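/- **Setting.** Let $k$ be an algebraically closed field of characteristic $0$, $n\ge 0$ an integer, $\ell\ge 1$ an odd integer and $q\in k$ a primitive $\ell$-th root of unity. Let $\Lambda=\mathbb Z^n$ with standard basis $\epsilon_1,\dots,\epsilon_n$, and put $$\alpha*\beta=\sum_{j<i}\alpha_i\beta_j,\qquad \theta(\alpha,\beta)=q^{\alpha*\beta-\beta*\alpha},\qquad \Lambda_+^{\le\kappa}=\{\alpha\in\Lambda : 0\le\alpha_i\le \ell-1 \text{ for all } i\}.$$ For $\alpha\in\Lambda$ let $[\alpha]\in\Lambda_+^{\le\kappa}$ be the tuple congruent to $\alpha$ modulo $\ell$ in each entry, let $\tilde\beta_i=\sum_{j\le i}\beta_j-\sum_{j>i}\beta_j$, and let $\kappa(\alpha,\beta)=[-\tilde\beta+2\beta-\alpha]$. The *$n$-rank Taft algebra* $\bar{\mathscr A}=\bar{\mathscr A}_q(n)$ is the $k$-algebra with generators $K(\epsilon_i)^{\pm1},x_i$ $(1\le i\le n)$ and relations: $K(\epsilon_i)K(\epsilon_i)^{-1}=K(\epsilon_i)^{-1}K(\epsilon_i)=1$, $K(\epsilon_i)K(\epsilon_j)=K(\epsilon_j)K(\epsilon_i)$,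 $K(\epsilon_i)^\ell=1$, $K(\epsilon_i)x_jK(\epsilon_i)^{-1}=\theta(\epsilon_i,\epsilon_j)q^{\delta_{ij}}x_j$, $x_ix_j=\theta(\epsilon_i,\epsilon_j)x_jx_i$, $x_i^\ell=0$. It is a Hopf algebra with $$\Delta(K(\epsilon_i)^{\pm1})=K(\epsilon_i)^{\pm1}\otimes K(\epsilon_i)^{\pm1},\quad \Delta(x_i)=x_i\otimes 1+K(\epsilon_i)\otimes x_i,\quad \varepsilon(K(\epsilon_i)^{\pm1})=1,\quad \varepsilon(x_i)=0,$$ $$s(K(\epsilon_i)^{\pm1})=K(\epsilon_i)^{\mp1},\qquad s(x_i)=-K(\epsilon_i)^{-1}x_i .$$ For $\alpha\in\Lambda$ let $K(\alpha)=\prod_iK(\epsilon_i)^{\alpha_i}$, and let $\mathfrak K(\alpha):\bar{\mathscr A}\to k$ be the algebra homomorphism (that is, the group-like element of $\bar{\mathscr A}^*$) with $\mathfrak K(\alpha)(K(\epsilon_i))=q^{\alpha_i}$ and $\mathfrak K(\alpha)(x_i)=0$. The *Drinfel'd double* $D(\bar{\mathscr A})=(\bar{\mathscr A}^*)^{\mathrm{cop}}\bowtie\bar{\mathscr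 A}$ is the Hopf algebra with underlying coalgebra $(\bar{\mathscr A}^*)^{\mathrm{cop}}\otimes\bar{\mathscr A}$, unit $\varepsilon\otimes1$, product $$(p\otimes h)(p'\otimes h')=p\,\bigl(h_{(1)}\rightharpoonup p'\leftharpoonup s^{-1}(h_{(3)})\bigr)\otimes h_{(2)}h',\qquad (h\rightharpoonup p\leftharpoonup l)(a)=p(l\,a\,h),$$ and antipode $S(p\otimes h)=(\varepsilon\otimes s(h))\,(p\circ s^{-1}\otimes 1)$. The *dual* of a $D(\bar{\mathscr A})$-module $M$ is $M^*=\mathrm{Hom}_k(M,k)$ with $(Xf)(m)=f(S(X)m)$, and $M$ is *self-dual* if $M\cong M^*$ as $D(\bar{\mathscr A})$-modules. For $\alpha\in\Lambda$, the double acts on the vector space $\bar{\mathscr A}$ by $(p\otimes h)\cdot a=p\rightharpoonup(h\bullet_{\mathfrak K(\alpha)}a)$, where $$h\bullet_{\mathfrak K(\alpha)}a=\mathfrak K(\alpha)(h_{(2)})\,h_{(3)}\,a\,s^{-1}(h_{(1)}),\qquad p\rightharpoonup a=p(a_{(2)})\,a_{(1)}.$$ For $\alpha,\beta\in\Lambda_+^{\le\kappa}$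 let $\bar{\mathscr A}_{\alpha,\beta}=\bar{\mathscr A}\bullet_{\mathfrak K(\alpha)}K(\beta)$, which is a $D(\bar{\mathscr A})$-submodule. **Theorem.** Put $i_0=(\ell+1)/2$. 1. Let $\alpha,\beta\in\Lambda_+^{\le\kappa}$. The $D(\bar{\mathscr A})$-module $\bar{\mathscr A}_{\alpha,\beta}$ is simple. It is self-dual if and only if there is a unique tuple $r=(r_1,\dots,r_n)\in\Lambda_+^{\le\kappa}$ such that $$\beta=[(i_0r_1,\dots,i_0r_n)]\qquad\text{and}\qquad\alpha=[-\tilde\beta].$$ If $r\in\Lambda_+^{\le\kappa}$ satisfies these two equations, then $\kappa(\alpha,\beta)=r$ and $\dim_k\bar{\mathscr A}_{\alpha,\beta}=(r_1+1)\cdots(r_n+1)$. 2. The self-dual simple $D(\bar{\mathscr A})$-modules are classified up to isomorphism by the tuple $\kappa(\alpha,\beta)\in\Lambda_+^{\le\kappa}$: two self-dual modules $\bar{\mathscr A}_{\alpha,\beta}$ and $\bar{\mathscr A}_{\alpha',\beta'}$ with $\alpha,\beta,\alpha',\beta'\in\Lambda_+^{\le\kappa}$ are isomorphic if and only if $\kappa(\alpha,\beta)=\kappa(\alpha',\beta')$;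 every $r\in\Lambda_+^{\le\kappa}$ equals $\kappa(\alpha,\beta)$ for some self-dual $\bar{\mathscr A}_{\alpha,\beta}$; and for every self-dual simple $D(\bar{\mathscr A})$-module $M$ there is exactly one $r\in\Lambda_+^{\le\kappa}$ such that $M\cong\bar{\mathscr A}_{\alpha,\beta}$ for some $\alpha,\beta\in\Lambda_+^{\le\kappa}$ with $\kappa(\alpha,\beta)=r$. -/

import Mathlib

set_option linter.unusedSectionVars false

open scoped TensorProduct

noncomputable section

/-- The inverse of the antipode of a Hopf algebra (it exists for every finite-dimensional one). -/
class HopfInverseAntipode (k H : Type*) [Field k] [Ring H] [HopfAlgebra k H] where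
  /-- the inverse antipode, as a linear map -/
  sinv : H →ₗ[k] H
  sinv_antipode : ∀ h : H, sinv (HopfAlgebra.antipode k h) = h
  antipode_sinv : ∀ h : H, HopfAlgebra.antipode k (sinv h) = h

namespace HopfDouble

open Coalgebra HopfAlgebra TensorProduct LinearMap WithConv

section bare

variable (k : Type*) {H : Type*} [Field k] [Ring H] [HopfAlgebra k H]

/-- The convolution algebra `H^*` : `(p q)(h) = p(h₍₁₎) q(h₍₂₎)`, with unit the counit. -/
abbrev HStar (k H : Type*) [Field k] [Ring H] [HopfAlgebra k H] : Type _ :=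
  WithConv (H →ₗ[k] k)

/-- The twofold comultiplication `h ↦ h₍₁₎ ⊗ (h₍₂₎ ⊗ h₍₃₎)`. -/
def comul₃ : H →ₗ[k] H ⊗[k] (H ⊗[k] H) := (comul (R := k)).lTensor H ∘ₗ comul (R := k)

theorem comul₃_mul (a b : H) : comul₃ k (a * b) = comul₃ k a * comul₃ k b := by
  have : ∀ t u : H ⊗[k] H, (comul (R := k)).lTensor H (t * u)
      = (comul (R := k)).lTensor H t * (comul (R := k)).lTensor H u := by
    intro t u
    induction t with
    | zero => simp
    | add _ _ h1 h2 => simp [add_mul, h1, h2]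
    | tmul a b =>
      induction u with
      | zero => simp
      | add _ _ h1 h2 => simp [mul_add, h1, h2]
      | tmul c d => simp
  simp [comul₃, this]

theorem comul₃_one : comul₃ k (1 : H) = 1 ⊗ₜ (1 ⊗ₜ 1) := by
  simp [comul₃, Algebra.TensorProduct.one_def]

theorem reassoc₅ :
    (TensorProduct.assoc k H H (H ⊗[k] (H ⊗[k] H))).symm.toLinearMap ∘ₗ
    LinearMap.lTensor H ((LinearMap.lTensor H (TensorProduct.assoc k H H H).toLinearMap) ∘ₗ
      (TensorProduct.assoc k H (H ⊗[k] H) H).toLinearMap) ∘ₗ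
    LinearMap.lTensor H (LinearMap.rTensor H (comul₃ k)) ∘ₗ comul₃ k
      = map (comul (R := k) (A := H)) (LinearMap.lTensor H (comul (R := k))) ∘ₗ comul₃ k := by
  simp only [comul₃, coassoc_simps]

theorem reassoc₇ :
    (LinearMap.lTensor (H ⊗[k] (H ⊗[k] H))
      (LinearMap.lTensor H (TensorProduct.assoc k H H H).toLinearMap ∘ₗ
        (TensorProduct.assoc k H (H ⊗[k] H) H).toLinearMap)) ∘ₗ
    (TensorProduct.assoc k H (H ⊗[k] H) ((H ⊗[k] (H ⊗[k] H)) ⊗[k] H)).symm.toLinearMap ∘ₗ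
    (LinearMap.lTensor H
      (TensorProduct.assoc k (H ⊗[k] H) (H ⊗[k] (H ⊗[k] H)) H).toLinearMap) ∘ₗ
    LinearMap.lTensor H (LinearMap.rTensor H
      (map (comul (R := k) (A := H)) (LinearMap.lTensor H (comul (R := k))) ∘ₗ comul₃ k)) ∘ₗ
      comul₃ k
      = map (comul₃ k (H := H)) (LinearMap.lTensor H (comul₃ k)) ∘ₗ comul₃ k := by
  simp only [comul₃, coassoc_simps]

theorem reassoc₄ :
    (LinearMap.lTensor H (TensorProduct.assoc k H H H).symm.toLinearMap) ∘ₗ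
      (TensorProduct.assoc k H H (H ⊗[k] H)).toLinearMap ∘ₗ
      map (comul (R := k)) (comul (R := k)) ∘ₗ comul (R := k)
      = LinearMap.lTensor H (LinearMap.rTensor H (comul (R := k) (A := H))) ∘ₗ comul₃ k := by
  simp only [comul₃, coassoc_simps]

theorem lTensor_counit_comul₃ (h : H) :
    LinearMap.lTensor H ((TensorProduct.lid k H).toLinearMap ∘ₗ
      LinearMap.rTensor H (counit (R := k) (A := H))) (comul₃ k h) = comul (R := k) (A := H) h := by
  have : (TensorProduct.lid k H).toLinearMap ∘ₗ
      LinearMap.rTensor H (counit (R := k) (A := H)) ∘ₗ comul (R := k) = LinearMap.id := by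
    ext h; simp
  have h2 : LinearMap.lTensor H ((TensorProduct.lid k H).toLinearMap ∘ₗ
      LinearMap.rTensor H (counit (R := k) (A := H)) ∘ₗ comul (R := k)) ∘ₗ comul (R := k)
      = comul (R := k) (A := H) := by
    rw [this]; simp
  have h3 := LinearMap.congr_fun h2 h
  simpa [comul₃, LinearMap.lTensor_comp] using h3

/-- The antipode reverses the comultiplication. -/
theorem comul_antipode : (comul (R := k)) ∘ₗ (antipode k : H →ₗ[k] H) =
    map (antipode k) (antipode k) ∘ₗ (TensorProduct.comm k H H).toLinearMap ∘ₗ comul (R := k) := by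
  apply WithConv.toConv_injective
  symm
  apply left_inv_eq_right_inv (a := toConv (comul (R := k) (A := H))) _ LinearMap.comul_right_inv
  let M : H ⊗[k] H →ₗ[k] H := LinearMap.mul' k H ∘ₗ (antipode k).rTensor H
  let E : H ⊗[k] ((H ⊗[k] H) ⊗[k] H) →ₗ[k] H ⊗[k] H :=
    map M M ∘ₗ (TensorProduct.leftComm k H (H ⊗[k] H) H).toLinearMap
  have h1 : LinearMap.mul' k (H ⊗[k] H) ∘ₗ map (map (antipode k) (antipode k) ∘ₗ
        (TensorProduct.comm k H H).toLinearMap) LinearMap.id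
      = E ∘ₗ (LinearMap.lTensor H (TensorProduct.assoc k H H H).symm.toLinearMap) ∘ₗ
      (TensorProduct.assoc k H H (H ⊗[k] H)).toLinearMap := by
    ext a b c d
    simp [E, M]
  have h2 : E ∘ₗ LinearMap.lTensor H (LinearMap.rTensor H (comul (R := k) (A := H)))
      = LinearMap.lTensor H M ∘ₗ (TensorProduct.mk k H (H ⊗[k] H) 1) ∘ₗ LinearMap.lTensor H
        ((TensorProduct.lid k H).toLinearMap ∘ₗ LinearMap.rTensor H (counit (R := k) (A := H))) := by
    ext a b c
    simp [E, M, Algebra.algebraMap_eq_smul_one, TensorProduct.smul_tmul]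
  ext h
  have h3 := LinearMap.congr_fun (reassoc₄ (H := H) k) h
  have h4 := LinearMap.congr_fun h1 (map (comul (R := k)) (comul (R := k)) (comul (R := k) h))
  have h5 := LinearMap.congr_fun h2 (comul₃ k h)
  simp only [LinearMap.comp_apply] at h3 h4 h5
  rw [h3, h5, lTensor_counit_comul₃] at h4
  simp only [LinearMap.convMul_apply, LinearMap.convOne_apply]
  have h6 : map (map (antipode k) (antipode k) ∘ₗ (TensorProduct.comm k H H).toLinearMap ∘ₗ
      comul (R := k)) (comul (R := k)) =
      map (map (antipode k) (antipode k) ∘ₗ (TensorProduct.comm k H H).toLinearMap)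
        LinearMap.id ∘ₗ (map (comul (R := k)) (comul (R := k) (A := H))) := by
    rw [← TensorProduct.map_comp]
    rfl
  rw [h6, LinearMap.comp_apply, h4]
  simp [M, Algebra.TensorProduct.one_def, Algebra.algebraMap_eq_smul_one]

end bare

section general

variable (k : Type*) {H : Type*} [Field k] [Ring H] [HopfAlgebra k H] [HopfInverseAntipode k H]

/-- The inverse antipode `s⁻¹`. -/
abbrev sinv : H →ₗ[k] H := HopfInverseAntipode.sinv

theorem antipode_injective : Function.Injective (antipode k : H →ₗ[k] H) :=
  Function.LeftInverse.injective HopfInverseAntipode.sinv_antipode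

theorem sinv_one : sinv k (1 : H) = 1 := by
  simpa using HopfInverseAntipode.sinv_antipode (k := k) (1 : H)

theorem sinv_mul (a b : H) : sinv k (a * b) = sinv k b * sinv k a := by
  apply antipode_injective k
  simp [antipode_mul_antidistrib, HopfInverseAntipode.antipode_sinv]

theorem counit_sinv (a : H) : counit (R := k) (sinv k a) = counit (R := k) a := by
  rw [← counit_antipode (R := k) (sinv k a), HopfInverseAntipode.antipode_sinv]

theorem comul_sinv (a : H) : comul (R := k) (sinv k a) =
    map (sinv k) (sinv k) (TensorProduct.comm k H H (comul (R := k) a)) := by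
  have h := LinearMap.congr_fun (comul_antipode (H := H) k) (sinv k a)
  simp only [LinearMap.comp_apply, HopfInverseAntipode.antipode_sinv] at h
  rw [h]
  have : ∀ t : H ⊗[k] H, map (sinv k) (sinv k) (TensorProduct.comm k H H
      (map (antipode k) (antipode k) ((TensorProduct.comm k H H).toLinearMap t))) = t := by
    intro t
    induction t with
    | zero => simp
    | add _ _ h1 h2 => simp only [map_add, h1, h2]
    | tmul a b => simp [HopfInverseAntipode.sinv_antipode]
  rw [this]

/-- `s⁻¹(h₍₂₎) h₍₁₎ = ε(h)`. -/
theorem sinv_mul_self (h : H) :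
    LinearMap.mul' k H ((sinv k).rTensor H (TensorProduct.comm k H H (comul (R := k) h)))
      = algebraMap k H (counit (R := k) h) := by
  apply antipode_injective k
  have : ∀ t : H ⊗[k] H, antipode k (LinearMap.mul' k H
      ((sinv k).rTensor H (TensorProduct.comm k H H t))) =
      LinearMap.mul' k H ((antipode k).rTensor H t) := by
    intro t
    induction t with
    | zero => simp
    | add _ _ h1 h2 => simp only [map_add, h1, h2]
    | tmul a b => simp [HopfInverseAntipode.antipode_sinv, antipode_mul_antidistrib]
  rw [this, mul_antipode_rTensor_comul_apply]
  simp [Algebra.algebraMap_eq_smul_one]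

/-- The map `q ↦ a ⇀ q ↼ s⁻¹(c)` on `H^*`, that is `q ↦ q(s⁻¹(c) · a)`. -/
def coadj (a c : H) : HStar k H →ₗ[k] HStar k H where
  toFun q := toConv (q.ofConv ∘ₗ LinearMap.mulLeft k (sinv k c) ∘ₗ LinearMap.mulRight k a)
  map_add' _ _ := rfl
  map_smul' _ _ := rfl

@[simp] theorem coadj_apply (a c : H) (q : HStar k H) (x : H) :
    (coadj k a c q).ofConv x = q.ofConv (sinv k c * (x * a)) := rfl

/-- The map `a ⊗ (b ⊗ c) ↦ (q ↦ (a ⇀ q ↼ s⁻¹(c)) ⊗ b)`. -/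
def twist : H ⊗[k] (H ⊗[k] H) →ₗ[k] HStar k H →ₗ[k] HStar k H ⊗[k] H :=
  TensorProduct.lift
    { toFun := fun a => TensorProduct.lift (LinearMap.mk₂ k
        (fun b c => (TensorProduct.mk k (HStar k H) H).flip b ∘ₗ coadj k a c)
        (by intros; ext; simp)
        (by intros; ext; simp)
        (by
          intro b c c'
          refine LinearMap.ext fun q => ?_
          have : coadj k a (c + c') q = coadj k a c q + coadj k a c' q := by
            ext; simp [add_mul]
          simp [this])
        (by
          intro r b c
          refine LinearMap.ext fun q => ?_
          have : coadj k a (r • c) q = r • coadj k a c q := by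
            ext; simp
          simp [this]))
      map_add' := by
        intro a a'
        refine TensorProduct.ext' fun b c => LinearMap.ext fun q => ?_
        have : coadj k (a + a') c q = coadj k a c q + coadj k a' c q := by
          ext; simp [mul_add]
        simp [this]
      map_smul' := by
        intro r a
        refine TensorProduct.ext' fun b c => LinearMap.ext fun q => ?_
        have : coadj k (r • a) c q = r • coadj k a c q := by
          ext; simp
        simp [this] }

@[simp] theorem twist_tmul (a b c : H) (q : HStar k H) :
    twist k (a ⊗ₜ (b ⊗ₜ c)) q = coadj k a c q ⊗ₜ b := rfl

/-- The product `(p ⊗ h)(q ⊗ l) = p (h₍₁₎ ⇀ q ↼ s⁻¹(h₍₃₎)) ⊗ h₍₂₎ l` on `H^* ⊗ H`. -/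
def dmul : HStar k H ⊗[k] H →ₗ[k] HStar k H ⊗[k] H →ₗ[k] HStar k H ⊗[k] H :=
  TensorProduct.lift (LinearMap.mk₂ k
    (fun p h => TensorProduct.lift (LinearMap.mk₂ k
      (fun q l => map (LinearMap.mulLeft k p) (LinearMap.mulRight k l) (twist k (comul₃ k h) q))
      (by intros; simp) (by intros; simp)
      (by
        intro q l l'
        rw [← LinearMap.add_apply, ← TensorProduct.map_add_right]
        congr 2; ext; simp [mul_add])
      (by
        intro c q l
        rw [← LinearMap.smul_apply, ← TensorProduct.map_smul_right]
        congr 2; ext; simp)))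
    (by
      intro p p' h; ext q l
      simp only [AlgebraTensorModule.curry_apply, restrictScalars_self, curry_apply, lift.tmul,
        mk₂_apply, LinearMap.add_apply]
      rw [← LinearMap.add_apply, ← TensorProduct.map_add_left]
      congr 2; ext1; simp only [LinearMap.mulLeft_apply, LinearMap.add_apply, add_mul])
    (by
      intro c p h; ext q l
      simp only [AlgebraTensorModule.curry_apply, restrictScalars_self, curry_apply, lift.tmul,
        mk₂_apply, LinearMap.smul_apply]
      rw [← LinearMap.smul_apply, ← TensorProduct.map_smul_left]
      congr 2; ext1; simp only [LinearMap.mulLeft_apply, LinearMap.smul_apply, smul_mul_assoc])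
    (by intros; ext; simp) (by intros; ext; simp))

theorem dmul_tmul (p q : HStar k H) (h l : H) : dmul k (p ⊗ₜ h) (q ⊗ₜ l) =
    map (LinearMap.mulLeft k p) (LinearMap.mulRight k l) (twist k (comul₃ k h) q) := rfl

theorem coadj_one_one (q : HStar k H) : coadj k 1 1 q = q := by
  ext; simp [sinv_one]

theorem coadj_coadj (a a' c c' : H) (q : HStar k H) :
    coadj k a c (coadj k a' c' q) = coadj k (a * a') (c * c') q := by
  ext; simp [sinv_mul, mul_assoc]

theorem twist_one (q : HStar k H) : twist k (comul₃ k (1 : H)) q = q ⊗ₜ 1 := by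
  rw [comul₃_one, twist_tmul, coadj_one_one]

theorem lTensor_twist_coadj (t : H ⊗[k] (H ⊗[k] H)) (a b c : H) (r : HStar k H) :
    LinearMap.lTensor _ (LinearMap.mulRight k b) (twist k t (coadj k a c r))
      = twist k (t * (a ⊗ₜ (b ⊗ₜ c))) r := by
  induction t with
  | zero => simp
  | add t t' h h' => simp only [map_add, LinearMap.add_apply, h, h', add_mul]
  | tmul x t =>
    induction t with
    | zero => simp
    | add t t' h h' =>
      simp only [map_add, LinearMap.add_apply, h, h', add_mul, TensorProduct.tmul_add]
    | tmul y z => simp [coadj_coadj]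

theorem dmul_lTensor (X Y : HStar k H ⊗[k] H) (l : H) :
    dmul k X (LinearMap.lTensor _ (LinearMap.mulRight k l) Y)
      = LinearMap.lTensor _ (LinearMap.mulRight k l) (dmul k X Y) := by
  induction X with
  | zero => simp
  | add t t' h h' => simp only [map_add, LinearMap.add_apply, h, h']
  | tmul p h =>
    induction Y with
    | zero => simp
    | add t t' h h' => simp only [map_add, h, h']
    | tmul q m =>
      rw [LinearMap.lTensor_tmul, dmul_tmul, dmul_tmul, ← LinearMap.comp_apply (LinearMap.lTensor _ _)]
      congr 1
      ext x y; simp [mul_assoc]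

theorem dmul_rTensor (X Y : HStar k H ⊗[k] H) (p : HStar k H) :
    dmul k (LinearMap.rTensor _ (LinearMap.mulLeft k p) X) Y
      = LinearMap.rTensor _ (LinearMap.mulLeft k p) (dmul k X Y) := by
  induction X with
  | zero => simp
  | add t t' h h' => simp only [map_add, LinearMap.add_apply, h, h']
  | tmul p h =>
    induction Y with
    | zero => simp
    | add t t' h h' => simp only [map_add, h, h']
    | tmul q m =>
      rw [LinearMap.rTensor_tmul, dmul_tmul, dmul_tmul, ← LinearMap.comp_apply (LinearMap.rTensor _ _)]
      congr 1
      refine TensorProduct.ext' fun x y => ?_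
      simp

theorem dmul_one_tmul (h : H) (q : HStar k H) :
    dmul k (1 ⊗ₜ h) (q ⊗ₜ 1) = twist k (comul₃ k h) q := by
  simp [dmul_tmul]

theorem dmul_tmul_one (p : HStar k H) (h : H) (q : HStar k H) :
    dmul k (p ⊗ₜ h) (q ⊗ₜ 1)
      = LinearMap.rTensor _ (LinearMap.mulLeft k p) (twist k (comul₃ k h) q) := by
  simp [dmul_tmul, LinearMap.rTensor]

theorem dmul_one_twist (h : H) (u : H ⊗[k] (H ⊗[k] H)) (r : HStar k H) :
    dmul k (1 ⊗ₜ h) (twist k u r) = twist k (comul₃ k h * u) r := by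
  induction u with
  | zero => simp
  | add t t' h h' => simp only [map_add, LinearMap.add_apply, h, h', mul_add]
  | tmul x t =>
    induction t with
    | zero => simp
    | add t t' h h' =>
      simp only [map_add, LinearMap.add_apply, h, h', mul_add, TensorProduct.tmul_add]
    | tmul y z =>
      rw [twist_tmul, ← lTensor_twist_coadj, ← dmul_one_tmul, ← dmul_lTensor]
      simp

theorem dmul_lTensor_one (X : HStar k H ⊗[k] H) (l : H) (r : HStar k H) :
    dmul k (LinearMap.lTensor _ (LinearMap.mulRight k l) X) (r ⊗ₜ 1)
      = dmul k X (twist k (comul₃ k l) r) := by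
  induction X with
  | zero => simp
  | add t t' h h' => simp only [map_add, LinearMap.add_apply, h, h']
  | tmul p h =>
    rw [LinearMap.lTensor_tmul, dmul_tmul_one, LinearMap.mulRight_apply, comul₃_mul,
      ← dmul_one_twist, ← dmul_rTensor]
    simp

/-- The bilinear map `(a, c) ↦ a ⇀ q ↼ s⁻¹(c)`. -/
def coadjL (q : HStar k H) : H ⊗[k] H →ₗ[k] HStar k H :=
  TensorProduct.lift (LinearMap.mk₂ k (fun a c => coadj k a c q)
    (by intros; ext; simp [mul_add]) (by intros; ext; simp)
    (by intros; ext; simp [add_mul]) (by intros; ext; simp))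

@[simp] theorem coadjL_tmul (q : HStar k H) (a c : H) :
    coadjL k q (a ⊗ₜ c) = coadj k a c q := rfl

theorem coadj_mul (a c : H) (q r : HStar k H) :
    coadj k a c (q * r) = LinearMap.mul' k (HStar k H) (map (coadjL k q) (coadjL k r)
      (TensorProduct.tensorTensorTensorComm k H H H H
        (comul (R := k) a ⊗ₜ TensorProduct.comm k H H (comul (R := k) c)))) := by
  ext x
  rw [coadj_apply]
  change LinearMap.mul' k k (map q.ofConv r.ofConv (comul (R := k) _)) = _
  rw [Bialgebra.comul_mul, Bialgebra.comul_mul, comul_sinv]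
  generalize comul (R := k) a = A
  generalize comul (R := k) c = C
  induction A with
  | zero => simp
  | add t t' h h' =>
    simp only [map_add, TensorProduct.add_tmul, mul_add, h, h', WithConv.ofConv_add,
      LinearMap.add_apply]
  | tmul a a' =>
    induction C with
    | zero => simp
    | add t t' h h' =>
      simp only [map_add, TensorProduct.tmul_add, add_mul, h, h', WithConv.ofConv_add,
        LinearMap.add_apply]
    | tmul c c' =>
      simp only [TensorProduct.comm_tmul, TensorProduct.tensorTensorTensorComm_tmul,
        TensorProduct.map_tmul, coadjL_tmul, LinearMap.mul'_apply]
      change _ = LinearMap.mul' k k (map _ _ (comul (R := k) x))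
      generalize comul (R := k) x = X
      induction X with
      | zero => simp
      | add t t' h h' => simp only [map_add, mul_add, add_mul, h, h']
      | tmul x x' => simp

/-- The map sending `(a ⊗ a') ⊗ (b ⊗ (c ⊗ c'))` to `(a ⇀ q ↼ s⁻¹(c')) (a' ⇀ r ↼ s⁻¹(c)) ⊗ b`. -/
def phiL (q r : HStar k H) : (H ⊗[k] H) ⊗[k] (H ⊗[k] (H ⊗[k] H)) →ₗ[k] HStar k H ⊗[k] H :=
  LinearMap.rTensor H (LinearMap.mul' k (HStar k H) ∘ₗ map (coadjL k q) (coadjL k r) ∘ₗ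
    (TensorProduct.tensorTensorTensorComm k H H H H).toLinearMap) ∘ₗ
  (TensorProduct.assoc k (H ⊗[k] H) (H ⊗[k] H) H).symm.toLinearMap ∘ₗ
  LinearMap.lTensor (H ⊗[k] H) ((LinearMap.rTensor H (TensorProduct.comm k H H).toLinearMap) ∘ₗ
    (TensorProduct.comm k H (H ⊗[k] H)).toLinearMap)

theorem phiL_tmul (q r : HStar k H) (a c : H ⊗[k] H) (b : H) :
    phiL k q r (a ⊗ₜ (b ⊗ₜ c)) = LinearMap.mul' k (HStar k H) (map (coadjL k q) (coadjL k r)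
      (TensorProduct.tensorTensorTensorComm k H H H H (a ⊗ₜ TensorProduct.comm k H H c))) ⊗ₜ b := by
  simp [phiL]

/-- The straightening map is compatible with the product of `H^*`. -/
theorem dmul_twist_one (h : H) (q r : HStar k H) :
    dmul k (twist k (comul₃ k h) q) (r ⊗ₜ 1) = twist k (comul₃ k h) (q * r) := by
  have h1 := LinearMap.congr_fun (reassoc₅ (H := H) k) h
  simp only [LinearMap.comp_apply] at h1
  generalize comul₃ k h = t at h1 ⊢
  have h2 : twist k t (q * r) =
      phiL k q r (map (comul (R := k) (A := H)) (LinearMap.lTensor H (comul (R := k))) t) := by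
    clear h1
    induction t with
    | zero => simp
    | add t t' h h' => simp only [map_add, LinearMap.add_apply, h, h']
    | tmul x t =>
      induction t with
      | zero => simp
      | add t t' h h' =>
        simp only [map_add, LinearMap.add_apply, h, h', TensorProduct.tmul_add]
      | tmul y z => simp [phiL_tmul, coadj_mul]
  rw [h2, ← h1]
  clear h1 h2
  induction t with
  | zero => simp
  | add t t' h h' => simp only [map_add, LinearMap.add_apply, h, h']
  | tmul x t =>
    induction t with
    | zero => simp
    | add t t' h h' =>
      simp only [map_add, LinearMap.add_apply, h, h', TensorProduct.tmul_add]
    | tmul y z =>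
      simp only [twist_tmul, dmul_tmul_one, LinearMap.lTensor_tmul, LinearMap.rTensor_tmul]
      generalize comul₃ k y = t
      induction t with
      | zero => simp
      | add t t' h h' =>
        simp only [map_add, LinearMap.add_apply, h, h', TensorProduct.tmul_add, TensorProduct.add_tmul]
      | tmul x t =>
        induction t with
        | zero => simp
        | add t t' h h' =>
          simp only [map_add, LinearMap.add_apply, h, h', TensorProduct.tmul_add, TensorProduct.add_tmul]
        | tmul y z => simp [phiL_tmul]

theorem dmul_assoc (X Y Z : HStar k H ⊗[k] H) :
    dmul k (dmul k X Y) Z = dmul k X (dmul k Y Z) := by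
  induction X with
  | zero => simp
  | add t t' h h' => simp only [map_add, LinearMap.add_apply, h, h']
  | tmul p h =>
  induction Y with
  | zero => simp
  | add t t' h h' => simp only [map_add, LinearMap.add_apply, h, h']
  | tmul q l =>
  induction Z with
  | zero => simp
  | add t t' h h' => simp only [map_add, h, h']
  | tmul r m =>
  have e1 : (p ⊗ₜ h : HStar k H ⊗[k] H) = LinearMap.rTensor _ (LinearMap.mulLeft k p) (1 ⊗ₜ h) := by
    simp
  have e2 : (r ⊗ₜ m : HStar k H ⊗[k] H) = LinearMap.lTensor _ (LinearMap.mulRight k m) (r ⊗ₜ 1) := by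
    simp
  have e3 : (q ⊗ₜ l : HStar k H ⊗[k] H) = LinearMap.lTensor _ (LinearMap.mulRight k l) (q ⊗ₜ 1) := by
    simp
  have e4 : ∀ Y, dmul k (twist k (comul₃ k h) q) Y
      = dmul k (1 ⊗ₜ h) (LinearMap.rTensor _ (LinearMap.mulLeft k q) Y) := by
    intro Y
    induction Y with
    | zero => simp
    | add t t' h h' => simp only [map_add, h, h']
    | tmul r m =>
      have e2 : (r ⊗ₜ m : HStar k H ⊗[k] H) =
        LinearMap.lTensor _ (LinearMap.mulRight k m) (r ⊗ₜ 1) := by simp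
      have e5 : LinearMap.rTensor H (LinearMap.mulLeft k q) (r ⊗ₜ m) =
        LinearMap.lTensor _ (LinearMap.mulRight k m) ((q * r) ⊗ₜ 1) := by simp
      rw [e5, e2, dmul_lTensor, dmul_lTensor, dmul_twist_one, dmul_one_tmul]
  rw [e1, e2]
  simp only [dmul_rTensor, dmul_lTensor]
  congr 2
  rw [dmul_tmul_one, e3, dmul_lTensor, dmul_one_tmul, dmul_lTensor_one, e4]

theorem counit_comul₃ (h : H) :
    TensorProduct.rid k H (LinearMap.lTensor H (counit (R := k) (A := H))
      (TensorProduct.lid k _ (LinearMap.rTensor _ (counit (R := k) (A := H)) (comul₃ k h)))) = h := by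
  have : ∀ t : H ⊗[k] H, TensorProduct.lid k _ (LinearMap.rTensor (H ⊗[k] H)
      (counit (R := k) (A := H)) (LinearMap.lTensor H (comul (R := k)) t)) =
      comul (R := k) (TensorProduct.lid k _ (LinearMap.rTensor H
      (counit (R := k) (A := H)) t)) := by
    intro t
    induction t with
    | zero => simp
    | add t t' h h' => simp only [map_add, h, h']
    | tmul x y => simp
  simp [comul₃, this]

theorem dmul_one (X : HStar k H ⊗[k] H) : dmul k X (1 ⊗ₜ 1) = X := by
  induction X with
  | zero => simp
  | add t t' h h' => simp only [map_add, LinearMap.add_apply, h, h']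
  | tmul p h =>
    rw [dmul_tmul_one]
    have : twist k (comul₃ k h) 1 = 1 ⊗ₜ h := by
      have e : ∀ t : H ⊗[k] (H ⊗[k] H), twist k t 1 = 1 ⊗ₜ
          (TensorProduct.rid k H (LinearMap.lTensor H (counit (R := k) (A := H))
          (TensorProduct.lid k _ (LinearMap.rTensor _ (counit (R := k) (A := H)) t)))) := by
        intro t
        induction t with
        | zero => simp
        | add t t' h h' => simp only [map_add, LinearMap.add_apply, h, h', TensorProduct.tmul_add]
        | tmul x t =>
          induction t with
          | zero => simp
          | add t t' h h' =>
            simp only [map_add, LinearMap.add_apply, h, h', TensorProduct.tmul_add]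
          | tmul y z =>
            have : coadj k x z 1 = (counit (R := k) x * counit (R := k) z) • (1 : HStar k H) := by
              ext w
              simp [counit_sinv]
              ring
            simp [this, TensorProduct.smul_tmul', mul_smul, smul_comm (counit (R := k) z) (counit (R := k) x)]
      rw [e]
      rw [counit_comul₃]
    rw [this]; simp

theorem one_dmul (X : HStar k H ⊗[k] H) : dmul k (1 ⊗ₜ 1) X = X := by
  induction X with
  | zero => simp
  | add t t' h h' => simp only [map_add, h, h']
  | tmul p h => rw [dmul_tmul, twist_one]; simp

/-- The collapse `a ⊗ c ↦ s⁻¹(c) a`. -/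
def sinvMul : H ⊗[k] H →ₗ[k] H :=
  LinearMap.mul' k H ∘ₗ (sinv k).rTensor H ∘ₗ (TensorProduct.comm k H H).toLinearMap

@[simp] theorem sinvMul_tmul (a c : H) : sinvMul k (a ⊗ₜ c) = sinv k c * a := rfl

theorem sinvMul_comul (h : H) :
    sinvMul k (comul (R := k) h) = algebraMap k H (counit (R := k) h) := sinv_mul_self k h

end general

/-- The underlying vector space `H^* ⊗ H` of the Drinfeld double `D(H) = (H^*)^cop ⋈ H`. -/
def Double (k H : Type*) [Field k] [Ring H] [HopfAlgebra k H] : Type _ := HStar k H ⊗[k] H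

section double

variable (k : Type*) {H : Type*} [Field k] [Ring H] [HopfAlgebra k H]

instance instAddCommGroupDouble : AddCommGroup (Double k H) := inferInstanceAs (AddCommGroup (HStar k H ⊗[k] H))
instance : Module k (Double k H) := inferInstanceAs (Module k (HStar k H ⊗[k] H))

/-- The element `p ⊗ h` of `D(H)`. -/
def Double.mk (p : HStar k H) (h : H) : Double k H := p ⊗ₜ[k] h

@[elab_as_elim] theorem Double.induction {P : Double k H → Prop} (zero : P 0)
    (mk : ∀ p h, P (Double.mk k p h)) (add : ∀ X Y, P X → P Y → P (X + Y)) (X : Double k H) : P X :=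
  TensorProduct.induction_on X zero mk add

variable [HopfInverseAntipode k H]

/-- The product of the Drinfeld double:
`(p ⊗ h)(q ⊗ l) = p (h₍₁₎ ⇀ q ↼ s⁻¹(h₍₃₎)) ⊗ h₍₂₎ l`, with unit `ε ⊗ 1`. -/
instance : Ring (Double k H) :=
  { instAddCommGroupDouble k with
    mul := fun X Y => dmul k X Y
    one := Double.mk k 1 1
    left_distrib := fun X Y Z => (dmul k X).map_add Y Z
    right_distrib := fun X Y Z => LinearMap.congr_fun ((dmul k).map_add X Y) Z
    zero_mul := fun X => LinearMap.congr_fun (dmul k).map_zero X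
    mul_zero := fun X => (dmul k X).map_zero
    mul_assoc := dmul_assoc k
    one_mul := one_dmul k
    mul_one := dmul_one k }

instance : Algebra k (Double k H) :=
  Algebra.ofModule (fun c X Y => LinearMap.congr_fun ((dmul k).map_smul c X) Y)
    (fun c X Y => (dmul k X).map_smul c Y)

theorem Double.mul_def (X Y : Double k H) : X * Y = dmul k X Y := rfl

theorem Double.mk_mul_mk (p q : HStar k H) (h l : H) : Double.mk k p h * Double.mk k q l =
    map (LinearMap.mulLeft k p) (LinearMap.mulRight k l) (twist k (comul₃ k h) q) := rfl

/-- The transpose `p ↦ p ∘ s⁻¹` of the inverse antipode, the antipode of `(H^*)^cop`. -/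
def dualSinv : HStar k H →ₗ[k] HStar k H where
  toFun p := toConv (p.ofConv ∘ₗ sinv k)
  map_add' _ _ := rfl
  map_smul' _ _ := rfl

@[simp] theorem dualSinv_apply (p : HStar k H) (x : H) :
    (dualSinv k p).ofConv x = p.ofConv (sinv k x) := rfl

theorem dualSinv_one : dualSinv k (1 : HStar k H) = 1 := by
  ext x; simp [counit_sinv]

theorem dualSinv_mul (p q : HStar k H) :
    dualSinv k (p * q) = dualSinv k q * dualSinv k p := by
  ext x
  change LinearMap.mul' k k (map p.ofConv q.ofConv (comul (R := k) (sinv k x))) =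
    LinearMap.mul' k k (map _ _ (comul (R := k) x))
  rw [comul_sinv]
  generalize comul (R := k) x = X
  induction X with
  | zero => simp
  | add t t' h h' => simp only [map_add, h, h']
  | tmul x x' => simp [mul_comm]

/-- The antipode of the Drinfeld double: `S(p ⊗ h) = (ε ⊗ s(h)) (p ∘ s⁻¹ ⊗ 1)`. -/
def Double.antipode : Double k H →ₗ[k] Double k H :=
  TensorProduct.lift (LinearMap.mk₂ k
    (fun (p : HStar k H) (h : H) => (Double.mk k 1 (HopfAlgebra.antipode k h) *
      Double.mk k (dualSinv k p) 1 : Double k H))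
    (by intro p p' h; rw [map_add, ← mul_add]; congr 1; exact TensorProduct.add_tmul _ _ _)
    (by intro c p h; rw [map_smul, ← mul_smul_comm]; congr 1)
    (by intro p h h'; rw [map_add, ← add_mul]; congr 1; exact TensorProduct.tmul_add _ _ _)
    (by intro c p h; rw [map_smul, ← smul_mul_assoc]; congr 1; exact TensorProduct.tmul_smul _ _ _))

theorem Double.antipode_mk (p : HStar k H) (h : H) : Double.antipode k (Double.mk k p h) =
    Double.mk k 1 (HopfAlgebra.antipode k h) * Double.mk k (dualSinv k p) 1 := rfl

theorem Double.mk_eq (p : HStar k H) (h : H) :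
    Double.mk k p h = Double.mk k p 1 * Double.mk k 1 h := by
  rw [Double.mk_mul_mk, twist_one]; simp [Double.mk]; rfl

theorem Double.mk_one_mul (h l : H) :
    (Double.mk k 1 (h * l) : Double k H) = Double.mk k 1 h * Double.mk k 1 l := by
  have := dmul_lTensor k (1 ⊗ₜ h : HStar k H ⊗[k] H) (1 ⊗ₜ 1) l
  rw [dmul_one] at this
  rw [LinearMap.lTensor_tmul, LinearMap.lTensor_tmul, LinearMap.mulRight_apply,
    LinearMap.mulRight_apply, one_mul] at this
  exact this.symm

theorem Double.mk_mul_one (p q : HStar k H) :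
    (Double.mk k (p * q) 1 : Double k H) = Double.mk k p 1 * Double.mk k q 1 := by
  rw [Double.mk_mul_mk, twist_one]; simp [Double.mk]; rfl

theorem comul₃_antipode (h : H) : comul₃ k (HopfAlgebra.antipode k h) =
    map (HopfAlgebra.antipode k) (map (HopfAlgebra.antipode k) (HopfAlgebra.antipode k))
      ((TensorProduct.assoc k H H H) (LinearMap.rTensor H (TensorProduct.comm k H H).toLinearMap
      (TensorProduct.comm k H (H ⊗[k] H) (comul₃ k h)))) := by
  have e : comul₃ k h = TensorProduct.assoc k H H H
      (LinearMap.rTensor H (comul (R := k)) (comul (R := k) h)) := (coassoc_apply h).symm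
  have e2 := LinearMap.congr_fun (comul_antipode (H := H) k) h
  simp only [LinearMap.comp_apply] at e2
  rw [e, comul₃, LinearMap.comp_apply, e2]
  generalize comul (R := k) h = t
  induction t with
  | zero => simp
  | add t t' h h' => simp only [map_add, h, h']
  | tmul x y =>
    have e2 := LinearMap.congr_fun (comul_antipode (H := H) k) x
    simp only [LinearMap.comp_apply] at e2
    simp only [LinearEquiv.coe_coe, _root_.TensorProduct.comm_tmul, _root_.TensorProduct.map_tmul, lTensor_tmul, rTensor_tmul, e2]
    generalize comul (R := k) x = t
    induction t with
    | zero => simp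
    | add t t' h h' =>
      simp only [map_add, TensorProduct.tmul_add, TensorProduct.add_tmul, h, h']
    | tmul x y => simp

/-- The map `u ⊗ (b ⊗ v) ↦ (x ↦ q(v s⁻¹(x) u)) ⊗ s(b)`. -/
def antiAux (q : HStar k H) : H ⊗[k] (H ⊗[k] H) →ₗ[k] HStar k H ⊗[k] H :=
  map (TensorProduct.lift (LinearMap.mk₂ k (fun u v : H =>
    (toConv (q.ofConv ∘ₗ LinearMap.mulLeft k v ∘ₗ LinearMap.mulRight k u ∘ₗ sinv k) : HStar k H))
      (by intros; ext; simp [mul_add]) (by intros; ext; simp)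
      (by intros; ext; simp [add_mul]) (by intros; ext; simp))) (HopfAlgebra.antipode k) ∘ₗ
  (TensorProduct.assoc k H H H).symm.toLinearMap ∘ₗ
  LinearMap.lTensor H (TensorProduct.comm k H H).toLinearMap

theorem antiAux_tmul (q : HStar k H) (u b v : H) : antiAux k q (u ⊗ₜ (b ⊗ₜ v)) =
    (toConv (q.ofConv ∘ₗ LinearMap.mulLeft k v ∘ₗ LinearMap.mulRight k u ∘ₗ sinv k) : HStar k H)
      ⊗ₜ HopfAlgebra.antipode k b := rfl

theorem antipode_twist (h : H) (q : HStar k H) :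
    Double.antipode k (twist k (comul₃ k h) q) =
      Double.mk k (dualSinv k q) (HopfAlgebra.antipode k h) := by
  have h1 := LinearMap.congr_fun (reassoc₅ (H := H) k) h
  have h0 := counit_comul₃ k h
  simp only [LinearMap.comp_apply] at h1
  generalize comul₃ k h = t at h1 h0 ⊢
  have h2 : Double.mk k (dualSinv k q) (HopfAlgebra.antipode k h) =
      antiAux k q (map (sinvMul k) (LinearMap.lTensor H (sinvMul k))
        (map (comul (R := k) (A := H)) (LinearMap.lTensor H (comul (R := k))) t)) := by
    clear h1
    rw [← h0]
    clear h0
    induction t with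
    | zero => simp [Double.mk]; rfl
    | add t t' h h' =>
      simp only [map_add, ← h, ← h']
      exact TensorProduct.tmul_add _ _ _
    | tmul x t =>
      induction t with
      | zero => simp [Double.mk]; rfl
      | add t t' h h' =>
        simp only [map_add, TensorProduct.tmul_add, ← h, ← h']
        exact TensorProduct.tmul_add _ _ _
      | tmul y z =>
        simp only [_root_.TensorProduct.map_tmul, lTensor_tmul, rTensor_tmul, sinvMul_comul, antiAux_tmul, _root_.TensorProduct.lid_tmul,
          _root_.TensorProduct.rid_tmul, TensorProduct.smul_tmul', map_smul]
        unfold Double.mk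
        rw [← TensorProduct.smul_tmul, ← TensorProduct.smul_tmul]
        congr 1
        ext w
        simp [Algebra.algebraMap_eq_smul_one]
  rw [h2, ← h1]
  clear h0 h1 h2
  induction t with
  | zero => simp; rfl
  | add t t' h h' =>
    simp only [map_add, LinearMap.add_apply, ← h, ← h']
    exact map_add (Double.antipode k) _ _
  | tmul x t =>
    induction t with
    | zero => simp; rfl
    | add t t' h h' =>
      simp only [map_add, LinearMap.add_apply, TensorProduct.tmul_add, ← h, ← h']
      exact map_add (Double.antipode k) _ _
    | tmul y z =>
      rw [twist_tmul]
      change Double.antipode k (Double.mk k _ _) = _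
      rw [Double.antipode_mk]
      change dmul k (1 ⊗ₜ _) (_ ⊗ₜ 1) = _
      rw [dmul_one_tmul, comul₃_antipode]
      simp only [lTensor_tmul, rTensor_tmul]
      generalize comul₃ k y = t
      induction t with
      | zero => simp
      | add t t' h h' =>
        simp only [map_add, LinearMap.add_apply, TensorProduct.tmul_add, TensorProduct.add_tmul, h, h']
      | tmul a t =>
        induction t with
        | zero => simp
        | add t t' h h' =>
          simp only [map_add, LinearMap.add_apply, TensorProduct.tmul_add, TensorProduct.add_tmul, h, h']
        | tmul b c =>
          simp only [LinearMap.comp_apply, LinearEquiv.coe_coe, _root_.TensorProduct.comm_tmul, rTensor_tmul, _root_.TensorProduct.assoc_tmul,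
            _root_.TensorProduct.map_tmul, twist_tmul, lTensor_tmul, _root_.TensorProduct.assoc_symm_tmul, antiAux_tmul, sinvMul_tmul]
          congr 1
          ext w
          simp [sinv_mul, HopfInverseAntipode.sinv_antipode, mul_assoc]

theorem Double.antipode_one : Double.antipode k (1 : Double k H) = 1 := by
  change Double.antipode k (Double.mk k 1 1) = _
  rw [Double.antipode_mk, dualSinv_one, HopfAlgebra.antipode_one]
  exact one_mul (1 : Double k H)

theorem Double.antipode_mul (X Y : Double k H) :
    Double.antipode k (X * Y) = Double.antipode k Y * Double.antipode k X := by
  have sw : ∀ (p : HStar k H) (l : H) (Z : Double k H),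
      Double.antipode k (Double.mk k p 1 * Z * Double.mk k 1 l) =
      Double.mk k 1 (HopfAlgebra.antipode k l) * Double.antipode k Z *
        Double.mk k (dualSinv k p) 1 := by
    intro p l Z
    induction Z using Double.induction k with
    | zero => simp
    | add X Y hX hY => simp only [map_add, mul_add, add_mul, hX, hY]
    | mk q h =>
      have : Double.mk k p 1 * Double.mk k q h * Double.mk k 1 l = Double.mk k (p * q) (h * l) := by
        rw [Double.mk_eq k q h, Double.mk_eq k (p * q), Double.mk_one_mul, Double.mk_mul_one]
        simp only [mul_assoc]
      rw [this, Double.antipode_mk, Double.antipode_mk, dualSinv_mul, antipode_mul_antidistrib,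
        Double.mk_one_mul, Double.mk_mul_one]
      simp only [mul_assoc]
  induction X using Double.induction k with
  | zero => simp
  | add X Y hX hY => simp only [map_add, mul_add, add_mul, hX, hY]
  | mk p h =>
  induction Y using Double.induction k with
  | zero => simp
  | add X Y hX hY => simp only [map_add, mul_add, add_mul, hX, hY]
  | mk q l =>
    have e : Double.mk k p h * Double.mk k q l = Double.mk k p 1 *
        (Double.mk k 1 h * Double.mk k q 1) * Double.mk k 1 l := by
      rw [Double.mk_eq k q l, Double.mk_eq k p h]
      simp only [mul_assoc]
    have e2 : Double.mk k 1 h * Double.mk k q 1 = (twist k (comul₃ k h) q : Double k H) :=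
      dmul_one_tmul k h q
    rw [e, sw, e2, antipode_twist, Double.antipode_mk, Double.antipode_mk,
      Double.mk_eq k (dualSinv k q) (HopfAlgebra.antipode k h)]
    simp only [mul_assoc]

/-- The dual space `M^*` of a `D(H)`-module `M`, with the action `(X f)(m) = f(S(X) m)`. -/
def Contragredient (k H M : Type*) [Field k] [Ring H] [HopfAlgebra k H] [AddCommGroup M]
    [Module k M] : Type _ := Module.Dual k M

/-- The linear form underlying an element of the contragredient module. -/
def Contragredient.toDual {k H M : Type*} [Field k] [Ring H] [HopfAlgebra k H] [AddCommGroup M]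
    [Module k M] (f : Contragredient k H M) : Module.Dual k M := f

section contragredient

variable (M : Type*) [AddCommGroup M] [Module k M] [Module (Double k H) M]
  [IsScalarTower k (Double k H) M]

instance : AddCommGroup (Contragredient k H M) := inferInstanceAs (AddCommGroup (Module.Dual k M))

instance : Module (Double k H) (Contragredient k H M) where
  smul X f := f.toDual ∘ₗ Algebra.lsmul k k M (Double.antipode k X)
  one_smul f := LinearMap.ext fun m => by
    change f.toDual (Double.antipode k (1 : Double k H) • m) = _
    rw [Double.antipode_one, one_smul]
    rfl
  mul_smul X Y f := LinearMap.ext fun m => by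
    change f.toDual (Double.antipode k (X * Y) • m) =
      f.toDual (Double.antipode k Y • Double.antipode k X • m)
    rw [Double.antipode_mul, mul_smul]
  smul_zero X := LinearMap.zero_comp _
  smul_add X f g := LinearMap.add_comp _ _ _
  add_smul X Y f := LinearMap.ext fun m => by
    change f.toDual (Double.antipode k (X + Y) • m) =
      f.toDual (Double.antipode k X • m) +
      f.toDual (Double.antipode k Y • m)
    rw [map_add, add_smul, map_add]
  zero_smul f := LinearMap.ext fun m => by
    change f.toDual (Double.antipode k (0 : Double k H) • m) = 0
    rw [map_zero, zero_smul, map_zero]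

theorem Contragredient.smul_apply (X : Double k H) (f : Contragredient k H M) (m : M) :
    (X • f).toDual m = f.toDual (Double.antipode k X • m) := rfl

variable (H) in
/-- A `D(H)`-module is self-dual if it is isomorphic to its dual as a `D(H)`-module. -/
def IsSelfDual : Prop := Nonempty (M ≃ₗ[Double k H] Contragredient k H M)

end contragredient

/-- The left action of `H^*` on `H` coming from the right coaction `Δ`: `p ⇀ a = a₍₁₎ p(a₍₂₎)`. -/
def hit (p : HStar k H) : H →ₗ[k] H :=
  (TensorProduct.rid k H).toLinearMap ∘ₗ LinearMap.lTensor H p.ofConv ∘ₗ comul (R := k)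

variable {k} in
/-- The map `x ⊗ (y ⊗ z) ↦ (a ↦ χ(y) z a s⁻¹(x))`. -/
def bulletAux (χ : H →ₐ[k] k) : H ⊗[k] (H ⊗[k] H) →ₗ[k] H →ₗ[k] H :=
  TensorProduct.lift
    { toFun := fun x => TensorProduct.lift (LinearMap.mk₂ k
        (fun y z => χ y • (LinearMap.mulLeft k z ∘ₗ LinearMap.mulRight k (sinv k x)))
        (by intros; rw [map_add, add_smul]) (by intros; rw [map_smul, smul_eq_mul, mul_smul])
        (by intros; ext; simp [add_mul])
        (by intro c y z; ext w; simp [smul_smul, mul_comm]))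
      map_add' := by
        intros; refine TensorProduct.ext' fun b c => LinearMap.ext fun q => ?_; simp [mul_add]
      map_smul' := by
        intros; refine TensorProduct.ext' fun b c => LinearMap.ext fun q => ?_
        simp [smul_smul, mul_comm] }

@[simp] theorem bulletAux_tmul (χ : H →ₐ[k] k) (x y z a : H) :
    bulletAux χ (x ⊗ₜ (y ⊗ₜ z)) a = χ y • (z * (a * sinv k x)) := rfl

variable {k} in
/-- The action `h • a = (h₍₂₎ ↼ χ) a s⁻¹(h₍₁₎) = χ(h₍₂₎) h₍₃₎ a s⁻¹(h₍₁₎)` of `H` on itself, for a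
group-like element `χ` of the dual Hopf algebra, i.e. an algebra homomorphism `χ : H → k`. -/
def bullet (χ : H →ₐ[k] k) : H →ₗ[k] H →ₗ[k] H := bulletAux χ ∘ₗ comul₃ k

theorem bullet_one (χ : H →ₐ[k] k) (a : H) : bullet χ 1 a = a := by
  simp [bullet, comul₃_one, sinv_one]

theorem bullet_mul (χ : H →ₐ[k] k) (h l a : H) : bullet χ (h * l) a = bullet χ h (bullet χ l a) := by
  simp only [bullet, LinearMap.comp_apply, comul₃_mul]
  generalize comul₃ k h = t
  generalize comul₃ k l = u
  induction t with
  | zero => simp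
  | add t t' h h' => simp only [map_add, add_mul, LinearMap.add_apply, h, h']
  | tmul x t =>
  induction t with
  | zero => simp
  | add t t' h h' => simp only [map_add, add_mul, LinearMap.add_apply, TensorProduct.tmul_add, h, h']
  | tmul y z =>
  induction u with
  | zero => simp
  | add t t' h h' => simp only [map_add, mul_add, LinearMap.add_apply, h, h']
  | tmul x' t =>
  induction t with
  | zero => simp
  | add t t' h h' => simp only [map_add, mul_add, LinearMap.add_apply, TensorProduct.tmul_add, h, h']
  | tmul y' z' => simp [sinv_mul, smul_smul, mul_assoc, mul_comm (χ y')]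

theorem hit_one (a : H) : hit k 1 a = a := by
  have : ∀ t : H ⊗[k] H, TensorProduct.rid k H (LinearMap.lTensor H
      ((1 : HStar k H).ofConv) t) =
      TensorProduct.rid k H (LinearMap.lTensor H (counit (R := k)) t) := by
    intro t
    induction t with
    | zero => simp
    | add t t' h h' => simp only [map_add, h, h']
    | tmul x y => simp
  simp [hit, this]

theorem hit_mul (p q : HStar k H) (a : H) : hit k (p * q) a = hit k p (hit k q a) := by
  have e : ∀ t : H ⊗[k] H, LinearMap.lTensor H p.ofConv (comul (R := k)
      (TensorProduct.rid k H (LinearMap.lTensor H q.ofConv t))) =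
      LinearMap.lTensor H (LinearMap.mul' k k ∘ₗ map p.ofConv q.ofConv)
        (TensorProduct.assoc k H H H (LinearMap.rTensor H (comul (R := k)) t)) := by
    intro t
    induction t with
    | zero => simp
    | add t t' h h' => simp only [map_add, h, h']
    | tmul x y =>
      simp only [LinearMap.lTensor_tmul, LinearMap.rTensor_tmul, _root_.TensorProduct.rid_tmul,
        map_smul]
      generalize comul (R := k) x = t
      induction t with
      | zero => simp
      | add t t' h h' =>
        simp only [map_add, TensorProduct.add_tmul, smul_add, h, h']
      | tmul x y => simp [TensorProduct.smul_tmul', TensorProduct.smul_tmul, mul_comm (q.ofConv _)]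
  have e2 : (p * q).ofConv = LinearMap.mul' k k ∘ₗ map p.ofConv q.ofConv ∘ₗ comul (R := k) := rfl
  simp only [hit, LinearMap.comp_apply, LinearEquiv.coe_coe]
  rw [e, coassoc_apply, e2, ← LinearMap.comp_assoc, LinearMap.lTensor_comp]
  rfl

variable {k} in
/-- The map `U ⊗ (y ⊗ Z) ↦ χ(y) Z A σ(U)`. -/
def sandwich (χ : H →ₐ[k] k) (A : H ⊗[k] H) (σ : H ⊗[k] H →ₗ[k] H ⊗[k] H) :
    (H ⊗[k] H) ⊗[k] (H ⊗[k] (H ⊗[k] H)) →ₗ[k] H ⊗[k] H :=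
  TensorProduct.lift (LinearMap.mk₂ k
    (fun U w => TensorProduct.lid k _ (map χ.toLinearMap (LinearMap.mulRight k (A * σ U)) w))
    (by
      intro U U' w
      have e : LinearMap.mulRight k (A * σ (U + U')) =
          LinearMap.mulRight k (A * σ U) + LinearMap.mulRight k (A * σ U') :=
        LinearMap.ext fun x => by simp only [LinearMap.mulRight_apply, LinearMap.add_apply, map_add, mul_add]
      rw [e, TensorProduct.map_add_right, LinearMap.add_apply, map_add])
    (by
      intro c U w
      have e : LinearMap.mulRight k (A * σ (c • U)) = c • LinearMap.mulRight k (A * σ U) :=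
        LinearMap.ext fun x => by
          simp only [LinearMap.mulRight_apply, LinearMap.smul_apply, map_smul, mul_smul_comm]
      rw [e, TensorProduct.map_smul_right, LinearMap.smul_apply, map_smul])
    (by intros; simp) (by intros; simp))

theorem sandwich_tmul (χ : H →ₐ[k] k) (A : H ⊗[k] H) (σ : H ⊗[k] H →ₗ[k] H ⊗[k] H)
    (U Z : H ⊗[k] H) (y : H) :
    sandwich χ A σ (U ⊗ₜ (y ⊗ₜ Z)) = χ y • (Z * (A * σ U)) := by
  simp only [sandwich, TensorProduct.lift.tmul, LinearMap.mk₂_apply, _root_.TensorProduct.map_tmul,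
    LinearMap.mulRight_apply, _root_.TensorProduct.lid_tmul]
  rfl

theorem comul_bullet (χ : H →ₐ[k] k) (h a : H) : comul (R := k) (bullet χ h a) =
    sandwich χ (comul (R := k) a) (map (sinv k) (sinv k) ∘ₗ (TensorProduct.comm k H H).toLinearMap)
      (map (comul (R := k) (A := H)) (LinearMap.lTensor H (comul (R := k))) (comul₃ k h)) := by
  simp only [bullet, LinearMap.comp_apply]
  generalize comul₃ k h = t
  induction t with
  | zero => simp
  | add t t' h h' => simp only [map_add, LinearMap.add_apply, h, h']
  | tmul x t =>
  induction t with
  | zero => simp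
  | add t t' h h' => simp only [map_add, LinearMap.add_apply, TensorProduct.tmul_add, h, h']
  | tmul y z =>
    simp only [bulletAux_tmul, map_smul, Bialgebra.comul_mul, _root_.TensorProduct.map_tmul,
      LinearMap.lTensor_tmul, sandwich_tmul, comul_sinv]
    rfl

variable {k} in
/-- The action of `H^* ⊗ H` on `H`: `(p ⊗ h) a = p ⇀ (h • a)`. -/
def actL (χ : H →ₐ[k] k) : HStar k H ⊗[k] H →ₗ[k] H →ₗ[k] H :=
  TensorProduct.lift (LinearMap.mk₂ k (fun p h => hit k p ∘ₗ bullet χ h)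
    (by
      intro p p' h; ext a
      simp only [hit, LinearMap.comp_apply, LinearMap.add_apply, WithConv.ofConv_add,
        LinearMap.lTensor_add, map_add])
    (by
      intro c p h; ext a
      simp only [hit, LinearMap.comp_apply, LinearMap.smul_apply, WithConv.ofConv_smul,
        LinearMap.lTensor_smul, map_smul])
    (by intros; ext; simp) (by intros; ext; simp))

@[simp] theorem actL_tmul (χ : H →ₐ[k] k) (p : HStar k H) (h a : H) :
    actL χ (p ⊗ₜ h) a = hit k p (bullet χ h a) := rfl

theorem collapse_left (h : H) : LinearMap.rTensor H (sinvMul k)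
    ((TensorProduct.assoc k H H H).symm (comul₃ k h)) = 1 ⊗ₜ h := by
  have e : (TensorProduct.assoc k H H H).symm (comul₃ k h) =
      LinearMap.rTensor H (comul (R := k)) (comul (R := k) h) := by
    rw [LinearEquiv.symm_apply_eq]; exact (coassoc_apply h).symm
  have e2 : sinvMul k ∘ₗ comul (R := k) = Algebra.linearMap k H ∘ₗ counit (R := k) := by
    ext x; simp [sinvMul_comul]
  rw [e, ← LinearMap.comp_apply, ← LinearMap.rTensor_comp, e2, LinearMap.rTensor_comp,
    LinearMap.comp_apply, rTensor_counit_comul]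
  simp

theorem collapse_right (h : H) : LinearMap.lTensor H (sinvMul k) (comul₃ k h) = h ⊗ₜ 1 := by
  have e2 : sinvMul k ∘ₗ comul (R := k) = Algebra.linearMap k H ∘ₗ counit (R := k) := by
    ext x; simp [sinvMul_comul]
  rw [comul₃, ← LinearMap.comp_apply, ← LinearMap.comp_assoc, ← LinearMap.lTensor_comp, e2,
    LinearMap.lTensor_comp, LinearMap.comp_apply, LinearMap.comp_apply, lTensor_counit_comul]
  simp

/-- The compatibility of action and coaction. -/
theorem actL_twist (χ : H →ₐ[k] k) (h : H) (q : HStar k H) (a : H) :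
    actL χ (twist k (comul₃ k h) q) a = bullet χ h (hit k q a) := by
  let σ : H ⊗[k] H →ₗ[k] H ⊗[k] H :=
    LinearMap.rTensor H (sinv k) ∘ₗ (TensorProduct.comm k H H).toLinearMap
  let ev : H ⊗[k] H →ₗ[k] H := (TensorProduct.rid k H).toLinearMap ∘ₗ LinearMap.lTensor H q.ofConv
  let C : H ⊗[k] (H ⊗[k] H) →ₗ[k] H ⊗[k] H :=
    LinearMap.rTensor H (sinvMul k) ∘ₗ (TensorProduct.assoc k H H H).symm.toLinearMap
  let Φ : (H ⊗[k] (H ⊗[k] H)) ⊗[k] (H ⊗[k] (H ⊗[k] (H ⊗[k] H))) →ₗ[k] H :=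
    ev ∘ₗ sandwich χ (comul (R := k) a) σ ∘ₗ
      map C (LinearMap.lTensor H (LinearMap.lTensor H (sinvMul k)))
  have h1 := LinearMap.congr_fun (reassoc₇ (H := H) k) h
  simp only [LinearMap.comp_apply] at h1
  rw [bullet, LinearMap.comp_apply]
  generalize comul₃ k h = t at h1 ⊢
  have h2 : bulletAux χ t (hit k q a) =
      Φ (map (comul₃ k (H := H)) (LinearMap.lTensor H (comul₃ k)) t) := by
    clear h1
    induction t with
    | zero => simp
    | add t t' h h' => simp only [map_add, LinearMap.add_apply, h, h']
    | tmul x t =>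
    induction t with
    | zero => simp
    | add t t' h h' => simp only [map_add, LinearMap.add_apply, TensorProduct.tmul_add, h, h']
    | tmul y z =>
      simp only [Φ, C, LinearMap.comp_apply, _root_.TensorProduct.map_tmul, LinearMap.lTensor_tmul,
        LinearEquiv.coe_coe, collapse_left, collapse_right, sandwich_tmul, bulletAux_tmul, hit,
        map_smul]
      congr 1
      generalize comul (R := k) a = A
      induction A with
      | zero => simp
      | add t t' h h' => simp only [map_add, mul_add, add_mul, h, h']
      | tmul m m' => simp [σ, ev]
  rw [h2, ← h1]
  clear h1 h2
  induction t with
  | zero => simp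
  | add t t' h h' => simp only [map_add, LinearMap.add_apply, h, h']
  | tmul x t =>
  induction t with
  | zero => simp
  | add t t' h h' => simp only [map_add, LinearMap.add_apply, TensorProduct.tmul_add, h, h']
  | tmul b c =>
    simp only [twist_tmul, actL_tmul, hit, LinearMap.comp_apply, comul_bullet,
      LinearMap.lTensor_tmul, LinearMap.rTensor_tmul]
    generalize map (comul (R := k) (A := H)) (LinearMap.lTensor H (comul (R := k)))
      (comul₃ k b) = u
    induction u with
    | zero => simp
    | add t t' h h' =>
      simp only [map_add, TensorProduct.tmul_add, TensorProduct.add_tmul, h, h']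
    | tmul X w =>
    induction w with
    | zero => simp
    | add t t' h h' =>
      simp only [map_add, TensorProduct.tmul_add, TensorProduct.add_tmul, h, h']
    | tmul y Z =>
    induction X with
    | zero => simp
    | add t t' h h' =>
      simp only [map_add, TensorProduct.tmul_add, TensorProduct.add_tmul, h, h']
    | tmul x₁ x₂ =>
    induction Z with
    | zero => simp
    | add t t' h h' =>
      simp only [map_add, TensorProduct.tmul_add, TensorProduct.add_tmul, h, h']
    | tmul z₁ z₂ =>
      simp only [Φ, C, LinearMap.comp_apply, _root_.TensorProduct.map_tmul, LinearMap.lTensor_tmul,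
        LinearEquiv.coe_coe, sandwich_tmul, _root_.TensorProduct.assoc_tmul,
        _root_.TensorProduct.assoc_symm_tmul, LinearMap.rTensor_tmul, sinvMul_tmul, map_smul]
      congr 1
      generalize comul (R := k) a = A
      induction A with
      | zero => simp
      | add t t' h h' => simp only [map_add, mul_add, add_mul, h, h']
      | tmul m m' => simp [σ, ev, mul_assoc]

theorem actL_one (χ : H →ₐ[k] k) (a : H) : actL χ (1 ⊗ₜ 1) a = a := by
  rw [actL_tmul, bullet_one, hit_one]

theorem actL_mul (χ : H →ₐ[k] k) (X Y : HStar k H ⊗[k] H) (a : H) :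
    actL χ (dmul k X Y) a = actL χ X (actL χ Y a) := by
  induction X with
  | zero => simp
  | add X X' h h' => simp only [map_add, LinearMap.add_apply, h, h']
  | tmul p h =>
  induction Y with
  | zero => simp
  | add X X' h h' => simp only [map_add, LinearMap.add_apply, h, h']
  | tmul q l =>
    rw [actL_tmul, actL_tmul, ← actL_twist, dmul_tmul]
    generalize twist k (comul₃ k h) q = t
    induction t with
    | zero => simp
    | add t t' h h' => simp only [map_add, LinearMap.add_apply, h, h']
    | tmul r m => simp [hit_mul, bullet_mul]

/-- The Yetter-Drinfeld module `H_χ = (H, •, Δ)` as a module over the Drinfeld double; its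
underlying vector space is `H`. -/
def Twisted (k H : Type*) [Field k] [Ring H] [HopfAlgebra k H] (_χ : H →ₐ[k] k) : Type _ := H

section twisted

variable {k} (χ : H →ₐ[k] k)

instance : AddCommGroup (Twisted k H χ) := inferInstanceAs (AddCommGroup H)
instance : Module k (Twisted k H χ) := inferInstanceAs (Module k H)

/-- The action of `D(H)` on `H_χ`: `(p ⊗ h) a = p ⇀ (h • a)`. -/
instance : Module (Double k H) (Twisted k H χ) where
  smul X a := actL χ X a
  one_smul a := actL_one k χ a
  mul_smul X Y a := actL_mul k χ X Y a
  smul_zero X := (actL χ X).map_zero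
  smul_add X a b := (actL χ X).map_add a b
  add_smul X Y a := LinearMap.congr_fun ((actL χ).map_add X Y) a
  zero_smul a := LinearMap.congr_fun (actL χ).map_zero a

instance : IsScalarTower k (Double k H) (Twisted k H χ) where
  smul_assoc c X a := LinearMap.congr_fun ((actL χ).map_smul c X) a

theorem Twisted.mk_smul (p : HStar k H) (h : H) (a : Twisted k H χ) :
    Double.mk k p h • a = hit k p (bullet χ h a) := rfl

theorem hit_bullet_groupLike (g : GroupLike k H) (p : HStar k H) (h : H) :
    ∃ l : H, hit k p (bullet χ h g.val) = bullet χ l g.val := by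
  have h1 := LinearMap.congr_fun (reassoc₅ (H := H) k) h
  simp only [LinearMap.comp_apply] at h1
  rw [hit, LinearMap.comp_apply, LinearMap.comp_apply, comul_bullet, ← h1,
    g.isGroupLikeElem_val.comul_eq_tmul_self]
  clear h1
  generalize comul₃ k h = t
  induction t with
  | zero => exact ⟨0, by simp⟩
  | add t t' h h' =>
    obtain ⟨l, hl⟩ := h
    obtain ⟨l', hl'⟩ := h'
    exact ⟨l + l', by simp only [map_add, LinearMap.add_apply, hl, hl']⟩
  | tmul x t =>
  induction t with
  | zero => exact ⟨0, by simp⟩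
  | add t t' h h' =>
    obtain ⟨l, hl⟩ := h
    obtain ⟨l', hl'⟩ := h'
    exact ⟨l + l', by simp only [map_add, TensorProduct.tmul_add, LinearMap.add_apply, hl, hl']⟩
  | tmul b c =>
    refine ⟨p.ofConv (c * (g.val * sinv k x)) • b, ?_⟩
    rw [map_smul, LinearMap.smul_apply, bullet, LinearMap.comp_apply]
    simp only [LinearMap.lTensor_tmul, LinearMap.rTensor_tmul]
    generalize comul₃ k b = t
    induction t with
    | zero => simp
    | add t t' h h' =>
      simp only [map_add, TensorProduct.tmul_add, TensorProduct.add_tmul, LinearMap.add_apply,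
        smul_add, h, h']
    | tmul u t =>
    induction t with
    | zero => simp
    | add t t' h h' =>
      simp only [map_add, TensorProduct.tmul_add, TensorProduct.add_tmul, LinearMap.add_apply,
        smul_add, h, h']
    | tmul v w =>
      simp [sandwich_tmul, smul_smul, mul_comm]

theorem actL_bullet_groupLike (g : GroupLike k H) (X : HStar k H ⊗[k] H) (h : H) :
    ∃ l : H, bullet χ l g.val = actL χ X (bullet χ h g.val) := by
  induction X with
  | zero => exact ⟨0, by simp⟩
  | add t t' h h' =>
    obtain ⟨l, hl⟩ := h
    obtain ⟨l', hl'⟩ := h'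
    exact ⟨l + l', by simp only [map_add, LinearMap.add_apply, hl, hl']⟩
  | tmul p m =>
    obtain ⟨l, hl⟩ := hit_bullet_groupLike χ g p (m * h)
    exact ⟨l, by rw [actL_tmul, ← bullet_mul, hl]⟩

/-- The Yetter-Drinfeld submodule `H_{χ,g} = H • g` of `H_χ`, for a group-like element `g` of `H`,
as a `D(H)`-submodule. -/
def orbit (g : GroupLike k H) : Submodule (Double k H) (Twisted k H χ) where
  carrier := Set.range fun h : H => (bullet χ h g.val : H)
  zero_mem' := ⟨0, by simp; rfl⟩
  add_mem' := by
    rintro _ _ ⟨a, rfl⟩ ⟨b, rfl⟩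
    exact ⟨a + b, by simp; rfl⟩
  smul_mem' := by
    rintro X _ ⟨a, rfl⟩
    exact actL_bullet_groupLike χ g X a

end twisted

end double

end HopfDouble

namespace TaftAlgebra

section qbinom

variable {k : Type*} [Field k]

/-- Gaussian binomial coefficients. -/
def gaussBinom (q : k) : ℕ → ℕ → k
  | _, 0 => 1
  | 0, _ + 1 => 0
  | m + 1, j + 1 => gaussBinom q m j + q ^ (j + 1) * gaussBinom q m (j + 1)

theorem gaussBinom_zero_right (q : k) (m : ℕ) : gaussBinom q m 0 = 1 := by
  cases m <;> rfl

theorem gaussBinom_eq_zero (q : k) (m : ℕ) : ∀ j, m < j → gaussBinom q m j = 0 := by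
  induction m with
  | zero =>
    intro j hj
    obtain ⟨j, rfl⟩ := Nat.exists_eq_succ_of_ne_zero hj.ne'
    rfl
  | succ m ih =>
    intro j hj
    obtain ⟨j, rfl⟩ := Nat.exists_eq_succ_of_ne_zero (by omega : j ≠ 0)
    simp [gaussBinom, ih j (by omega), ih (j + 1) (by omega)]

theorem gaussBinom_self (q : k) (m : ℕ) : gaussBinom q m m = 1 := by
  induction m with
  | zero => rfl
  | succ m ih => simp [gaussBinom, ih, gaussBinom_eq_zero q m (m + 1) (by omega)]

theorem gaussBinom_absorb (q : k) (m : ℕ) : ∀ j, (q ^ (j + 1) - 1) * gaussBinom q (m + 1) (j + 1)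
    = (q ^ (m + 1) - 1) * gaussBinom q m j := by
  induction m with
  | zero =>
    intro j
    cases j with
    | zero => simp [gaussBinom]
    | succ j => simp [gaussBinom]
  | succ m ih =>
    intro j
    have h1 := ih j
    rw [gaussBinom]
    cases j with
    | zero =>
      simp only [gaussBinom_zero_right] at h1 ⊢
      linear_combination q * h1
    | succ j =>
      have h2 := ih j
      have h3 : gaussBinom q (m + 1) (j + 1) =
        gaussBinom q m j + q ^ (j + 1) * gaussBinom q m (j + 1) := rfl
      linear_combination q ^ (j + 2) * h1 + q * h2 - q * (q ^ (m + 1) - 1) * h3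

variable {R : Type*} [Ring R] [Algebra k R]

theorem pow_mul_q_comm {q : k} {a b : R} (h : b * a = q • (a * b)) (j : ℕ) :
    b ^ j * a = q ^ j • (a * b ^ j) := by
  induction j with
  | zero => simp
  | succ j ih =>
    rw [pow_succ, mul_assoc, h, mul_smul_comm, ← mul_assoc, ih, smul_mul_assoc, smul_smul,
      mul_assoc, ← pow_succ']

theorem q_add_pow {q : k} {a b : R} (h : b * a = q • (a * b)) (m : ℕ) :
    (a + b) ^ m = ∑ j ∈ Finset.range (m + 1), gaussBinom q m j • (a ^ (m - j) * b ^ j) := by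
  induction m with
  | zero => simp [gaussBinom]
  | succ m ih =>
    rw [pow_succ, ih, mul_add, Finset.sum_mul, Finset.sum_mul, Finset.sum_range_succ' _ (m + 1)]
    have e1 : ∀ j ∈ Finset.range (m + 1), gaussBinom q m j • (a ^ (m - j) * b ^ j) * a =
        (gaussBinom q m j * q ^ j) • (a ^ (m + 1 - j) * b ^ j) := by
      intro j hj
      have : m + 1 - j = m - j + 1 := by
        have := Finset.mem_range.1 hj; omega
      rw [smul_mul_assoc, mul_assoc, pow_mul_q_comm h, mul_smul_comm, smul_smul, this, pow_succ,
        mul_assoc]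
    have e2 : ∑ j ∈ Finset.range (m + 1), (gaussBinom q m j * q ^ j) • (a ^ (m + 1 - j) * b ^ j) =
        ∑ j ∈ Finset.range (m + 2), (gaussBinom q m j * q ^ j) • (a ^ (m + 1 - j) * b ^ j) := by
      rw [Finset.sum_range_succ _ (m + 1), gaussBinom_eq_zero q m (m + 1) (by omega)]
      simp
    rw [Finset.sum_congr rfl e1, e2, Finset.sum_range_succ' _ (m + 1), add_right_comm,
      ← Finset.sum_add_distrib]
    congr 1
    · refine Finset.sum_congr rfl fun j _ => ?_
      have : m + 1 - (j + 1) = m - j := by omega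
      rw [this, smul_mul_assoc, mul_assoc, ← pow_succ, ← add_smul, gaussBinom]
      congr 1
      ring
    · simp [gaussBinom_zero_right]

theorem q_add_pow_eq {q : k} {ℓ : ℕ} [NeZero ℓ] (hq : IsPrimitiveRoot q ℓ) {a b : R}
    (h : b * a = q • (a * b)) : (a + b) ^ ℓ = a ^ ℓ + b ^ ℓ := by
  obtain ⟨m, rfl⟩ := Nat.exists_eq_succ_of_ne_zero (NeZero.ne ℓ)
  rw [q_add_pow h, Finset.sum_range_succ, Finset.sum_range_succ', Finset.sum_eq_zero]
  · simp [gaussBinom_zero_right, gaussBinom_self]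
  · intro j hj
    have hj := Finset.mem_range.1 hj
    have h1 := gaussBinom_absorb q m j
    rw [hq.pow_eq_one, sub_self, zero_mul, mul_eq_zero, sub_eq_zero] at h1
    rcases h1 with h1 | h1
    · exact absurd h1 (hq.pow_ne_one_of_pos_of_lt (by omega) (by omega))
    · rw [h1, zero_smul]

theorem exists_mul_pow {q : k} {a b : R} (h : b * a = q • (a * b)) (m : ℕ) :
    ∃ c : k, (a * b) ^ m = c • (a ^ m * b ^ m) := by
  induction m with
  | zero => exact ⟨1, by simp⟩
  | succ m ih =>
    obtain ⟨c, hc⟩ := ih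
    refine ⟨c * q ^ m, ?_⟩
    rw [pow_succ, hc, smul_mul_assoc, mul_assoc, ← mul_assoc (b ^ m), pow_mul_q_comm h,
      smul_mul_assoc, mul_smul_comm, smul_smul, pow_succ a, pow_succ b]
    simp only [mul_assoc]

end qbinom

section defs

/-- The bilinear form `α * β = ∑_{j < i} α_i β_j` on `Λ = ℤⁿ`. -/
def star {n : ℕ} (α β : Fin n → ℤ) : ℤ := ∑ j, ∑ i ∈ Finset.univ.filter (fun i => j < i), α i * β j

variable {k : Type*} [Field k]

/-- The skew bicharacter `θ(α, β) = q^(α * β - β * α)`. -/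
def theta {n : ℕ} (q : k) (α β : Fin n → ℤ) : k := q ^ (star α β - star β α)

/-- The basis vector `ε_i` of `Λ = ℤⁿ`. -/
def eps {n : ℕ} (i : Fin n) : Fin n → ℤ := Pi.single i 1

theorem theta_self {n : ℕ} (q : k) (α : Fin n → ℤ) : theta q α α = 1 := by simp [theta]

theorem theta_mul_theta {n : ℕ} {q : k} (hq : q ≠ 0) (α β : Fin n → ℤ) :
    theta q α β * theta q β α = 1 := by
  rw [theta, theta, ← zpow_add₀ hq]; simp

/-- The scalar `θ(ε_i, ε_j) q^(δ_ij)`. -/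
def coef {n : ℕ} (q : k) (i j : Fin n) : k := theta q (eps i) (eps j) * if i = j then q else 1

theorem coef_self {n : ℕ} (q : k) (i : Fin n) : coef q i i = q := by simp [coef, theta_self]

theorem coef_ne_zero {n : ℕ} {q : k} (hq : q ≠ 0) (i j : Fin n) : coef q i j ≠ 0 := by
  unfold coef theta
  split_ifs <;> simp [hq, zpow_ne_zero]

theorem coef_eq {n : ℕ} {q : k} (hq : q ≠ 0) (i j : Fin n) :
    coef q i j = theta q (eps i) (eps j) * coef q j i * theta q (eps i) (eps j) := by
  have h := theta_mul_theta hq (eps i) (eps j)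
  have : (if j = i then q else 1) = if i = j then q else 1 := by simp only [eq_comm]
  rw [coef, coef, this]
  linear_combination (-theta q (eps i) (eps j) * if i = j then q else 1) * h

/-- The generators `K(ε_i)`, `K(ε_i)⁻¹`, `x_i`. -/
inductive Gen (n : ℕ) : Type
  | K (i : Fin n) : Gen n
  | Kinv (i : Fin n) : Gen n
  | x (i : Fin n) : Gen n

open Gen FreeAlgebra in
/-- The defining relations of the `n`-rank Taft algebra. -/
inductive Rel (q : k) (ℓ n : ℕ) : FreeAlgebra k (Gen n) → FreeAlgebra k (Gen n) → Prop
  | K_comm (i j) : Rel q ℓ n (ι k (K i) * ι k (K j)) (ι k (K j) * ι k (K i))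
  | K_Kinv (i) : Rel q ℓ n (ι k (K i) * ι k (Kinv i)) 1
  | Kinv_K (i) : Rel q ℓ n (ι k (Kinv i) * ι k (K i)) 1
  | K_pow (i) : Rel q ℓ n (ι k (K i) ^ ℓ) 1
  | K_x (i j) : Rel q ℓ n (ι k (K i) * ι k (x j) * ι k (Kinv i))
      ((theta q (eps i) (eps j) * if i = j then q else 1) • ι k (x j))
  | x_x (i j) : Rel q ℓ n (ι k (x i) * ι k (x j))
      (theta q (eps i) (eps j) • (ι k (x j) * ι k (x i)))
  | x_pow (i) : Rel q ℓ n (ι k (x i) ^ ℓ) 0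

/-- The `n`-rank Taft algebra `Ā_q(n)`, where `q` is a primitive `ℓ`-th root of unity. -/
def Taft (q : k) (ℓ n : ℕ) : Type _ := RingQuot (Rel q ℓ n)

variable (q : k) (ℓ n : ℕ)

instance : Ring (Taft q ℓ n) := inferInstanceAs (Ring (RingQuot (Rel q ℓ n)))
instance : Algebra k (Taft q ℓ n) := inferInstanceAs (Algebra k (RingQuot (Rel q ℓ n)))

/-- The projection from the free algebra. -/
def Taft.proj : FreeAlgebra k (Gen n) →ₐ[k] Taft q ℓ n := RingQuot.mkAlgHom k (Rel q ℓ n)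

/-- The images of the generators in the Taft algebra. -/
def Taft.gen (g : Gen n) : Taft q ℓ n := Taft.proj q ℓ n (FreeAlgebra.ι k g)

variable {q ℓ n}

theorem Taft.proj_rel {a b : FreeAlgebra k (Gen n)} (h : Rel q ℓ n a b) :
    Taft.proj q ℓ n a = Taft.proj q ℓ n b := RingQuot.mkAlgHom_rel k h

variable (q ℓ n) in
/-- The relations of the Taft algebra, for a family of elements of an algebra. -/
structure Sat {B : Type*} [Ring B] [Algebra k B] (f : Gen n → B) : Prop where
  K_comm (i j) : f (.K i) * f (.K j) = f (.K j) * f (.K i)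
  K_Kinv (i) : f (.K i) * f (.Kinv i) = 1
  Kinv_K (i) : f (.Kinv i) * f (.K i) = 1
  K_pow (i) : f (.K i) ^ ℓ = 1
  K_x (i j) : f (.K i) * f (.x j) = coef q i j • (f (.x j) * f (.K i))
  x_x (i j) : f (.x i) * f (.x j) = theta q (eps i) (eps j) • (f (.x j) * f (.x i))
  x_pow (i) : f (.x i) ^ ℓ = 0

theorem Taft.sat : Sat q ℓ n (Taft.gen q ℓ n) where
  K_comm i j := by simpa [Taft.gen] using Taft.proj_rel (Rel.K_comm (q := q) (ℓ := ℓ) i j)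
  K_Kinv i := by simpa [Taft.gen] using Taft.proj_rel (Rel.K_Kinv (q := q) (ℓ := ℓ) i)
  Kinv_K i := by simpa [Taft.gen] using Taft.proj_rel (Rel.Kinv_K (q := q) (ℓ := ℓ) i)
  K_pow i := by simpa [Taft.gen] using Taft.proj_rel (Rel.K_pow (q := q) (ℓ := ℓ) i)
  K_x i j := by
    have h := Taft.proj_rel (Rel.K_x (q := q) (ℓ := ℓ) i j)
    have h2 := Taft.proj_rel (Rel.Kinv_K (q := q) (ℓ := ℓ) i)
    simp only [map_mul, map_smul, map_one] at h h2
    change Taft.gen q ℓ n _ * Taft.gen q ℓ n _ * Taft.gen q ℓ n _ =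
      coef q i j • Taft.gen q ℓ n _ at h
    change Taft.gen q ℓ n _ * Taft.gen q ℓ n _ = 1 at h2
    rw [← smul_mul_assoc, ← h, mul_assoc, h2, mul_one]
  x_x i j := by simpa [Taft.gen] using Taft.proj_rel (Rel.x_x (q := q) (ℓ := ℓ) i j)
  x_pow i := by simpa [Taft.gen] using Taft.proj_rel (Rel.x_pow (q := q) (ℓ := ℓ) i)

section lift

variable {B : Type*} [Ring B] [Algebra k B]

/-- The algebra homomorphism out of the Taft algebra given by images of the generators. -/
def Taft.lift (f : Gen n → B) (hf : Sat q ℓ n f) : Taft q ℓ n →ₐ[k] B :=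
  RingQuot.liftAlgHom k ⟨FreeAlgebra.lift k f, by
    intro a b h
    induction h with
    | K_comm i j => simpa using hf.K_comm i j
    | K_Kinv i => simpa using hf.K_Kinv i
    | Kinv_K i => simpa using hf.Kinv_K i
    | K_pow i => simpa using hf.K_pow i
    | K_x i j =>
      have h : f (.K i) * f (.x j) * f (.Kinv i) = coef q i j • f (.x j) := by
        rw [hf.K_x, smul_mul_assoc, mul_assoc, hf.K_Kinv, mul_one]
      simp only [map_mul, FreeAlgebra.lift_ι_apply, map_smul]
      exact h
    | x_x i j => simpa using hf.x_x i j
    | x_pow i => simpa using hf.x_pow i⟩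

@[simp] theorem Taft.lift_gen (f : Gen n → B) (hf : Sat q ℓ n f) (g : Gen n) :
    Taft.lift f hf (Taft.gen q ℓ n g) = f g := by
  have := RingQuot.liftAlgHom_mkAlgHom_apply k (FreeAlgebra.lift k f) (s := Rel q ℓ n)
  simp only [Taft.lift, Taft.gen, Taft.proj]
  exact (this _ _).trans (FreeAlgebra.lift_ι_apply f g)

theorem Taft.hom_ext {f g : Taft q ℓ n →ₐ[k] B}
    (h : ∀ a, f (Taft.gen q ℓ n a) = g (Taft.gen q ℓ n a)) : f = g :=
  RingQuot.ringQuot_ext' k (s := Rel q ℓ n) f g (FreeAlgebra.hom_ext (funext h))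

theorem Taft.induction {P : Taft q ℓ n → Prop} (scalar : ∀ r, P (algebraMap k _ r))
    (gen : ∀ g, P (Taft.gen q ℓ n g)) (mul : ∀ a b, P a → P b → P (a * b))
    (add : ∀ a b, P a → P b → P (a + b)) (a : Taft q ℓ n) : P a := by
  obtain ⟨a, rfl⟩ := RingQuot.mkAlgHom_surjective k (Rel q ℓ n) a
  change P (Taft.proj q ℓ n a)
  induction a using FreeAlgebra.induction with
  | grade0 r => rw [AlgHom.commutes]; exact scalar r
  | grade1 g => exact gen g
  | mul a b ha hb => rw [map_mul]; exact mul _ _ ha hb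
  | add a b ha hb => rw [map_add]; exact add _ _ ha hb

end lift

section sat

variable {B : Type*} [Ring B] [Algebra k B] {f : Gen n → B}

theorem Sat.Kinv_comm (hf : Sat q ℓ n f) (i j : Fin n) :
    f (.Kinv i) * f (.Kinv j) = f (.Kinv j) * f (.Kinv i) := by
  have h1 : IsUnit (f (.K j) * f (.K i)) :=
    ⟨⟨f (.K j) * f (.K i), f (.Kinv i) * f (.Kinv j), by
      rw [mul_assoc, ← mul_assoc (f (.K i)), hf.K_Kinv, one_mul, hf.K_Kinv], by
      rw [mul_assoc, ← mul_assoc (f (.Kinv j)), hf.Kinv_K, one_mul, hf.Kinv_K]⟩, rfl⟩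
  apply h1.mul_left_cancel
  rw [mul_assoc, ← mul_assoc (f (.K i)), hf.K_Kinv, one_mul, hf.K_Kinv, hf.K_comm, mul_assoc,
    ← mul_assoc (f (.K j)), hf.K_Kinv, one_mul, hf.K_Kinv]

theorem Sat.Kinv_pow (hf : Sat q ℓ n f) (i : Fin n) : f (.Kinv i) ^ ℓ = 1 := by
  have h : (f (.K i) * f (.Kinv i)) ^ ℓ = f (.K i) ^ ℓ * f (.Kinv i) ^ ℓ :=
    Commute.mul_pow ((hf.K_Kinv i).trans (hf.Kinv_K i).symm) ℓ
  rw [hf.K_Kinv, one_pow, hf.K_pow, one_mul] at h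
  exact h.symm

/-- `x_j K_i⁻¹ = θ(ε_i, ε_j) q^(δ_ij) K_i⁻¹ x_j`. -/
theorem Sat.x_Kinv (hf : Sat q ℓ n f) (i j : Fin n) :
    f (.x j) * f (.Kinv i) = coef q i j • (f (.Kinv i) * f (.x j)) := by
  have h := congrArg (fun t => f (.Kinv i) * t * f (.Kinv i)) (hf.K_x i j)
  simp only [mul_smul_comm, smul_mul_assoc] at h
  rw [← mul_assoc, hf.Kinv_K, one_mul, mul_assoc (f (.Kinv i)), mul_assoc (f (.x j)), hf.K_Kinv,
    mul_one] at h
  exact h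

/-- The images of the generators under the antipode, in the opposite algebra. -/
def antiGen (f : Gen n → B) : Gen n → Bᵐᵒᵖ
  | .K i => MulOpposite.op (f (.Kinv i))
  | .Kinv i => MulOpposite.op (f (.K i))
  | .x i => MulOpposite.op (-(f (.Kinv i) * f (.x i)))

/-- The images of the generators under the inverse antipode, in the opposite algebra. -/
def antiGen' (f : Gen n → B) : Gen n → Bᵐᵒᵖ
  | .K i => MulOpposite.op (f (.Kinv i))
  | .Kinv i => MulOpposite.op (f (.K i))
  | .x i => MulOpposite.op (-(f (.x i) * f (.Kinv i)))

theorem Sat.anti (hq : q ≠ 0) (hf : Sat q ℓ n f) : Sat q ℓ n (antiGen f) where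
  K_comm i j := by simp only [antiGen, ← MulOpposite.op_mul, hf.Kinv_comm]
  K_Kinv i := by simp only [antiGen, ← MulOpposite.op_mul, hf.K_Kinv, MulOpposite.op_one]
  Kinv_K i := by simp only [antiGen, ← MulOpposite.op_mul, hf.Kinv_K, MulOpposite.op_one]
  K_pow i := by simp only [antiGen, ← MulOpposite.op_pow, hf.Kinv_pow, MulOpposite.op_one]
  K_x i j := by
    simp only [antiGen, ← MulOpposite.op_mul, ← MulOpposite.op_smul]
    congr 1
    rw [neg_mul, mul_neg, smul_neg, mul_assoc, hf.x_Kinv, mul_smul_comm, ← mul_assoc, ← mul_assoc,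
      hf.Kinv_comm]
  x_x i j := by
    simp only [antiGen, ← MulOpposite.op_mul, ← MulOpposite.op_smul]
    congr 1
    rw [neg_mul_neg, neg_mul_neg, mul_assoc, ← mul_assoc (f (.x j)), hf.x_Kinv, mul_assoc,
      ← mul_assoc (f (.x i)), hf.x_Kinv]
    simp only [smul_mul_assoc, mul_smul_comm, mul_assoc]
    rw [hf.x_x i j]
    simp only [mul_smul_comm, smul_smul]
    rw [← mul_assoc, ← mul_assoc, hf.Kinv_comm j i, coef_eq hq i j, mul_assoc]
    simp only [mul_assoc]
  x_pow i := by
    simp only [antiGen, ← MulOpposite.op_pow]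
    have h := hf.x_Kinv i i
    obtain ⟨c, hc⟩ := exists_mul_pow h ℓ
    rw [neg_pow, hc, hf.x_pow]
    simp

theorem Sat.anti' (hq : q ≠ 0) (hf : Sat q ℓ n f) : Sat q ℓ n (antiGen' f) := by
  have e : antiGen' f = fun g => match g with
      | .K i => antiGen f (.K i)
      | .Kinv i => antiGen f (.Kinv i)
      | .x i => q • antiGen f (.x i) := by
    funext g
    cases g with
    | K i => rfl
    | Kinv i => rfl
    | x i =>
      simp only [antiGen, antiGen', hf.x_Kinv, coef_self, ← MulOpposite.op_smul, smul_neg]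
  rw [e]
  have h := hf.anti hq
  exact
  { K_comm := h.K_comm
    K_Kinv := h.K_Kinv
    Kinv_K := h.Kinv_K
    K_pow := h.K_pow
    K_x := fun i j => by
      simp only [mul_smul_comm, smul_mul_assoc, h.K_x, smul_comm q]
    x_x := fun i j => by
      simp only [mul_smul_comm, smul_mul_assoc, h.x_x i j, smul_comm q]
    x_pow := fun i => by simp only [smul_pow, h.x_pow, smul_zero] }

end sat

end defs

section hopf

variable {k : Type*} [Field k] {q : k} {ℓ n : ℕ}

open Coalgebra HopfAlgebra HopfDouble

theorem q_ne_zero [NeZero ℓ] (hq : IsPrimitiveRoot q ℓ) : q ≠ 0 := hq.ne_zero (NeZero.ne ℓ)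

/-- `Δ(K) = K ⊗ K` and `Δ(x_i) = x_i ⊗ 1 + K(ε_i) ⊗ x_i` on generators. -/
def comulGen (q : k) (ℓ n : ℕ) : Gen n → Taft q ℓ n ⊗[k] Taft q ℓ n
  | .K i => Taft.gen q ℓ n (.K i) ⊗ₜ Taft.gen q ℓ n (.K i)
  | .Kinv i => Taft.gen q ℓ n (.Kinv i) ⊗ₜ Taft.gen q ℓ n (.Kinv i)
  | .x i => Taft.gen q ℓ n (.x i) ⊗ₜ 1 + Taft.gen q ℓ n (.K i) ⊗ₜ Taft.gen q ℓ n (.x i)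

/-- `ε(K) = 1` and `ε(x_i) = 0` on generators. -/
def counitGen (k : Type*) [Field k] (n : ℕ) : Gen n → k
  | .K _ => 1
  | .Kinv _ => 1
  | .x _ => 0

theorem comulGen_sat [NeZero ℓ] (hq : IsPrimitiveRoot q ℓ) : Sat q ℓ n (comulGen q ℓ n) where
  K_comm i j := by
    simp only [comulGen, Algebra.TensorProduct.tmul_mul_tmul, Taft.sat.K_comm]
  K_Kinv i := by
    simp only [comulGen, Algebra.TensorProduct.tmul_mul_tmul, Taft.sat.K_Kinv,
      Algebra.TensorProduct.one_def]
  Kinv_K i := by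
    simp only [comulGen, Algebra.TensorProduct.tmul_mul_tmul, Taft.sat.Kinv_K,
      Algebra.TensorProduct.one_def]
  K_pow i := by
    simp only [comulGen, Algebra.TensorProduct.tmul_pow, Taft.sat.K_pow,
      Algebra.TensorProduct.one_def]
  K_x i j := by
    simp only [comulGen, mul_add, add_mul, Algebra.TensorProduct.tmul_mul_tmul, Taft.sat.K_x i j,
      mul_one, one_mul, Taft.sat.K_comm i j, smul_add, TensorProduct.smul_tmul',
      TensorProduct.tmul_smul]
  x_x i j := by
    have h0 := q_ne_zero hq
    by_cases hij : i = j
    · subst hij; simp [theta_self]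
    · have e1 : coef q i j = theta q (eps i) (eps j) := by simp [coef, hij]
      have e2 : theta q (eps i) (eps j) * coef q j i = 1 := by
        simp [coef, Ne.symm hij, theta_mul_theta h0]
      simp only [comulGen, mul_add, add_mul, Algebra.TensorProduct.tmul_mul_tmul, mul_one, one_mul,
        Taft.sat.K_x i j, Taft.sat.K_x j i, Taft.sat.K_comm i j, Taft.sat.x_x i j, smul_add,
        TensorProduct.smul_tmul', TensorProduct.tmul_smul, smul_smul, e1, e2, one_smul]
      abel
  x_pow i := by
    have h : (Taft.gen q ℓ n (.K i) ⊗ₜ[k] Taft.gen q ℓ n (.x i)) *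
        (Taft.gen q ℓ n (.x i) ⊗ₜ[k] (1 : Taft q ℓ n)) =
        q • ((Taft.gen q ℓ n (.x i) ⊗ₜ[k] (1 : Taft q ℓ n)) *
        (Taft.gen q ℓ n (.K i) ⊗ₜ[k] Taft.gen q ℓ n (.x i))) := by
      simp only [Algebra.TensorProduct.tmul_mul_tmul, Taft.sat.K_x, coef_self, mul_one, one_mul,
        TensorProduct.smul_tmul']
    rw [comulGen, q_add_pow_eq hq h]
    simp [Algebra.TensorProduct.tmul_pow, Taft.sat.x_pow]

theorem counitGen_sat [NeZero ℓ] : Sat q ℓ n (counitGen k n) where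
  K_comm i j := by simp [counitGen]
  K_Kinv i := by simp [counitGen]
  Kinv_K i := by simp [counitGen]
  K_pow i := by simp [counitGen]
  K_x i j := by simp [counitGen]
  x_x i j := by simp [counitGen]
  x_pow i := by simp [counitGen, NeZero.ne ℓ]

variable [NeZero ℓ] [hq : Fact (IsPrimitiveRoot q ℓ)]

/-- The bialgebra structure of the `n`-rank Taft algebra. -/
instance instBialgebraTaft : Bialgebra k (Taft q ℓ n) :=
  Bialgebra.ofAlgHom (Taft.lift (comulGen q ℓ n) (comulGen_sat hq.out))
    (Taft.lift (counitGen k n) counitGen_sat)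
    (Taft.hom_ext fun a => by
      cases a <;> simp [comulGen, Algebra.TensorProduct.one_def, TensorProduct.add_tmul,
        TensorProduct.tmul_add, add_assoc])
    (Taft.hom_ext fun a => by cases a <;> simp [comulGen, counitGen])
    (Taft.hom_ext fun a => by cases a <;> simp [comulGen, counitGen])

@[simp] theorem Taft.comul_gen (a : Gen n) :
    comul (R := k) (Taft.gen q ℓ n a) = comulGen q ℓ n a :=
  Taft.lift_gen (comulGen q ℓ n) (comulGen_sat hq.out) a

@[simp] theorem Taft.counit_gen (a : Gen n) :
    counit (R := k) (Taft.gen q ℓ n a) = counitGen k n a :=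
  Taft.lift_gen (counitGen k n) counitGen_sat a

/-- The antipode: `s(K) = K⁻¹`, `s(x_i) = -K(ε_i)⁻¹ x_i`, as a homomorphism to the opposite
algebra. -/
def Taft.antiHom (q : k) (ℓ n : ℕ) [NeZero ℓ] [hq : Fact (IsPrimitiveRoot q ℓ)] :
    Taft q ℓ n →ₐ[k] (Taft q ℓ n)ᵐᵒᵖ :=
  Taft.lift _ (Taft.sat.anti (q_ne_zero hq.out))

/-- The inverse antipode: `s⁻¹(K) = K⁻¹`, `s⁻¹(x_i) = -x_i K(ε_i)⁻¹`, as a homomorphism to the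
opposite algebra. -/
def Taft.antiHom' (q : k) (ℓ n : ℕ) [NeZero ℓ] [hq : Fact (IsPrimitiveRoot q ℓ)] :
    Taft q ℓ n →ₐ[k] (Taft q ℓ n)ᵐᵒᵖ :=
  Taft.lift _ (Taft.sat.anti' (q_ne_zero hq.out))

/-- The antipode of the Taft algebra as a linear map. -/
def Taft.antipode (q : k) (ℓ n : ℕ) [NeZero ℓ] [Fact (IsPrimitiveRoot q ℓ)] :
    Taft q ℓ n →ₗ[k] Taft q ℓ n :=
  (MulOpposite.opLinearEquiv k).symm.toLinearMap ∘ₗ (Taft.antiHom q ℓ n).toLinearMap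

/-- The inverse antipode of the Taft algebra as a linear map. -/
def Taft.antipode' (q : k) (ℓ n : ℕ) [NeZero ℓ] [Fact (IsPrimitiveRoot q ℓ)] :
    Taft q ℓ n →ₗ[k] Taft q ℓ n :=
  (MulOpposite.opLinearEquiv k).symm.toLinearMap ∘ₗ (Taft.antiHom' q ℓ n).toLinearMap

theorem Taft.antipode_mul (a b : Taft q ℓ n) :
    Taft.antipode q ℓ n (a * b) = Taft.antipode q ℓ n b * Taft.antipode q ℓ n a := by
  simp [Taft.antipode]

theorem Taft.antipode'_mul (a b : Taft q ℓ n) :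
    Taft.antipode' q ℓ n (a * b) = Taft.antipode' q ℓ n b * Taft.antipode' q ℓ n a := by
  simp [Taft.antipode']

theorem Taft.antipode_algebraMap (r : k) :
    Taft.antipode q ℓ n (algebraMap k _ r) = algebraMap k _ r := by
  simp [Taft.antipode]

theorem Taft.antipode'_algebraMap (r : k) :
    Taft.antipode' q ℓ n (algebraMap k _ r) = algebraMap k _ r := by
  simp [Taft.antipode']

theorem Taft.antipode_one : Taft.antipode q ℓ n 1 = 1 := by
  simpa using Taft.antipode_algebraMap (q := q) (ℓ := ℓ) (n := n) 1

theorem Taft.antipode_gen (a : Gen n) : Taft.antipode q ℓ n (Taft.gen q ℓ n a) =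
    MulOpposite.unop (antiGen (Taft.gen q ℓ n) a) := by
  simp [Taft.antipode, Taft.antiHom]

theorem Taft.antipode'_gen (a : Gen n) : Taft.antipode' q ℓ n (Taft.gen q ℓ n a) =
    MulOpposite.unop (antiGen' (Taft.gen q ℓ n) a) := by
  simp [Taft.antipode', Taft.antiHom']

theorem Taft.antipode'_antipode (a : Taft q ℓ n) :
    Taft.antipode' q ℓ n (Taft.antipode q ℓ n a) = a := by
  induction a using Taft.induction with
  | scalar r => rw [Taft.antipode_algebraMap, Taft.antipode'_algebraMap]
  | mul a b ha hb => rw [Taft.antipode_mul, Taft.antipode'_mul, ha, hb]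
  | add a b ha hb => rw [map_add, map_add, ha, hb]
  | gen g =>
    cases g with
    | K i => simp [Taft.antipode_gen, Taft.antipode'_gen, antiGen, antiGen']
    | Kinv i => simp [Taft.antipode_gen, Taft.antipode'_gen, antiGen, antiGen']
    | x i =>
      simp [Taft.antipode_gen, Taft.antipode'_gen, Taft.antipode'_mul, antiGen, antiGen', mul_assoc,
        Taft.sat.Kinv_K]

theorem Taft.antipode_antipode' (a : Taft q ℓ n) :
    Taft.antipode q ℓ n (Taft.antipode' q ℓ n a) = a := by
  induction a using Taft.induction with
  | scalar r => rw [Taft.antipode'_algebraMap, Taft.antipode_algebraMap]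
  | mul a b ha hb => rw [Taft.antipode'_mul, Taft.antipode_mul, ha, hb]
  | add a b ha hb => rw [map_add, map_add, ha, hb]
  | gen g =>
    cases g with
    | K i => simp [Taft.antipode_gen, Taft.antipode'_gen, antiGen, antiGen']
    | Kinv i => simp [Taft.antipode_gen, Taft.antipode'_gen, antiGen, antiGen']
    | x i =>
      simp [Taft.antipode_gen, Taft.antipode'_gen, Taft.antipode_mul, antiGen, antiGen',
        ← mul_assoc, Taft.sat.K_Kinv]

/-- The Hopf algebra structure of the `n`-rank Taft algebra. -/
instance instHopfAlgebraTaft : HopfAlgebra k (Taft q ℓ n) where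
  antipode := Taft.antipode q ℓ n
  mul_antipode_rTensor_comul := by
    have key : ∀ (t u : Taft q ℓ n ⊗[k] Taft q ℓ n) (c : k),
        LinearMap.mul' k _ ((Taft.antipode q ℓ n).rTensor _ t) = algebraMap k _ c →
        LinearMap.mul' k _ ((Taft.antipode q ℓ n).rTensor _ (t * u)) =
        c • LinearMap.mul' k _ ((Taft.antipode q ℓ n).rTensor _ u) := by
      intro t u c h
      induction u with
      | zero => simp
      | add u u' hu hu' => simp only [mul_add, map_add, smul_add, hu, hu']
      | tmul b b' =>
        have : LinearMap.mul' k _ ((Taft.antipode q ℓ n).rTensor _ (t * (b ⊗ₜ b'))) =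
            Taft.antipode q ℓ n b * LinearMap.mul' k _ ((Taft.antipode q ℓ n).rTensor _ t) * b' := by
          clear h
          induction t with
          | zero => simp
          | add t t' h h' => simp only [mul_add, add_mul, map_add, h, h']
          | tmul a a' => simp [Taft.antipode_mul, mul_assoc]
        rw [this, h]
        simp [Algebra.algebraMap_eq_smul_one]
    ext a
    simp only [LinearMap.comp_apply, Algebra.linearMap_apply]
    induction a using Taft.induction with
    | scalar r => simp [Taft.antipode_algebraMap, Algebra.TensorProduct.algebraMap_apply]
    | mul a b ha hb =>
      rw [Bialgebra.comul_mul, key _ _ _ ha, hb, Bialgebra.counit_mul, map_mul, Algebra.smul_def]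
    | add a b ha hb => simp only [map_add, ha, hb]
    | gen g =>
      cases g with
      | K i => simp [comulGen, counitGen, Taft.antipode_gen, antiGen, Taft.sat.Kinv_K]
      | Kinv i => simp [comulGen, counitGen, Taft.antipode_gen, antiGen, Taft.sat.K_Kinv]
      | x i => simp [comulGen, counitGen, Taft.antipode_gen, antiGen]
  mul_antipode_lTensor_comul := by
    have key : ∀ (t u : Taft q ℓ n ⊗[k] Taft q ℓ n) (c : k),
        LinearMap.mul' k _ ((Taft.antipode q ℓ n).lTensor _ u) = algebraMap k _ c →
        LinearMap.mul' k _ ((Taft.antipode q ℓ n).lTensor _ (t * u)) =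
        c • LinearMap.mul' k _ ((Taft.antipode q ℓ n).lTensor _ t) := by
      intro t u c h
      induction t with
      | zero => simp
      | add u u' hu hu' => simp only [add_mul, map_add, smul_add, hu, hu']
      | tmul b b' =>
        have : LinearMap.mul' k _ ((Taft.antipode q ℓ n).lTensor _ ((b ⊗ₜ b') * u)) =
            b * LinearMap.mul' k _ ((Taft.antipode q ℓ n).lTensor _ u) *
              Taft.antipode q ℓ n b' := by
          clear h
          induction u with
          | zero => simp
          | add t t' h h' => simp only [mul_add, add_mul, map_add, h, h']
          | tmul a a' => simp [Taft.antipode_mul, mul_assoc]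
        rw [this, h]
        simp [Algebra.algebraMap_eq_smul_one]
    ext a
    simp only [LinearMap.comp_apply, Algebra.linearMap_apply]
    induction a using Taft.induction with
    | scalar r =>
      simp [Taft.antipode_one, Algebra.TensorProduct.algebraMap_apply]
    | mul a b ha hb =>
      rw [Bialgebra.comul_mul, key _ _ _ hb, ha, Bialgebra.counit_mul, map_mul, Algebra.smul_def,
        Algebra.commutes]
    | add a b ha hb => simp only [map_add, ha, hb]
    | gen g =>
      cases g with
      | K i => simp [comulGen, counitGen, Taft.antipode_gen, antiGen, Taft.sat.K_Kinv]
      | Kinv i => simp [comulGen, counitGen, Taft.antipode_gen, antiGen, Taft.sat.Kinv_K]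
      | x i =>
        simp [comulGen, counitGen, Taft.antipode_gen, antiGen, ← mul_assoc, Taft.sat.K_Kinv,
          Taft.antipode_one]

instance instHopfInverseAntipodeTaft : HopfInverseAntipode k (Taft q ℓ n) where
  sinv := Taft.antipode' q ℓ n
  sinv_antipode := Taft.antipode'_antipode
  antipode_sinv := Taft.antipode_antipode'

variable (q ℓ) in
/-- `K(α) = K(ε_1)^(α_1) ⋯ K(ε_n)^(α_n)` as a group-like element. -/
def Taft.K (α : Fin n → ℤ) : GroupLike k (Taft q ℓ n) :=
  (List.ofFn fun i => (⟨Taft.gen q ℓ n (.K i), by simp [counitGen], by simp [comulGen]⟩ :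
    GroupLike k (Taft q ℓ n)) ^ α i).prod

/-- The values of `𝔎(α)` on the generators. -/
def charGen (q : k) (α : Fin n → ℤ) : Gen n → k
  | .K i => q ^ α i
  | .Kinv i => q ^ (-α i)
  | .x _ => 0

theorem charGen_sat (α : Fin n → ℤ) : Sat q ℓ n (charGen q α) where
  K_comm i j := mul_comm _ _
  K_Kinv i := by
    simp only [charGen]; rw [← zpow_add₀ (q_ne_zero hq.out)]; simp
  Kinv_K i := by
    simp only [charGen]; rw [← zpow_add₀ (q_ne_zero hq.out)]; simp
  K_pow i := by
    simp only [charGen]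
    rw [← zpow_natCast, ← zpow_mul, mul_comm, zpow_mul, zpow_natCast, hq.out.pow_eq_one, one_zpow]
  K_x i j := by simp [charGen]
  x_x i j := by simp [charGen]
  x_pow i := by simp [charGen, NeZero.ne ℓ]

variable (q ℓ) in
/-- The group-like element `𝔎(α)` of the dual Hopf algebra, i.e. the algebra homomorphism with
`𝔎(α)(K(ε_i)) = q^(α_i)` and `𝔎(α)(x_i) = 0`; thus `𝔎(α)(x^γ K(β)) = δ_{γ,0} q^⟨α,β⟩`. -/
def Taft.frakK (α : Fin n → ℤ) : Taft q ℓ n →ₐ[k] k := Taft.lift (charGen q α) (charGen_sat α)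

variable (q ℓ) in
/-- The Drinfeld double `D(Ā_q(n))`. -/
abbrev DTaft (n : ℕ) : Type _ := Double k (Taft q ℓ n)

variable (q ℓ) in
/-- The `D(Ā_q(n))`-module `Ā_{α,β} = Ā_q(n) •_{𝔎(α)} K(β)`. -/
def simpleMod (α β : Fin n → ℤ) :
    Submodule (DTaft q ℓ n) (Twisted k (Taft q ℓ n) (Taft.frakK q ℓ α)) :=
  orbit (Taft.frakK q ℓ α) (Taft.K q ℓ β)

end hopf

section combinatorics

variable {n : ℕ}

/-- The set `Λ₊^{≤κ}` of tuples with entries in `{0, …, ℓ - 1}`. -/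
def box (ℓ n : ℕ) : Set (Fin n → ℤ) := {α | ∀ i, 0 ≤ α i ∧ α i ≤ (ℓ : ℤ) - 1}

/-- The reduction `[α] ∈ Λ₊^{≤κ}` of `α` modulo `ℓ`. -/
def red (ℓ : ℕ) (α : Fin n → ℤ) : Fin n → ℤ := fun i => α i % (ℓ : ℤ)

/-- `β̃_i = β_1 + ⋯ + β_i - β_{i+1} - ⋯ - β_n`. -/
def tilde (β : Fin n → ℤ) : Fin n → ℤ := fun i => ∑ j, if j ≤ i then β j else -β j

/-- `κ(α, β) = [-β̃ + 2β - α]`. -/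
def kappa (ℓ : ℕ) (α β : Fin n → ℤ) : Fin n → ℤ := red ℓ (-tilde β + 2 • β - α)

end combinatorics

end TaftAlgebra

end

/-! The proof is a lowest weight theory for the double. A vector has lowest weight (α, β) if each
K(ε_i) acts on it by q^(α_i) and each functional p acts by p(K(β)). The vector K(β) in Ā_{α,β} is of
this kind.

Besides the characters 𝔎(μ), the dual contains skew derivations ξ_j that vanish on all group-likes,
hence kill lowest weight vectors. They satisfy x_i ξ_j = ξ_j x_i + δ_ij (χ_j - K(ε_j)) with a
character χ_j (`dX_mul_inl_xi`), so x_j and ξ_j behave like the raising and lowering operators of a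
quantum sl₂. Summing commutators, ξ_j x_j^(m+1) v is a multiple of x_j^m v. For m + 1 < ℓ the factor
vanishes exactly when m = κ(α, β)_j. Hence all x^γ v with γ ≤ κ(α, β) are nonzero
(`IsLow.monSmul_ne_zero`). In Ā_{α,β} a direct computation gives x_j^(κ_j + 1) K(β) = 0
(`bullet_x_pow`), so these monomials form a basis, which gives the dimension. Their weights β - γ
are distinct modulo ℓ, so a lowest weight vector is a multiple of a single monomial, and the ξ_j
force that monomial to be x^0 (`IsStandard.eq_smul_of_isLow`).

Every nonzero module contains a lowest weight vector (`exists_isLow`): the functionals vanishing on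
all group-likes form a nilpotent ideal, so they kill some nonzero vector, and on such vectors the
torus can be diagonalised. Applied to submodules, this gives simplicity. A simple module is
determined by its lowest weight, by comparison inside the product of two modules
(`IsLow.smul_eq_zero_of_smul_eq_zero`).

For duality, a lowest weight functional on Ā_{α,β} must vanish on all basis monomials except the top
one x^κ. Its weight is therefore (-α - κ̃, κ - β) modulo ℓ (`IsStandard.weights_of_isLow_dual`).
Since ℓ is odd, equality with (α, β) amounts to α ≡ -β̃, because this congruence already implies κ ≡
2β. Conversely, when the weights agree, a dimension count identifies the module with its dual. The
tuple r is κ itself, and i₀ = (ℓ + 1)/2 is the inverse of 2 modulo ℓ. -/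

noncomputable section

namespace HopfDouble

open Coalgebra HopfAlgebra TensorProduct LinearMap WithConv

/-! ### The two subalgebras of a Drinfeld double and their order of multiplication -/

section embeddings

variable (k : Type*) {H : Type*} [Field k] [Ring H] [HopfAlgebra k H] [HopfInverseAntipode k H]

/-- The embedding `h ↦ ε ⊗ h` of `H` into its Drinfeld double. -/
def Double.inr : H →ₐ[k] Double k H :=
  AlgHom.ofLinearMap (TensorProduct.mk k (HStar k H) H 1) rfl (Double.mk_one_mul k)

/-- The embedding `p ↦ p ⊗ 1` of `H^*` into the Drinfeld double of `H`. -/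
def Double.inl : HStar k H →ₐ[k] Double k H :=
  AlgHom.ofLinearMap ((TensorProduct.mk k (HStar k H) H).flip 1) rfl (Double.mk_mul_one k)

theorem Double.inl_mul_inr (p : HStar k H) (h : H) :
    Double.inl k p * Double.inr k h = Double.mk k p h := (Double.mk_eq k p h).symm

/-- This is the order of factors in which the product is not a pure tensor. Every straightening
relation below comes from expanding `comul₃` on a generator and reading off the terms of `twist`. -/
theorem Double.inr_mul_inl (h : H) (p : HStar k H) :
    Double.inr k h * Double.inl k p = (twist k (comul₃ k h) p : Double k H) :=
  dmul_one_tmul k h p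

theorem Double.twist_tmul_eq (a b c : H) (p : HStar k H) :
    (twist k (a ⊗ₜ (b ⊗ₜ c)) p : Double k H) =
      Double.inl k (coadj k a c p) * Double.inr k b := by
  rw [Double.inl_mul_inr]; rfl

theorem Double.antipode_inl (p : HStar k H) :
    Double.antipode k (Double.inl k p) = Double.inl k (dualSinv k p) := by
  change Double.antipode k (Double.mk k p 1) = _
  rw [Double.antipode_mk, HopfAlgebra.antipode_one]
  exact one_mul (Double.inl k (dualSinv k p))

theorem Double.antipode_inr (h : H) :
    Double.antipode k (Double.inr k h) = Double.inr k (HopfAlgebra.antipode k h) := by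
  change Double.antipode k (Double.mk k 1 h) = _
  rw [Double.antipode_mk, dualSinv_one]
  exact mul_one (Double.inr k (HopfAlgebra.antipode k h))

/-- The span of the products `h p` with `h ∈ H` and `p ∈ H^*` inside the Drinfeld double. -/
def Double.reversed : Submodule k (Double k H) :=
  Submodule.span k {X | ∃ h p, X = Double.inr k h * Double.inl k p}

theorem Double.inr_mul_inl_mem (h : H) (p : HStar k H) :
    Double.inr k h * Double.inl k p ∈ Double.reversed k (H := H) :=
  Submodule.subset_span ⟨h, p, rfl⟩

theorem Double.inr_mul_mem_reversed (h : H) {X : Double k H} (hX : X ∈ Double.reversed k (H := H)) :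
    Double.inr k h * X ∈ Double.reversed k (H := H) := by
  induction hX using Submodule.span_induction with
  | mem X hX =>
    obtain ⟨l, p, rfl⟩ := hX
    rw [← mul_assoc, ← map_mul]
    exact Double.inr_mul_inl_mem k _ _
  | zero => simp
  | add X Y _ _ hX hY => rw [mul_add]; exact add_mem hX hY
  | smul c X _ hX => rw [mul_smul_comm]; exact Submodule.smul_mem _ _ hX

/-- The elements `h` for which all products `p h` can be rewritten with `H` on the left are closed
under multiplication. -/
theorem Double.mk_mul_mem_reversed {a b : H}
    (ha : ∀ p, Double.mk k p a ∈ Double.reversed k (H := H))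
    (hb : ∀ p, Double.mk k p b ∈ Double.reversed k (H := H)) (p : HStar k H) :
    Double.mk k p (a * b) ∈ Double.reversed k (H := H) := by
  rw [← Double.inl_mul_inr, map_mul, ← mul_assoc, Double.inl_mul_inr]
  have h := ha p
  generalize Double.mk k p a = X at h
  induction h using Submodule.span_induction with
  | mem X hX =>
    obtain ⟨l, p, rfl⟩ := hX
    rw [mul_assoc, Double.inl_mul_inr]
    exact Double.inr_mul_mem_reversed k l (hb p)
  | zero => simp
  | add X Y _ _ hX hY => rw [add_mul]; exact add_mem hX hY
  | smul c X _ hX => rw [smul_mul_assoc]; exact Submodule.smul_mem _ _ hX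

end embeddings

end HopfDouble

namespace TaftAlgebra

open Coalgebra HopfAlgebra HopfDouble

/-! ### The group-like elements K(α) and the weights of the x_j -/

section torus

variable {k : Type*} [Field k] {q : k} {ℓ n : ℕ} [NeZero ℓ] [hq : Fact (IsPrimitiveRoot q ℓ)]

theorem zpow_eq_of_dvd {a b : ℤ} (h : (ℓ : ℤ) ∣ a - b) : q ^ a = q ^ b := by
  have h0 : q ≠ 0 := q_ne_zero hq.out
  rw [← mul_inv_eq_one₀ (zpow_ne_zero _ h0), ← zpow_neg, ← zpow_add₀ h0, ← sub_eq_add_neg]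
  exact (hq.out.zpow_eq_one_iff_dvd _).2 h

theorem dvd_of_zpow_eq {a b : ℤ} (h : q ^ a = q ^ b) : (ℓ : ℤ) ∣ a - b := by
  have h0 : q ≠ 0 := q_ne_zero hq.out
  rw [← mul_inv_eq_one₀ (zpow_ne_zero _ h0), ← zpow_neg, ← zpow_add₀ h0, ← sub_eq_add_neg] at h
  exact (hq.out.zpow_eq_one_iff_dvd _).1 h

variable (q ℓ) in
/-- The group-like element `K(ε_i)`. -/
def Taft.groupGen (i : Fin n) : GroupLike k (Taft q ℓ n) :=
  ⟨Taft.gen q ℓ n (.K i), by simp [counitGen], by simp [comulGen]⟩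

@[simp] theorem Taft.groupGen_val (i : Fin n) :
    (Taft.groupGen q ℓ i).val = Taft.gen q ℓ n (.K i) := rfl

theorem Taft.groupGen_inv_val (i : Fin n) :
    (Taft.groupGen q ℓ i)⁻¹.val = Taft.gen q ℓ n (.Kinv i) := by
  change Taft.antipode q ℓ n (Taft.gen q ℓ n (.K i)) = _
  rw [Taft.antipode_gen]; rfl

theorem Taft.groupGen_commute (i j : Fin n) :
    Commute (Taft.groupGen q ℓ i) (Taft.groupGen q ℓ j) :=
  GroupLike.val_injective (Taft.sat.K_comm i j)

theorem Taft.groupGen_pow (i : Fin n) : Taft.groupGen q ℓ i ^ ℓ = 1 :=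
  GroupLike.val_injective (Taft.sat.K_pow i)

theorem Taft.K_eq (α : Fin n → ℤ) :
    Taft.K q ℓ α = ((List.finRange n).map fun i => Taft.groupGen q ℓ i ^ α i).prod := by
  rw [Taft.K, List.ofFn_eq_map]; rfl

theorem Taft.K_zero : Taft.K q ℓ (0 : Fin n → ℤ) = 1 := by
  rw [Taft.K_eq]; exact List.prod_eq_one (by simp)

theorem Taft.K_add (α β : Fin n → ℤ) : Taft.K q ℓ (α + β) = Taft.K q ℓ α * Taft.K q ℓ β := by
  simp only [Taft.K_eq]
  induction List.finRange n with
  | nil => simp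
  | cons i l ih =>
    simp only [List.map_cons, List.prod_cons]
    rw [ih, Pi.add_apply, zpow_add]
    have : Commute (Taft.groupGen q ℓ i ^ β i)
        ((l.map fun i => Taft.groupGen q ℓ i ^ α i).prod) := by
      refine Commute.list_prod_right _ _ fun x hx => ?_
      obtain ⟨j, _, rfl⟩ := List.mem_map.1 hx
      exact (Taft.groupGen_commute i j).zpow_zpow _ _
    simp only [mul_assoc]
    rw [← mul_assoc (Taft.groupGen q ℓ i ^ β i), this.eq, mul_assoc]

theorem Taft.K_neg (α : Fin n → ℤ) : Taft.K q ℓ (-α) = (Taft.K q ℓ α)⁻¹ := by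
  rw [eq_inv_iff_mul_eq_one, ← Taft.K_add, neg_add_cancel, Taft.K_zero]

theorem Taft.K_eps (i : Fin n) : Taft.K q ℓ (eps i) = Taft.groupGen q ℓ i := by
  rw [Taft.K_eq]
  -- The product runs over a list, so the induction is over duplicate-free sublists and records
  -- whether i has been met.
  have key : ∀ l : List (Fin n), l.Nodup →
      (l.map fun j => Taft.groupGen q ℓ j ^ (eps i : Fin n → ℤ) j).prod =
        if i ∈ l then Taft.groupGen q ℓ i else 1 := by
    intro l hl
    induction l with
    | nil => simp
    | cons j l ih =>
      rw [List.nodup_cons] at hl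
      rw [List.map_cons, List.prod_cons, ih hl.2]
      by_cases h : j = i
      · subst h; simp [hl.1, eps]
      · simp [eps, h, Ne.symm h]
  simp [key _ (List.nodup_finRange n)]

theorem Taft.K_congr {α β : Fin n → ℤ} (h : ∀ i, (ℓ : ℤ) ∣ α i - β i) :
    Taft.K q ℓ α = Taft.K q ℓ β := by
  simp only [Taft.K_eq]
  congr 1
  refine List.map_congr_left fun i _ => ?_
  obtain ⟨m, hm⟩ := h i
  rw [show α i = β i + ℓ * m by linarith, zpow_add, zpow_mul, zpow_natCast, Taft.groupGen_pow,
    one_zpow, mul_one]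

/-- An algebra homomorphism to `k` evaluated on `K(α)`. -/
theorem Taft.algHom_K (φ : Taft q ℓ n →ₐ[k] k) (α : Fin n → ℤ) :
    φ (Taft.K q ℓ α).val = ∏ i, φ (Taft.gen q ℓ n (.K i)) ^ α i := by
  let ψ : GroupLike k (Taft q ℓ n) →* k :=
    { toFun := fun g => φ g.val
      map_one' := map_one φ
      map_mul' := fun a b => map_mul φ a.val b.val }
  change ψ _ = _
  rw [Taft.K, map_list_prod, List.map_ofFn, List.prod_ofFn]
  refine Finset.prod_congr rfl fun i _ => ?_
  rw [Function.comp_apply, map_zpow]; rfl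

theorem prod_zpow_eq (hq0 : q ≠ 0) {ι : Type*} (s : Finset ι) (f : ι → ℤ) :
    ∏ i ∈ s, q ^ f i = q ^ ∑ i ∈ s, f i := by
  classical
  induction s using Finset.induction_on with
  | empty => simp
  | insert i s hi ih => rw [Finset.prod_insert hi, Finset.sum_insert hi, zpow_add₀ hq0, ih]

theorem Taft.frakK_gen (μ : Fin n → ℤ) (g : Gen n) :
    Taft.frakK q ℓ μ (Taft.gen q ℓ n g) = charGen q μ g := Taft.lift_gen _ _ _

theorem Taft.frakK_K (μ α : Fin n → ℤ) :
    Taft.frakK q ℓ μ (Taft.K q ℓ α).val = q ^ ∑ i, μ i * α i := by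
  rw [Taft.algHom_K, ← prod_zpow_eq (q_ne_zero hq.out)]
  exact Finset.prod_congr rfl fun i _ => by rw [Taft.frakK_gen, charGen, zpow_mul]

/-- The exponent of `q` in `K(ε_i) x_j = q^(±1) x_j K(ε_i)`. -/
def sgn (i j : Fin n) : ℤ := if j ≤ i then 1 else -1

/-- Since ε_i * ε_j is 1 for j < i and 0 otherwise, θ contributes q or q⁻¹ off the diagonal and 1 on
it. The extra factor q^(δ_ij) puts the diagonal on the side j ≤ i. -/
theorem coef_eq_zpow (i j : Fin n) : coef q i j = q ^ sgn i j := by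
  have hs : ∀ i j : Fin n, star (eps i) (eps j) = if j < i then 1 else 0 := by
    intro i j
    simp only [star, eps, Pi.single_apply, mul_ite, mul_one, mul_zero]
    simp [Finset.mem_filter]
  rw [coef, theta, hs, hs, sgn]
  rcases lt_trichotomy i j with h | rfl | h
  · simp [h, h.not_gt, h.ne, h.not_ge]
  · simp
  · simp [h, h.not_gt, h.ne', h.le]

variable (n) in
/-- The exponent of `q` in `K(β) x_j = q^(⋯) x_j K(β)`. -/
def wt (β : Fin n → ℤ) (j : Fin n) : ℤ := ∑ i, sgn i j * β i

/-- The signs `sgn i j` and `sgn j i` cancel for i ≠ j and add up to 2 for i = j. -/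
theorem wt_add_tilde (β : Fin n → ℤ) (j : Fin n) : wt n β j + tilde β j = 2 * β j := by
  rw [wt, tilde, ← Finset.sum_add_distrib, Finset.sum_eq_single j]
  · simp [sgn]; ring
  · intro i _ hi
    rcases lt_or_gt_of_ne hi with h | h
    · simp [sgn, h.le, h.not_ge]
    · simp [sgn, h.le, h.not_ge]
  · simp

theorem tilde_eq_sum (β : Fin n → ℤ) (i : Fin n) : tilde β i = ∑ j, sgn i j * β j := by
  refine Finset.sum_congr rfl fun j _ => ?_
  rw [sgn]; split_ifs <;> simp

/-- In this form κ is the discrepancy between the eigenvalue of χ_j and that of K(ε_j) on a vector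
of weight (α, β), which is how it enters the commutator computations. -/
theorem kappa_eq (α β : Fin n → ℤ) (j : Fin n) : kappa ℓ α β j = (wt n β j - α j) % ℓ := by
  have := wt_add_tilde β j
  simp only [kappa, red, Pi.sub_apply, Pi.add_apply, Pi.neg_apply, two_nsmul]
  congr 1
  linarith

theorem Taft.groupGen_zpow_mul_x (i j : Fin n) (z : ℤ) :
    (Taft.groupGen q ℓ i ^ z).val * Taft.gen q ℓ n (.x j) =
      q ^ (sgn i j * z) • (Taft.gen q ℓ n (.x j) * (Taft.groupGen q ℓ i ^ z).val) := by
  have h0 := q_ne_zero hq.out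
  induction z using Int.induction_on with
  | zero => simp
  | succ z ih =>
    rw [zpow_add_one, GroupLike.val_mul, mul_assoc, Taft.groupGen_val, Taft.sat.K_x, mul_smul_comm,
      ← mul_assoc, ih, smul_mul_assoc, smul_smul, mul_assoc, coef_eq_zpow, ← zpow_add₀ h0]
    congr 2; ring
  | pred z ih =>
    have h := Taft.sat.x_Kinv (q := q) (ℓ := ℓ) i j
    have h2 : Taft.gen q ℓ n (.Kinv i) * Taft.gen q ℓ n (.x j) =
        q ^ (-sgn i j) • (Taft.gen q ℓ n (.x j) * Taft.gen q ℓ n (.Kinv i)) := by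
      rw [h, coef_eq_zpow, smul_smul, ← zpow_add₀ h0]; simp
    rw [zpow_sub_one, GroupLike.val_mul, mul_assoc, Taft.groupGen_inv_val, h2, mul_smul_comm,
      ← mul_assoc, ih, smul_mul_assoc, smul_smul, mul_assoc, ← zpow_add₀ h0]
    congr 2; ring

theorem Taft.K_mul_x (β : Fin n → ℤ) (j : Fin n) :
    (Taft.K q ℓ β).val * Taft.gen q ℓ n (.x j) =
      q ^ wt n β j • (Taft.gen q ℓ n (.x j) * (Taft.K q ℓ β).val) := by
  rw [Taft.K_eq, wt, ← List.sum_ofFn, List.ofFn_eq_map]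
  induction List.finRange n with
  | nil => simp
  | cons i l ih =>
    rw [List.map_cons, List.prod_cons, GroupLike.val_mul, mul_assoc, ih, mul_smul_comm, ← mul_assoc,
      Taft.groupGen_zpow_mul_x, smul_mul_assoc, smul_smul, mul_assoc, List.map_cons, List.sum_cons,
      ← zpow_add₀ (q_ne_zero hq.out), add_comm]

theorem Taft.K_mul_gen (β : Fin n → ℤ) (j : Fin n) :
    (Taft.K q ℓ β).val * Taft.gen q ℓ n (.K j) = Taft.gen q ℓ n (.K j) * (Taft.K q ℓ β).val := by
  rw [← Taft.groupGen_val, ← Taft.K_eps, ← GroupLike.val_mul, ← GroupLike.val_mul, ← Taft.K_add,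
    ← Taft.K_add, add_comm]

theorem Taft.sinv_gen (g : Gen n) : sinv k (Taft.gen q ℓ n g) =
    MulOpposite.unop (antiGen' (Taft.gen q ℓ n) g) := Taft.antipode'_gen g

theorem Taft.comul₃_K (i : Fin n) : comul₃ k (Taft.gen q ℓ n (.K i)) =
    Taft.gen q ℓ n (.K i) ⊗ₜ (Taft.gen q ℓ n (.K i) ⊗ₜ Taft.gen q ℓ n (.K i)) := by
  simp [comul₃, comulGen]

theorem Taft.comul₃_Kinv (i : Fin n) : comul₃ k (Taft.gen q ℓ n (.Kinv i)) =
    Taft.gen q ℓ n (.Kinv i) ⊗ₜ (Taft.gen q ℓ n (.Kinv i) ⊗ₜ Taft.gen q ℓ n (.Kinv i)) := by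
  simp [comul₃, comulGen]

theorem Taft.comul₃_x (i : Fin n) : comul₃ k (Taft.gen q ℓ n (.x i)) =
    Taft.gen q ℓ n (.x i) ⊗ₜ (1 ⊗ₜ 1) + (Taft.gen q ℓ n (.K i) ⊗ₜ (Taft.gen q ℓ n (.x i) ⊗ₜ 1) +
      Taft.gen q ℓ n (.K i) ⊗ₜ (Taft.gen q ℓ n (.K i) ⊗ₜ Taft.gen q ℓ n (.x i))) := by
  simp [comul₃, comulGen, TensorProduct.tmul_add, Algebra.TensorProduct.one_def]

end torus

end TaftAlgebra

end

noncomputable section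

namespace TaftAlgebra

open Coalgebra HopfAlgebra HopfDouble WithConv

/-! ### Commutation relations in the double, and the skew derivations ξ_j -/

section relations

variable {k : Type*} [Field k] {q : k} {ℓ n : ℕ} [NeZero ℓ] [hq : Fact (IsPrimitiveRoot q ℓ)]

variable (q ℓ) in
/-- The element `x_i` of the Drinfeld double. -/
def dX (i : Fin n) : DTaft q ℓ n := Double.inr k (Taft.gen q ℓ n (.x i))

variable (q ℓ) in
/-- The element `K(ε_i)` of the Drinfeld double. -/
def dK (i : Fin n) : DTaft q ℓ n := Double.inr k (Taft.gen q ℓ n (.K i))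

variable (q ℓ) in
/-- The character `𝔎(μ)` as an element of the convolution algebra. -/
def chi (μ : Fin n → ℤ) : HStar k (Taft q ℓ n) := toConv (Taft.frakK q ℓ μ).toLinearMap

@[simp] theorem chi_apply (μ : Fin n → ℤ) (a : Taft q ℓ n) :
    (chi q ℓ μ).ofConv a = Taft.frakK q ℓ μ a := rfl

theorem dK_mul_inl (i : Fin n) (p : HStar k (Taft q ℓ n)) :
    dK q ℓ i * Double.inl k p =
      Double.inl k (coadj k (Taft.gen q ℓ n (.K i)) (Taft.gen q ℓ n (.K i)) p) * dK q ℓ i := by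
  rw [dK, Double.inr_mul_inl, Taft.comul₃_K, Double.twist_tmul_eq]

theorem inl_mul_dK (i : Fin n) (p : HStar k (Taft q ℓ n)) :
    Double.inl k p * dK q ℓ i = dK q ℓ i *
      Double.inl k (coadj k (Taft.gen q ℓ n (.Kinv i)) (Taft.gen q ℓ n (.Kinv i)) p) := by
  rw [dK_mul_inl, coadj_coadj, Taft.sat.K_Kinv, coadj_one_one]

/-- The three summands correspond to those of the twofold coproduct, x⊗1⊗1 + K⊗x⊗1 + K⊗K⊗x. The
middle leg stays in the algebra and the outer legs act on p. -/
theorem dX_mul_inl (i : Fin n) (p : HStar k (Taft q ℓ n)) :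
    dX q ℓ i * Double.inl k p = Double.inl k (coadj k (Taft.gen q ℓ n (.x i)) 1 p) +
      (Double.inl k (coadj k (Taft.gen q ℓ n (.K i)) 1 p) * dX q ℓ i +
      Double.inl k (coadj k (Taft.gen q ℓ n (.K i)) (Taft.gen q ℓ n (.x i)) p) * dK q ℓ i) := by
  have h1 : Double.inl k (coadj k (Taft.gen q ℓ n (.x i)) 1 p) =
      Double.inl k (coadj k (Taft.gen q ℓ n (.x i)) 1 p) * Double.inr k 1 := by
    rw [map_one, mul_one]
  rw [dX, dK, Double.inr_mul_inl, Taft.comul₃_x, h1]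
  simp only [← Double.twist_tmul_eq, map_add, LinearMap.add_apply]
  rfl

/-- Elements of the algebra can be moved to the left of functionals by solving the straightening
relations for p h on generators. The benefit is that X v lies in the span of algebra elements
applied to v as soon as the dual acts on v by scalars. -/
theorem mk_mem_reversed (h : Taft q ℓ n) (p : HStar k (Taft q ℓ n)) :
    Double.mk k p h ∈ Double.reversed k (H := Taft q ℓ n) := by
  have h1 : ∀ p : HStar k (Taft q ℓ n), Double.inl k p ∈ Double.reversed k := by
    intro p
    simpa using Double.inr_mul_inl_mem k (1 : Taft q ℓ n) p
  have hK : ∀ (i : Fin n) (p : HStar k (Taft q ℓ n)),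
      Double.inl k p * dK q ℓ i ∈ Double.reversed k := by
    intro i p
    rw [inl_mul_dK]
    exact Double.inr_mul_inl_mem k _ _
  induction h using Taft.induction generalizing p with
  | scalar r =>
    rw [← Double.inl_mul_inr, AlgHom.commutes, ← Algebra.commutes, ← Algebra.smul_def]
    exact Submodule.smul_mem _ _ (h1 p)
  | mul a b ha hb => exact Double.mk_mul_mem_reversed k ha hb p
  | add a b ha hb =>
    rw [← Double.inl_mul_inr] at *
    rw [map_add, mul_add]
    refine add_mem ?_ ?_ <;> rw [Double.inl_mul_inr]
    exacts [ha p, hb p]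
  | gen g =>
    rw [← Double.inl_mul_inr]
    cases g with
    | K i => exact hK i p
    | Kinv i =>
      have h2 : ∀ p, Double.inr k (Taft.gen q ℓ n (.Kinv i)) * Double.inl k p = _ := fun p => by
        rw [Double.inr_mul_inl, Taft.comul₃_Kinv, Double.twist_tmul_eq]
      have h3 := h2 (coadj k (Taft.gen q ℓ n (.K i)) (Taft.gen q ℓ n (.K i)) p)
      rw [coadj_coadj, Taft.sat.Kinv_K, coadj_one_one] at h3
      rw [← h3]
      exact Double.inr_mul_inl_mem k _ _
    | x i =>
      -- The functional is first shifted by K(ε_i)⁻¹, so that p itself stands in front of x_i in the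
      -- relation. The other terms have the required order.
      have h2 := dX_mul_inl i (coadj k (Taft.gen q ℓ n (.Kinv i)) 1 p)
      rw [coadj_coadj k (Taft.gen q ℓ n (.K i)), Taft.sat.K_Kinv, mul_one, coadj_one_one] at h2
      have h3 : Double.inl k p * Double.inr k (Taft.gen q ℓ n (.x i)) = _ :=
        eq_sub_of_add_eq (eq_sub_of_add_eq' h2.symm)
      rw [h3]
      exact sub_mem (sub_mem (Double.inr_mul_inl_mem k _ _) (h1 _)) (hK _ _)

theorem reversed_eq_top : Double.reversed k (H := Taft q ℓ n) = ⊤ := by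
  rw [eq_top_iff]
  rintro X -
  induction X using Double.induction k with
  | zero => exact zero_mem _
  | mk p h => exact mk_mem_reversed h p
  | add X Y hX hY => exact add_mem hX hY

/-- A character kills x_i, so of the three summands of the straightening relation only the diagonal
one survives. -/
theorem inl_chi_mul_dX (i : Fin n) (μ : Fin n → ℤ) :
    Double.inl k (chi q ℓ μ) * dX q ℓ i = q ^ (-μ i) • (dX q ℓ i * Double.inl k (chi q ℓ μ)) := by
  have h1 : coadj k (Taft.gen q ℓ n (.x i)) 1 (chi q ℓ μ) = 0 := by
    ext x; simp [Taft.frakK_gen, charGen]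
  have h2 : coadj k (Taft.gen q ℓ n (.K i)) 1 (chi q ℓ μ) = q ^ μ i • chi q ℓ μ := by
    ext x; simp [Taft.frakK_gen, charGen, sinv_one, mul_comm]
  have h3 : coadj k (Taft.gen q ℓ n (.K i)) (Taft.gen q ℓ n (.x i)) (chi q ℓ μ) = 0 := by
    ext x; simp [Taft.frakK_gen, charGen, Taft.sinv_gen, antiGen']
  rw [dX_mul_inl, h1, h2, h3]
  simp [smul_smul, zpow_ne_zero _ (q_ne_zero hq.out)]

theorem dK_mul_dX (i j : Fin n) : dK q ℓ i * dX q ℓ j = q ^ sgn i j • (dX q ℓ j * dK q ℓ i) := by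
  rw [dK, dX, ← map_mul, Taft.sat.K_x, map_smul, map_mul, coef_eq_zpow]

/-- The images of the generators under the upper triangular representation defining the skew
derivation `ξ_j`. -/
def xiGen (q : k) (j : Fin n) : Gen n → Matrix (Fin 2) (Fin 2) k
  | .K i => !![coef q i j, 0; 0, 1]
  | .Kinv i => !![(coef q i j)⁻¹, 0; 0, 1]
  | .x i => !![0, if i = j then 1 else 0; 0, 0]

theorem coef_pow (i j : Fin n) : coef q i j ^ ℓ = 1 := by
  rw [coef_eq_zpow, ← zpow_natCast, ← zpow_mul, mul_comm, zpow_mul, zpow_natCast,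
    hq.out.pow_eq_one, one_zpow]

theorem xiGen_x_mul (j i i' : Fin n) : xiGen q j (.x i) * xiGen q j (.x i') = 0 := by
  ext a b
  fin_cases a <;> fin_cases b <;> simp [xiGen, Matrix.mul_apply, Fin.sum_univ_two]

theorem xiGen_sat (hℓ : 1 < ℓ) (j : Fin n) : Sat q ℓ n (xiGen q j) where
  K_comm i i' := by simp [xiGen, mul_comm]
  K_Kinv i := by
    simp [xiGen, coef_ne_zero (q_ne_zero hq.out), Matrix.one_fin_two]
  Kinv_K i := by
    simp [xiGen, coef_ne_zero (q_ne_zero hq.out), Matrix.one_fin_two]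
  K_pow i := by
    have : ∀ m : ℕ, (!![coef q i j, 0; 0, 1] : Matrix (Fin 2) (Fin 2) k) ^ m =
        !![coef q i j ^ m, 0; 0, 1] := by
      intro m
      induction m with
      | zero => simp [Matrix.one_fin_two]
      | succ m ih => simp [pow_succ, ih]
    rw [xiGen, this, coef_pow, Matrix.one_fin_two]
  K_x i i' := by
    by_cases h : i' = j
    · subst h; simp [xiGen]
    · simp [xiGen, h]
  x_x i i' := by rw [xiGen_x_mul, xiGen_x_mul, smul_zero]
  x_pow i := by
    -- The matrices assigned to the x_i have square zero, so x_i^ℓ = 0 needs ℓ ≥ 2. For ℓ = 1 all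
    -- x_i vanish and there is no ξ_j.
    obtain ⟨m, rfl⟩ : ∃ m, ℓ = m + 2 := ⟨ℓ - 2, by omega⟩
    have : (xiGen q j (.x i)) ^ 2 = 0 := by
      rw [pow_two, xiGen_x_mul]
    rw [pow_add, this, mul_zero]

/-- The upper triangular representation `[χ_j, ξ_j; 0, ε]`. -/
def xiHom (hℓ : 1 < ℓ) (j : Fin n) : Taft q ℓ n →ₐ[k] Matrix (Fin 2) (Fin 2) k :=
  Taft.lift (xiGen q j) (xiGen_sat hℓ j)

/-- The skew derivation `ξ_j` in the dual of the Taft algebra. -/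
def xi (hℓ : 1 < ℓ) (j : Fin n) : HStar k (Taft q ℓ n) :=
  toConv { toFun := fun a => xiHom hℓ j a 0 1
           map_add' := fun a b => by simp
           map_smul' := fun a b => by simp }

theorem xi_apply (hℓ : 1 < ℓ) (j : Fin n) (a : Taft q ℓ n) :
    (xi hℓ j).ofConv a = xiHom hℓ j a 0 1 := rfl

theorem xiHom_entries (hℓ : 1 < ℓ) (j : Fin n) (a : Taft q ℓ n) : xiHom hℓ j a 1 0 = 0 ∧
    xiHom hℓ j a 1 1 = counit (R := k) a ∧
    xiHom hℓ j a 0 0 = Taft.frakK q ℓ (fun i => sgn i j) a := by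
  induction a using Taft.induction with
  | scalar r => simp [Matrix.algebraMap_matrix_apply]
  | mul a b ha hb =>
    simp [Matrix.mul_apply, Fin.sum_univ_two, ha, hb]
  | add a b ha hb => simp [ha, hb]
  | gen g =>
    cases g <;> simp [xiHom, xiGen, counitGen, Taft.frakK_gen, charGen, coef_eq_zpow]

/-- This is the upper right entry of a product of upper triangular matrices whose diagonals are a
character and the counit. -/
theorem xi_mul (hℓ : 1 < ℓ) (j : Fin n) (a b : Taft q ℓ n) : (xi hℓ j).ofConv (a * b) =
    Taft.frakK q ℓ (fun i => sgn i j) a * (xi hℓ j).ofConv b +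
      (xi hℓ j).ofConv a * counit (R := k) b := by
  simp only [xi_apply, map_mul, Matrix.mul_apply, Fin.sum_univ_two, xiHom_entries]

theorem xi_gen (hℓ : 1 < ℓ) (j : Fin n) (g : Gen n) :
    (xi hℓ j).ofConv (Taft.gen q ℓ n g) = xiGen q j g 0 1 := by
  rw [xi_apply, xiHom, Taft.lift_gen]

/-- The skew Leibniz rule propagates the vanishing on K(ε_i) and its inverse. Consequently ξ_j kills
every lowest weight vector. -/
theorem xi_K (hℓ : 1 < ℓ) (j : Fin n) (β : Fin n → ℤ) :
    (xi hℓ j).ofConv (Taft.K q ℓ β).val = 0 := by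
  have hz : ∀ (i : Fin n) (z : ℤ), (xi hℓ j).ofConv (Taft.groupGen q ℓ i ^ z).val = 0 := by
    intro i z
    induction z using Int.induction_on with
    | zero => simp [xi_apply]
    | succ z ih =>
      rw [zpow_add_one, GroupLike.val_mul, xi_mul, ih, Taft.groupGen_val, xi_gen]
      simp [xiGen]
    | pred z ih =>
      rw [zpow_sub_one, GroupLike.val_mul, xi_mul, ih, Taft.groupGen_inv_val, xi_gen]
      simp [xiGen]
  rw [Taft.K_eq]
  induction List.finRange n with
  | nil => simp [xi_apply]
  | cons i l ih => rw [List.map_cons, List.prod_cons, GroupLike.val_mul, xi_mul, ih, hz]; simp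

/-- The commutation relation `x_i ξ_j = ξ_j x_i + δ_ij (χ_j - K(ε_j))`. -/
theorem dX_mul_inl_xi (hℓ : 1 < ℓ) (i j : Fin n) :
    dX q ℓ i * Double.inl k (xi hℓ j) = Double.inl k (xi hℓ j) * dX q ℓ i +
      if i = j then Double.inl k (chi q ℓ fun i => sgn i j) - dK q ℓ j else 0 := by
  have h1 : coadj k (Taft.gen q ℓ n (.x i)) 1 (xi hℓ j) =
      if i = j then chi q ℓ fun i => sgn i j else 0 := by
    ext x
    rw [coadj_apply, sinv_one, one_mul, xi_mul, xi_gen]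
    split_ifs with h <;> simp [xiGen, h, counitGen]
  have h2 : coadj k (Taft.gen q ℓ n (.K i)) 1 (xi hℓ j) = xi hℓ j := by
    ext x
    rw [coadj_apply, sinv_one, one_mul, xi_mul, xi_gen]
    simp [xiGen, counitGen]
  -- The factor s⁻¹(x_i) = -x_i K(ε_i)⁻¹ stands on the left. In the skew Leibniz rule 𝔎(x_i) = 0, so
  -- all that follows x_i is seen through the counit, which is the unit of the convolution algebra.
  have h3 : coadj k (Taft.gen q ℓ n (.K i)) (Taft.gen q ℓ n (.x i)) (xi hℓ j) =
      if i = j then -1 else 0 := by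
    ext x
    rw [coadj_apply, Taft.sinv_gen]
    simp only [antiGen', MulOpposite.unop_op, neg_mul, map_neg, mul_assoc]
    rw [xi_mul, xi_gen]
    split_ifs with h <;> simp [xiGen, h, counitGen, Taft.frakK_gen, charGen]
  rw [dX_mul_inl, h1, h2, h3]
  split_ifs with h
  · subst h; simp; abel
  · simp

end relations

/-! ### Monomials in the x_i up to scalars -/

section monomials

variable {k : Type*} [Field k] {q : k} {ℓ n : ℕ}

variable (q ℓ) in
/-- The monomial `x^γ = x_1^(γ_1) ⋯ x_n^(γ_n)`. -/
def Taft.mon (γ : Fin n → ℕ) : Taft q ℓ n :=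
  ((List.finRange n).map fun i => Taft.gen q ℓ n (.x i) ^ γ i).prod

theorem Taft.mon_zero : Taft.mon q ℓ (0 : Fin n → ℕ) = 1 := by
  rw [Taft.mon]; exact List.prod_eq_one (by simp)

theorem Taft.mon_eq_zero {γ : Fin n → ℕ} {i : Fin n} (h : ℓ ≤ γ i) : Taft.mon q ℓ γ = 0 := by
  refine List.prod_eq_zero (List.mem_map.2 ⟨i, List.mem_finRange i, ?_⟩)
  exact pow_eq_zero_of_le h (Taft.sat.x_pow i)

theorem mul_pow_of_mul_eq_smul {B : Type*} [Ring B] [Algebra k B] {a b : B} {c : k}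
    (h : a * b = c • (b * a)) (m : ℕ) : a * b ^ m = c ^ m • (b ^ m * a) := by
  induction m with
  | zero => simp
  | succ m ih =>
    rw [pow_succ, ← mul_assoc, ih, smul_mul_assoc, mul_assoc, h, mul_smul_comm, smul_smul,
      ← mul_assoc, pow_succ]

/-- Moving an element past a monomial whose factors it skew-commutes with. -/
theorem mul_mon_eq {B : Type*} [Ring B] [Algebra k B] (φ : Taft q ℓ n →ₐ[k] B) {G : B}
    {g : Fin n → k} {γ : Fin n → ℕ}
    (h : ∀ j, γ j ≠ 0 → G * φ (Taft.gen q ℓ n (.x j)) = g j • (φ (Taft.gen q ℓ n (.x j)) * G)) :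
    G * φ (Taft.mon q ℓ γ) = (∏ j, g j ^ γ j) • (φ (Taft.mon q ℓ γ) * G) := by
  rw [Taft.mon, ← List.prod_ofFn, List.ofFn_eq_map]
  induction List.finRange n with
  | nil => simp
  | cons i l ih =>
    have h1 : G * φ (Taft.gen q ℓ n (.x i)) ^ γ i =
        g i ^ γ i • (φ (Taft.gen q ℓ n (.x i)) ^ γ i * G) := by
      -- The commutation is assumed only for variables that occur in the monomial. This later allows
      -- ξ_j to pass monomials free of x_j.
      by_cases hi : γ i = 0
      · simp [hi]
      · exact mul_pow_of_mul_eq_smul (h i hi) _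
    simp only [List.map_cons, List.prod_cons, map_mul, map_pow]
    rw [← mul_assoc, h1, smul_mul_assoc, mul_assoc, ih, mul_smul_comm, smul_smul, mul_assoc]

/-- The scalar collects the values of θ from moving x_j past the variables before it. Only its
nonvanishing matters, so that the relation can be read in both directions. -/
theorem Taft.x_mul_mon [NeZero ℓ] (hq0 : q ≠ 0) (j : Fin n) (γ : Fin n → ℕ) :
    ∃ c : k, c ≠ 0 ∧ Taft.gen q ℓ n (.x j) * Taft.mon q ℓ γ =
      c • Taft.mon q ℓ (γ + Pi.single j 1) := by
  have key : ∀ l : List (Fin n), l.Nodup → j ∈ l → ∃ c : k, c ≠ 0 ∧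
      Taft.gen q ℓ n (.x j) * (l.map fun i => Taft.gen q ℓ n (.x i) ^ γ i).prod =
      c • (l.map fun i => Taft.gen q ℓ n (.x i) ^ (γ + Pi.single j 1 : Fin n → ℕ) i).prod := by
    intro l hl hj
    induction l with
    | nil => simp at hj
    | cons i l ih =>
      rw [List.nodup_cons] at hl
      simp only [List.map_cons, List.prod_cons]
      by_cases h : i = j
      · subst h
        refine ⟨1, one_ne_zero, ?_⟩
        rw [one_smul, ← mul_assoc, ← pow_succ']
        congr 1
        · simp
        · congr 1
          refine List.map_congr_left fun m hm => ?_
          have : m ≠ i := fun h => hl.1 (h ▸ hm)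
          simp [this]
      · obtain ⟨c, hc, h1⟩ := ih hl.2 ((List.mem_cons.1 hj).resolve_left (Ne.symm h))
        have h2 := mul_pow_of_mul_eq_smul (Taft.sat.x_x (q := q) (ℓ := ℓ) j i) (γ i)
        refine ⟨theta q (eps j) (eps i) ^ γ i * c, mul_ne_zero (pow_ne_zero _ ?_) hc, ?_⟩
        · exact zpow_ne_zero _ hq0
        · rw [← mul_assoc, h2, smul_mul_assoc, mul_assoc, h1, mul_smul_comm, smul_smul]
          simp [h]
  exact key _ (List.nodup_finRange n) (List.mem_finRange j)

theorem Taft.x_pow_mul_mon [NeZero ℓ] (hq0 : q ≠ 0) (j : Fin n) (γ : Fin n → ℕ) (m : ℕ) :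
    ∃ c : k, c ≠ 0 ∧ Taft.gen q ℓ n (.x j) ^ m * Taft.mon q ℓ γ =
      c • Taft.mon q ℓ (γ + Pi.single j m) := by
  induction m with
  | zero => exact ⟨1, one_ne_zero, by simp⟩
  | succ m ih =>
    obtain ⟨c, hc, h⟩ := ih
    obtain ⟨d, hd, h'⟩ := Taft.x_mul_mon (ℓ := ℓ) hq0 j (γ + Pi.single j m)
    refine ⟨c * d, mul_ne_zero hc hd, ?_⟩
    rw [pow_succ', mul_assoc, h, mul_smul_comm, h', smul_smul, add_assoc, ← Pi.single_add]

/-- Invariance under left multiplication needs checking on generators only. Together with 1 ∈ S it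
shows that S is everything, both for the monomials and for the filtration below. -/
theorem Taft.mul_mem_of_gen_mul_mem {S : Submodule k (Taft q ℓ n)}
    (h : ∀ g, ∀ s ∈ S, Taft.gen q ℓ n g * s ∈ S) (a : Taft q ℓ n) : ∀ s ∈ S, a * s ∈ S := by
  induction a using Taft.induction with
  | scalar r => intro s hs; rw [← Algebra.smul_def]; exact S.smul_mem _ hs
  | gen g => exact h g
  | mul a b ha hb => intro s hs; rw [mul_assoc]; exact ha _ (hb _ hs)
  | add a b ha hb => intro s hs; rw [add_mul]; exact add_mem (ha _ hs) (hb _ hs)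

end monomials

/-! ### Spanning monomials and finite dimension -/

section spanning

variable {k : Type*} [Field k] {q : k} {ℓ n : ℕ} [NeZero ℓ] [hq : Fact (IsPrimitiveRoot q ℓ)]

theorem Taft.K_mul_mon (i : Fin n) (γ : Fin n → ℕ) :
    ∃ c : k, Taft.gen q ℓ n (.K i) * Taft.mon q ℓ γ =
      c • (Taft.mon q ℓ γ * Taft.gen q ℓ n (.K i)) :=
  ⟨_, mul_mon_eq (AlgHom.id k _) fun j _ => Taft.sat.K_x i j⟩

theorem Taft.Kinv_mul_mon (i : Fin n) (γ : Fin n → ℕ) :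
    ∃ c : k, Taft.gen q ℓ n (.Kinv i) * Taft.mon q ℓ γ =
      c • (Taft.mon q ℓ γ * Taft.gen q ℓ n (.Kinv i)) := by
  refine ⟨_, mul_mon_eq (AlgHom.id k _) (g := fun j => (coef q i j)⁻¹) fun j _ => ?_⟩
  have := Taft.sat.x_Kinv (q := q) (ℓ := ℓ) i j
  simp only [AlgHom.id_apply, this, smul_smul,
    inv_mul_cancel₀ (coef_ne_zero (q_ne_zero hq.out) i j), one_smul]

-- The span contains 1, and left multiplication by a generator preserves it because K(ε_i)^(±1) and
-- x_i skew-commute with the monomials. Linear independence is not needed.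
variable (q ℓ n) in
theorem Taft.span_mon_mul_K : Submodule.span k (Set.range fun t : (Fin n → ℕ) × (Fin n → ℤ) =>
    Taft.mon q ℓ t.1 * (Taft.K q ℓ t.2).val) = ⊤ := by
  rw [eq_top_iff]
  rintro a -
  set S := Submodule.span k (Set.range fun t : (Fin n → ℕ) × (Fin n → ℤ) =>
    Taft.mon q ℓ t.1 * (Taft.K q ℓ t.2).val) with hS
  have hmem : ∀ γ δ, Taft.mon q ℓ γ * (Taft.K q ℓ δ).val ∈ S :=
    fun γ δ => Submodule.subset_span ⟨(γ, δ), rfl⟩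
  have h1 : (1 : Taft q ℓ n) ∈ S := by
    simpa [Taft.mon_zero, Taft.K_zero] using hmem 0 0
  rw [← mul_one a]
  refine Taft.mul_mem_of_gen_mul_mem (fun g s hs => ?_) a 1 h1
  induction hs using Submodule.span_induction with
  | mem s hs =>
    obtain ⟨⟨γ, δ⟩, rfl⟩ := hs
    dsimp only
    rw [← mul_assoc]
    cases g with
    | K i =>
      obtain ⟨c, hc⟩ := Taft.K_mul_mon (q := q) (ℓ := ℓ) i γ
      rw [hc, smul_mul_assoc, mul_assoc, ← Taft.groupGen_val, ← Taft.K_eps, ← GroupLike.val_mul,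
        ← Taft.K_add]
      exact S.smul_mem _ (hmem _ _)
    | Kinv i =>
      obtain ⟨c, hc⟩ := Taft.Kinv_mul_mon (q := q) (ℓ := ℓ) i γ
      rw [hc, smul_mul_assoc, mul_assoc, ← Taft.groupGen_inv_val, ← Taft.K_eps, ← Taft.K_neg,
        ← GroupLike.val_mul, ← Taft.K_add]
      exact S.smul_mem _ (hmem _ _)
    | x i =>
      obtain ⟨c, -, hc⟩ := Taft.x_mul_mon (ℓ := ℓ) (q_ne_zero hq.out) i γ
      rw [hc, smul_mul_assoc]
      exact S.smul_mem _ (hmem _ _)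
  | zero => simp
  | add s t _ _ hs ht => rw [mul_add]; exact add_mem hs ht
  | smul c s _ hs => rw [mul_smul_comm]; exact S.smul_mem _ hs

instance : Module.Finite k (Taft q ℓ n) := by
  refine ⟨?_⟩
  rw [← Taft.span_mon_mul_K q ℓ n]
  -- Exponents of the K(ε_i) matter only modulo ℓ, and monomials with an exponent at least ℓ are
  -- zero. The value `none` accounts for the latter.
  refine Submodule.fg_span (Set.Finite.subset (Set.finite_range
    fun t : Option ((Fin n → Fin ℓ) × (Fin n → Fin ℓ)) => t.elim 0 fun t =>
      Taft.mon q ℓ (fun i => (t.1 i : ℕ)) * (Taft.K q ℓ fun i => ((t.2 i : ℕ) : ℤ)).val) ?_)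
  rintro _ ⟨⟨γ, δ⟩, rfl⟩
  by_cases h : ∃ i, ℓ ≤ γ i
  · obtain ⟨i, hi⟩ := h
    exact ⟨none, by simp [Taft.mon_eq_zero hi]⟩
  · push Not at h
    have hpos : (0 : ℤ) < ℓ := by exact_mod_cast NeZero.pos ℓ
    have hlt : ∀ i, (δ i % ℓ).toNat < ℓ := fun i => by
      have := Int.emod_lt_of_pos (δ i) hpos
      have := Int.emod_nonneg (δ i) hpos.ne'
      omega
    refine ⟨some (fun i => ⟨γ i, h i⟩, fun i => ⟨(δ i % ℓ).toNat, hlt i⟩), ?_⟩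
    simp only [Option.elim_some]
    congr 2
    refine Taft.K_congr fun i => ?_
    rw [Int.toNat_of_nonneg (Int.emod_nonneg _ hpos.ne')]
    exact (Int.dvd_iff_emod_eq_zero).2 (by simp)

end spanning

end TaftAlgebra

end

noncomputable section

namespace HopfDouble

open Coalgebra HopfAlgebra TensorProduct LinearMap WithConv

/-! ### The action of the dual on the Hopf algebra by p ⇀ a -/

section hit

variable (k : Type*) {H : Type*} [Field k] [Ring H] [HopfAlgebra k H]

/-- The functional `a ↦ p(g a)`. -/
def shiftLeft (g : H) (p : HStar k H) : HStar k H := toConv (p.ofConv ∘ₗ LinearMap.mulLeft k g)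

@[simp] theorem shiftLeft_apply (g : H) (p : HStar k H) (a : H) :
    (shiftLeft k g p).ofConv a = p.ofConv (g * a) := rfl

theorem hit_mul_of_comul {g : H} {ι : Type*} (s : Finset ι) (b c : ι → H)
    (hg : comul (R := k) g = ∑ i ∈ s, b i ⊗ₜ c i) (p : HStar k H) (a : H) :
    hit k p (g * a) = ∑ i ∈ s, b i * hit k (shiftLeft k (c i) p) a := by
  simp only [hit, LinearMap.comp_apply, Bialgebra.comul_mul, hg]
  generalize comul (R := k) a = t
  induction t with
  | zero => simp
  | add t t' h h' => simp only [mul_add, map_add, h, h', Finset.sum_add_distrib]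
  | tmul x y => simp [Finset.sum_mul]

theorem hit_groupLike_mul {g : H} (hg : comul (R := k) g = g ⊗ₜ g) (p : HStar k H) (a : H) :
    hit k p (g * a) = g * hit k (shiftLeft k g p) a := by
  simpa using hit_mul_of_comul k (Finset.univ (α := Unit)) (fun _ => g) (fun _ => g)
    (by simpa using hg) p a

/-- Applying ε to a₍₁₎ p(a₍₂₎) recovers p(a), so a functional acting by zero is zero. -/
theorem counit_hit (p : HStar k H) (a : H) : counit (R := k) (hit k p a) = p.ofConv a := by
  have h : ∀ t : H ⊗[k] H, counit (R := k) (TensorProduct.rid k H (lTensor H p.ofConv t)) =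
      p.ofConv (TensorProduct.lid k H (rTensor H (counit (R := k)) t)) := by
    intro t
    induction t with
    | zero => simp
    | add t t' h h' => simp only [map_add, h, h']
    | tmul x y => simp [mul_comm]
  rw [hit, LinearMap.comp_apply, LinearMap.comp_apply]
  refine (h _).trans ?_
  simp

theorem hit_groupLike (g : GroupLike k H) (p : HStar k H) :
    hit k p g.val = p.ofConv g.val • g.val := by
  simp [hit, g.isGroupLikeElem_val.comul_eq_tmul_self]

theorem convMul_groupLike (g : GroupLike k H) (p p' : HStar k H) :
    (p * p').ofConv g.val = p.ofConv g.val * p'.ofConv g.val := by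
  rw [LinearMap.convMul_apply, g.isGroupLikeElem_val.comul_eq_tmul_self]
  simp

theorem convOne_groupLike (g : GroupLike k H) : (1 : HStar k H).ofConv g.val = 1 := by
  simp [LinearMap.convOne_apply]

end hit

end HopfDouble

namespace TaftAlgebra

open Coalgebra HopfAlgebra HopfDouble WithConv

/-! ### Nilpotency of the functionals vanishing on the torus -/

section nilpotent

variable {k : Type*} [Field k] {q : k} {ℓ n : ℕ} [NeZero ℓ] [hq : Fact (IsPrimitiveRoot q ℓ)]

variable (q ℓ n) in
/-- The functionals vanishing on all group-like elements `K(δ)`. -/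
def torusAnn : Submodule k (HStar k (Taft q ℓ n)) where
  carrier := {p | ∀ δ, p.ofConv (Taft.K q ℓ δ).val = 0}
  zero_mem' δ := rfl
  add_mem' ha hb δ := by simp [ha δ, hb δ]
  smul_mem' c p hp δ := by simp [hp δ]

/-- Evaluation at a group-like element is multiplicative for convolution, so `torusAnn` is an
intersection of kernels of characters. -/
theorem mul_mem_torusAnn_right {p : HStar k (Taft q ℓ n)} (p' : HStar k (Taft q ℓ n))
    (h : p ∈ torusAnn q ℓ n) : p * p' ∈ torusAnn q ℓ n := fun δ => by
  rw [convMul_groupLike, h δ, zero_mul]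

theorem shiftLeft_mem_torusAnn (α : Fin n → ℤ) {p : HStar k (Taft q ℓ n)}
    (h : p ∈ torusAnn q ℓ n) : shiftLeft k (Taft.K q ℓ α).val p ∈ torusAnn q ℓ n := fun δ => by
  rw [shiftLeft_apply, ← GroupLike.val_mul, ← Taft.K_add, h]

variable (q ℓ n) in
/-- The coradical-type filtration of the Taft algebra by powers of `torusAnn`. -/
def skel : ℕ → Submodule k (Taft q ℓ n)
  | 0 => ⊥
  | m + 1 =>
    { carrier := {a | ∀ p ∈ torusAnn q ℓ n, hit k p a ∈ skel m}
      zero_mem' := fun p _ => by rw [map_zero]; exact zero_mem _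
      add_mem' := fun ha hb p hp => by rw [map_add]; exact add_mem (ha p hp) (hb p hp)
      smul_mem' := fun c a ha p hp => by
        rw [map_smul]; exact Submodule.smul_mem _ _ (ha p hp) }

/-- Acting by p and then by an element of the ideal is acting by their product, which lies in the
ideal again. -/
theorem hit_mem_skel {m : ℕ} {a : Taft q ℓ n} (ha : a ∈ skel q ℓ n m)
    (p : HStar k (Taft q ℓ n)) : hit k p a ∈ skel q ℓ n m := by
  cases m with
  | zero =>
    have : a = 0 := ha
    rw [this, map_zero]; exact zero_mem _
  | succ m =>
    intro p' hp'
    rw [← hit_mul]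
    exact ha _ (mul_mem_torusAnn_right p hp')

theorem skel_mono : Monotone (skel q ℓ n) :=
  monotone_nat_of_le_succ fun _ _ ha p _ => hit_mem_skel ha p

theorem K_mul_mem_skel (α : Fin n → ℤ) {m : ℕ} {a : Taft q ℓ n} (ha : a ∈ skel q ℓ n m) :
    (Taft.K q ℓ α).val * a ∈ skel q ℓ n m := by
  induction m generalizing a with
  | zero =>
    have : a = 0 := ha
    rw [this, mul_zero]; exact zero_mem _
  | succ m ih =>
    intro p hp
    rw [hit_groupLike_mul k (Taft.K q ℓ α).isGroupLikeElem_val.comul_eq_tmul_self]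
    exact ih (ha _ (shiftLeft_mem_torusAnn α hp))

/-- From Δ(x_i) = x_i ⊗ 1 + K(ε_i) ⊗ x_i, the element p ⇀ (x_i a) has two terms. In x_i (p ⇀ a) the
action has already lowered the level of a. The other is K(ε_i) times a functional applied to a,
which keeps the level m. -/
theorem x_mul_mem_skel (i : Fin n) {m : ℕ} {a : Taft q ℓ n} (ha : a ∈ skel q ℓ n m) :
    Taft.gen q ℓ n (.x i) * a ∈ skel q ℓ n (m + 1) := by
  induction m generalizing a with
  | zero =>
    have : a = 0 := ha
    rw [this, mul_zero]; exact zero_mem _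
  | succ m ih =>
    intro p hp
    rw [hit_mul_of_comul k (Finset.univ (α := Fin 2)) ![Taft.gen q ℓ n (.x i), Taft.gen q ℓ n (.K i)]
      ![1, Taft.gen q ℓ n (.x i)] (by simp [comulGen])]
    rw [Fin.sum_univ_two]
    refine add_mem (ih (ha _ ?_)) ?_
    · have : shiftLeft k (1 : Taft q ℓ n) p = p := by ext a; simp
      simpa [this] using hp
    · have := K_mul_mem_skel (eps i)
        (hit_mem_skel ha (shiftLeft k (Taft.gen q ℓ n (.x i)) p))
      rw [Taft.K_eps] at this
      exact this

-- The union of the filtration contains 1 at level one and is stable under left multiplication by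
-- generators, so it is everything.
variable (q ℓ n) in
theorem exists_skel_eq_top : ∃ m, skel q ℓ n m = ⊤ := by
  have hd : Directed (· ≤ ·) (skel q ℓ n) := skel_mono.directed_le
  have h1 : (1 : Taft q ℓ n) ∈ ⨆ m, skel q ℓ n m := by
    refine Submodule.mem_iSup_of_mem 1 fun p hp => ?_
    have := hit_groupLike k (Taft.K q ℓ (0 : Fin n → ℤ)) p
    rw [hp, zero_smul, Taft.K_zero] at this
    exact this
  have htop : (⨆ m, skel q ℓ n m) = ⊤ := by
    rw [eq_top_iff]
    rintro a -
    rw [← mul_one a]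
    refine Taft.mul_mem_of_gen_mul_mem (fun g s hs => ?_) a 1 h1
    obtain ⟨m, hm⟩ := (Submodule.mem_iSup_of_directed _ hd).1 hs
    cases g with
    | K i =>
      have := K_mul_mem_skel (eps i) hm
      rw [Taft.K_eps] at this
      exact Submodule.mem_iSup_of_mem m this
    | Kinv i =>
      have := K_mul_mem_skel (-eps i) hm
      rw [Taft.K_neg, Taft.K_eps, Taft.groupGen_inv_val] at this
      exact Submodule.mem_iSup_of_mem m this
    | x i => exact Submodule.mem_iSup_of_mem (m + 1) (x_mul_mem_skel i hm)
  -- Finite dimension makes the increasing filtration stop at a single level.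
  have h2 := WellFoundedGT.iSup_eq_monotonicSequenceLimit ⟨skel q ℓ n, skel_mono⟩
  exact ⟨_, h2.symm.trans htop⟩

theorem hit_eq_zero_of_mem_pow {m : ℕ} {p : HStar k (Taft q ℓ n)} (hp : p ∈ torusAnn q ℓ n ^ m)
    {a : Taft q ℓ n} (ha : a ∈ skel q ℓ n m) : hit k p a = 0 := by
  induction m generalizing p a with
  | zero =>
    have : a = 0 := ha
    rw [this, map_zero]
  | succ m ih =>
    rw [Submodule.pow_succ] at hp
    refine Submodule.mul_induction_on hp (fun p hp p' hp' => ?_) (fun p p' h h' => ?_)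
    · rw [hit_mul]; exact ih hp (ha p' hp')
    · have : hit k (p + p') a = hit k p a + hit k p' a := by
        simp [hit, LinearMap.lTensor_add]
      rw [this, h, h', add_zero]

variable (q ℓ n) in
/-- The functionals vanishing on the group-like elements form a nilpotent ideal. -/
theorem exists_torusAnn_pow_eq_bot : ∃ m, torusAnn q ℓ n ^ m = ⊥ := by
  obtain ⟨m, hm⟩ := exists_skel_eq_top q ℓ n
  refine ⟨m, (Submodule.eq_bot_iff _).2 fun p hp => ?_⟩
  ext a
  rw [← counit_hit, hit_eq_zero_of_mem_pow hp (hm ▸ Submodule.mem_top)]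
  simp

end nilpotent

/-! ### Fourier analysis on the torus: projectors onto weights -/

section projectors

variable {k : Type*} [Field k] {q : k} {ℓ n : ℕ} [NeZero ℓ] [hq : Fact (IsPrimitiveRoot q ℓ)]

theorem sum_zpow_mul (d : ℤ) :
    ∑ m : Fin ℓ, q ^ ((m : ℕ) * d : ℤ) = if (ℓ : ℤ) ∣ d then (ℓ : k) else 0 := by
  have h1 : ∀ m : Fin ℓ, q ^ ((m : ℕ) * d : ℤ) = (q ^ d) ^ (m : ℕ) := fun m => by
    rw [← zpow_natCast, ← zpow_mul, mul_comm]
  simp only [h1]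
  rw [Fin.sum_univ_eq_sum_range fun m => (q ^ d) ^ m]
  split_ifs with h
  · simp [(hq.out.zpow_eq_one_iff_dvd d).2 h]
  · have h2 : q ^ d ≠ 1 := fun h' => h ((hq.out.zpow_eq_one_iff_dvd d).1 h')
    have h3 := mul_geom_sum (q ^ d) ℓ
    rw [← zpow_natCast, ← zpow_mul, mul_comm d, zpow_mul, zpow_natCast, hq.out.pow_eq_one, one_zpow,
      sub_self] at h3
    exact (mul_eq_zero.1 h3).resolve_left (sub_ne_zero.2 h2)

theorem sum_zpow_pairing (d : Fin n → ℤ) :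
    ∑ μ : Fin n → Fin ℓ, q ^ ∑ i, ((μ i : ℕ) * d i : ℤ) =
      if ∀ i, (ℓ : ℤ) ∣ d i then (ℓ : k) ^ n else 0 := by
  have h := Finset.prod_univ_sum (fun _ : Fin n => (Finset.univ : Finset (Fin ℓ)))
    (fun i m => q ^ ((m : ℕ) * d i : ℤ))
  rw [Fintype.piFinset_univ] at h
  simp only [← prod_zpow_eq (q_ne_zero hq.out)]
  rw [← h]
  simp only [sum_zpow_mul]
  split_ifs with h1
  · simp [h1]
  · push Not at h1
    obtain ⟨i, hi⟩ := h1
    exact Finset.prod_eq_zero (Finset.mem_univ i) (by simp [hi])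

variable (q ℓ) in
/-- The combination of characters that projects (up to the factor `ℓⁿ`) to the weight `δ`. -/
def weightProj (δ : Fin n → ℤ) : HStar k (Taft q ℓ n) :=
  ∑ μ : Fin n → Fin ℓ, q ^ (-∑ i, ((μ i : ℕ) * δ i : ℤ)) • chi q ℓ fun i => ((μ i : ℕ) : ℤ)

/-- Orthogonality of characters of (ℤ/ℓ)ⁿ. The factor ℓⁿ is kept instead of divided out, so it is
inverted only where characteristic 0 is at hand. -/
theorem weightProj_K (δ β : Fin n → ℤ) : (weightProj q ℓ δ).ofConv (Taft.K q ℓ β).val =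
    if ∀ i, (ℓ : ℤ) ∣ β i - δ i then (ℓ : k) ^ n else 0 := by
  rw [← sum_zpow_pairing (q := q), weightProj, WithConv.ofConv_sum, LinearMap.sum_apply]
  refine Finset.sum_congr rfl fun μ _ => ?_
  rw [WithConv.ofConv_smul, LinearMap.smul_apply, chi_apply, Taft.frakK_K, smul_eq_mul,
    ← zpow_add₀ (q_ne_zero hq.out)]
  congr 1
  simp only [mul_sub, Finset.sum_sub_distrib]
  ring

variable (ℓ) in
/-- The residue of an integer modulo `ℓ`. -/
def residue (a : ℤ) : Fin ℓ :=
  ⟨(a % ℓ).toNat, by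
    have hpos : (0 : ℤ) < ℓ := by exact_mod_cast NeZero.pos ℓ
    have := Int.emod_lt_of_pos a hpos
    have := Int.emod_nonneg a hpos.ne'
    omega⟩

theorem dvd_sub_iff_eq_residue (a : ℤ) (m : Fin ℓ) :
    (ℓ : ℤ) ∣ a - ((m : ℕ) : ℤ) ↔ m = residue ℓ a := by
  have hpos : (0 : ℤ) < ℓ := by exact_mod_cast NeZero.pos ℓ
  have h1 := Int.emod_nonneg a hpos.ne'
  have h2 : ((m : ℕ) : ℤ) < ℓ := by exact_mod_cast m.2
  rw [← Int.modEq_iff_dvd, Int.ModEq, Int.emod_eq_of_lt (by positivity) h2, Fin.ext_iff]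
  simp only [residue]
  omega

/-- On each K(β) exactly one projector is nonzero, the one for the residue of β. Modulo the
nilpotent ideal the projectors thus decompose ℓⁿ times the unit. -/
theorem sum_weightProj_sub_mem :
    (∑ δ : Fin n → Fin ℓ, weightProj q ℓ fun i => ((δ i : ℕ) : ℤ)) - (ℓ : k) ^ n • 1 ∈
      torusAnn q ℓ n := by
  intro β
  have h : ∀ δ : Fin n → Fin ℓ, (∀ i, (ℓ : ℤ) ∣ β i - ((δ i : ℕ) : ℤ)) ↔
      δ = fun i => residue ℓ (β i) := fun δ => by
    rw [funext_iff]
    exact forall_congr' fun i => dvd_sub_iff_eq_residue _ _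
  rw [WithConv.ofConv_sub, WithConv.ofConv_sum, LinearMap.sub_apply, LinearMap.sum_apply]
  simp only [weightProj_K, h]
  rw [WithConv.ofConv_smul, LinearMap.smul_apply, convOne_groupLike]
  simp

end projectors

/-! ### Lowest weight vectors and their existence -/

section low

variable {k : Type*} [Field k] {q : k} {ℓ n : ℕ} [NeZero ℓ] [hq : Fact (IsPrimitiveRoot q ℓ)]
variable {P : Type*} [AddCommGroup P] [Module k P] [Module (DTaft q ℓ n) P]
  [IsScalarTower k (DTaft q ℓ n) P]

/-- Lowest weight vectors: `p v = p(K(β)) v` for `p` in the dual, and `K(ε_i) v = q^(α_i) v`. -/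
structure IsLow (α β : Fin n → ℤ) (v : P) : Prop where
  inl_smul (p : HStar k (Taft q ℓ n)) : Double.inl k p • v = p.ofConv (Taft.K q ℓ β).val • v
  dK_smul (i : Fin n) : dK q ℓ i • v = q ^ α i • v

/-- Vectors on which all characters act through the weight `δ`. -/
def IsWeight (δ : Fin n → ℤ) (v : P) : Prop :=
  ∀ μ : Fin n → ℤ, Double.inl k (chi q ℓ μ) • v = q ^ (∑ i, μ i * δ i) • v

theorem IsLow.isWeight {α β : Fin n → ℤ} {v : P} (h : IsLow (q := q) (ℓ := ℓ) α β v) :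
    IsWeight (q := q) (ℓ := ℓ) β v := fun μ => by
  rw [h.inl_smul, chi_apply, Taft.frakK_K]

theorem IsWeight.weightProj_smul {δ : Fin n → ℤ} {v : P} (h : IsWeight (q := q) (ℓ := ℓ) δ v)
    (β : Fin n → ℤ) : Double.inl k (weightProj q ℓ β) • v =
      (if ∀ i, (ℓ : ℤ) ∣ δ i - β i then (ℓ : k) ^ n else 0) • v := by
  rw [← weightProj_K (q := q), weightProj, map_sum, Finset.sum_smul, WithConv.ofConv_sum,
    LinearMap.sum_apply, Finset.sum_smul]
  refine Finset.sum_congr rfl fun μ _ => ?_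
  rw [map_smul, smul_assoc, h, WithConv.ofConv_smul, LinearMap.smul_apply, chi_apply, Taft.frakK_K,
    smul_assoc]

/-- An operator of order dividing `ℓ` has an eigenvector among the combinations of the iterates of
any nonzero vector. -/
theorem exists_eigenvector_of_pow_eq_one [CharZero k] {V : Type*} [AddCommGroup V] [Module k V]
    (T : Module.End k V) (hT : T ^ ℓ = 1) {W : Submodule k V} (hW : ∀ w ∈ W, T w ∈ W) {v : V}
    (hv : v ∈ W) (hv0 : v ≠ 0) : ∃ (a : ℤ) (w : V), w ∈ W ∧ w ≠ 0 ∧ T w = q ^ a • w := by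
  have hq0 := q_ne_zero hq.out
  -- The component of v for the eigenvalue q^a, up to the factor ℓ. These components sum to ℓ v, so
  -- one of them is nonzero.
  let f : Fin ℓ → V := fun a => ∑ m : Fin ℓ, q ^ ((m : ℕ) * (-(a : ℕ)) : ℤ) • (T ^ (m : ℕ)) v
  have hf : ∑ a, f a = (ℓ : k) • v := by
    simp only [f]
    rw [Finset.sum_comm]
    simp only [← Finset.sum_smul]
    have h1 : ∀ m : Fin ℓ, ∑ a : Fin ℓ, q ^ ((m : ℕ) * (-(a : ℕ)) : ℤ) =
        if m = ⟨0, NeZero.pos ℓ⟩ then (ℓ : k) else 0 := by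
      intro m
      have h2 := sum_zpow_mul (q := q) (ℓ := ℓ) (-(m : ℕ))
      have h3 : (ℓ : ℤ) ∣ -((m : ℕ) : ℤ) ↔ m = ⟨0, NeZero.pos ℓ⟩ := by
        rw [dvd_neg, Int.natCast_dvd_natCast, Fin.ext_iff]
        exact ⟨fun h => Nat.eq_zero_of_dvd_of_lt h m.2, fun h => by simp [h]⟩
      simp only [h3] at h2
      rw [← h2]
      refine Finset.sum_congr rfl fun a _ => ?_
      congr 1; ring
    simp only [h1, ite_smul, zero_smul, Finset.sum_ite_eq', Finset.mem_univ, if_true, pow_zero,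
      Module.End.one_apply]
  have h0 : ∃ a, f a ≠ 0 := by
    by_contra! h
    rw [Finset.sum_eq_zero fun a _ => h a] at hf
    have : (ℓ : k) ≠ 0 := Nat.cast_ne_zero.2 (NeZero.ne ℓ)
    exact (smul_ne_zero this hv0) hf.symm
  obtain ⟨a, ha⟩ := h0
  refine ⟨(a : ℕ), f a, ?_, ha, ?_⟩
  · refine sum_mem fun m _ => W.smul_mem _ ?_
    induction (m : ℕ) with
    | zero => simpa using hv
    | succ m ih => rw [pow_succ']; exact hW _ ih
  · simp only [f]
    rw [Fin.sum_univ_eq_sum_range fun m => q ^ ((m : ℤ) * (-(a : ℕ)) : ℤ) • (T ^ m) v, map_sum,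
      Finset.smul_sum]
    -- T f(a) and q^a f(a) are the sums of g over 1, …, ℓ and over 0, …, ℓ - 1. They agree because g
    -- ℓ = g 0.
    set g : ℕ → V := fun m => q ^ ((m : ℤ) * (-(a : ℕ)) + (a : ℕ) : ℤ) • (T ^ m) v with hg
    have e1 : ∀ m : ℕ, T (q ^ ((m : ℤ) * (-(a : ℕ)) : ℤ) • (T ^ m) v) = g (m + 1) := by
      intro m
      rw [map_smul, hg]
      simp only [pow_succ', Module.End.mul_apply]
      congr 2
      push_cast; ring
    have e2 : ∀ m : ℕ, q ^ ((a : ℕ) : ℤ) • q ^ ((m : ℤ) * (-(a : ℕ)) : ℤ) • (T ^ m) v = g m := by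
      intro m
      rw [smul_smul, ← zpow_add₀ hq0, add_comm]
    simp only [e1, e2]
    have e3 := (Finset.sum_range_succ' g ℓ).symm.trans (Finset.sum_range_succ g ℓ)
    have e4 : g ℓ = g 0 := by
      simp only [hg, hT]
      congr 1
      refine zpow_eq_of_dvd (q := q) (ℓ := ℓ) ?_
      exact ⟨-(a : ℕ), by push_cast; ring⟩
    rw [e4] at e3
    exact add_right_cancel e3

/-- Take the least power of the nilpotent ideal that kills v. It is a positive power, and any
nonzero vector obtained from v by the preceding power is killed by the ideal. -/
theorem exists_torusAnn_smul_eq_zero {v : P} (hv : v ≠ 0) :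
    ∃ w : P, w ≠ 0 ∧ ∀ p ∈ torusAnn q ℓ n, Double.inl k p • w = 0 := by
  classical
  have hex : ∃ m, ∀ p ∈ torusAnn q ℓ n ^ m, Double.inl k p • v = 0 := by
    obtain ⟨m, hm⟩ := exists_torusAnn_pow_eq_bot q ℓ n
    refine ⟨m, fun p hp => ?_⟩
    rw [hm, Submodule.mem_bot] at hp
    rw [hp, map_zero, zero_smul]
  have h1 := Nat.find_spec hex
  obtain ⟨m, hm⟩ : ∃ m, Nat.find hex = m + 1 := by
    refine Nat.exists_eq_succ_of_ne_zero fun h0 => hv ?_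
    rw [h0] at h1
    have := h1 1 (by rw [pow_zero]; exact Submodule.one_le.1 le_rfl)
    rwa [map_one, one_smul] at this
  have h2 := Nat.find_min hex (m := m) (by omega)
  push Not at h2
  obtain ⟨p, hp, hpv⟩ := h2
  refine ⟨_, hpv, fun p' hp' => ?_⟩
  rw [← mul_smul, ← map_mul]
  refine h1 _ ?_
  rw [hm, pow_succ']
  exact Submodule.mul_mem_mul hp' hp

/-- Every nonzero module over the double contains a lowest weight vector. -/
theorem exists_isLow [CharZero k] {v : P} (hv : v ≠ 0) :
    ∃ (α β : Fin n → ℤ) (w : P), w ≠ 0 ∧ IsLow (q := q) (ℓ := ℓ) α β w := by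
  have hℓ : (ℓ : k) ^ n ≠ 0 := pow_ne_zero _ (Nat.cast_ne_zero.2 (NeZero.ne ℓ))
  obtain ⟨u, hu, hu0⟩ := exists_torusAnn_smul_eq_zero (q := q) (ℓ := ℓ) (n := n) hv
  -- The ideal kills u, so the projections of u sum to ℓⁿ u, and they cannot all vanish.
  obtain ⟨δ, hδ⟩ : ∃ δ : Fin n → Fin ℓ,
      Double.inl k (weightProj q ℓ fun i => ((δ i : ℕ) : ℤ)) • u ≠ 0 := by
    by_contra! h
    have h1 := hu0 _ (sum_weightProj_sub_mem (q := q) (ℓ := ℓ) (n := n))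
    rw [map_sub, sub_smul, map_sum, Finset.sum_smul, Finset.sum_eq_zero fun δ _ => h δ, map_smul,
      map_one, smul_assoc, one_smul, zero_sub, neg_eq_zero] at h1
    exact smul_ne_zero hℓ hu h1
  set β : Fin n → ℤ := fun i => ((δ i : ℕ) : ℤ) with hβ
  -- The vectors on which the whole dual acts through evaluation at K(β). The projection of u
  -- belongs here because p times the projector and p(K(β)) times the projector agree on every
  -- group-like.
  let W : Submodule k P :=
    { carrier := {w | ∀ p : HStar k (Taft q ℓ n),
        Double.inl k p • w = p.ofConv (Taft.K q ℓ β).val • w}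
      zero_mem' := fun p => by simp
      add_mem' := fun ha hb p => by rw [smul_add, smul_add, ha, hb]
      smul_mem' := fun c w hw p => by rw [smul_comm, hw p, smul_comm] }
  have hW : Double.inl k (weightProj q ℓ β) • u ∈ W := by
    intro p
    rw [← mul_smul, ← map_mul, ← sub_eq_zero, ← smul_assoc, ← map_smul, ← sub_smul, ← map_sub]
    refine hu0 _ fun γ => ?_
    rw [WithConv.ofConv_sub, LinearMap.sub_apply, convMul_groupLike, WithConv.ofConv_smul,
      LinearMap.smul_apply, weightProj_K, smul_eq_mul]
    split_ifs with h
    · rw [Taft.K_congr h, sub_self]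
    · simp
  have hK : ∀ (i : Fin n), ∀ w ∈ W, dK q ℓ i • w ∈ W := by
    intro i w hw p
    rw [← mul_smul, inl_mul_dK, mul_smul, hw, smul_comm]
    congr 1
    rw [coadj_apply, Taft.sinv_gen]
    simp only [antiGen', MulOpposite.unop_op]
    rw [← mul_assoc, ← Taft.K_mul_gen, mul_assoc, Taft.sat.K_Kinv, mul_one]
  -- The K(ε_i) commute, preserve W and have order dividing ℓ. They are diagonalised one at a time,
  -- each inside the common eigenspace of the previous ones.
  have key : ∀ s : Finset (Fin n), ∃ (α : Fin n → ℤ) (w : P), w ∈ W ∧ w ≠ 0 ∧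
      ∀ i ∈ s, dK q ℓ i • w = q ^ α i • w := by
    classical
    intro s
    induction s using Finset.induction_on with
    | empty => exact ⟨0, _, hW, hδ, by simp⟩
    | insert i s hi ih =>
      obtain ⟨α, w, hw, hw0, hs⟩ := ih
      let T : Module.End k P := Algebra.lsmul k k P (dK q ℓ i)
      have hT : T ^ ℓ = 1 := by
        simp only [T, ← map_pow, dK, Taft.sat.K_pow, map_one]
      let W' : Submodule k P :=
        { carrier := {w | w ∈ W ∧ ∀ j ∈ s, dK q ℓ j • w = q ^ α j • w}
          zero_mem' := ⟨zero_mem _, fun _ _ => by simp⟩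
          add_mem' := fun ha hb => ⟨add_mem ha.1 hb.1, fun j hj => by
            rw [smul_add, smul_add, ha.2 j hj, hb.2 j hj]⟩
          smul_mem' := fun c w hw => ⟨W.smul_mem c hw.1, fun j hj => by
            rw [smul_comm, hw.2 j hj, smul_comm]⟩ }
      have hW' : ∀ w ∈ W', T w ∈ W' := by
        intro w hw
        refine ⟨hK i w hw.1, fun j hj => ?_⟩
        change dK q ℓ j • dK q ℓ i • w = q ^ α j • dK q ℓ i • w
        rw [← mul_smul, dK, dK, ← map_mul, Taft.sat.K_comm, map_mul, mul_smul]
        change dK q ℓ i • dK q ℓ j • w = q ^ α j • dK q ℓ i • w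
        rw [hw.2 j hj, smul_comm]
      obtain ⟨a, w', hw', hw0', hT'⟩ := exists_eigenvector_of_pow_eq_one (q := q) (ℓ := ℓ) T hT hW'
        (v := w) ⟨hw, hs⟩ hw0
      refine ⟨Function.update α i a, w', hw'.1, hw0', fun j hj => ?_⟩
      by_cases hji : j = i
      · subst hji
        rw [Function.update_self]
        exact hT'
      · rw [Function.update_of_ne hji]
        exact hw'.2 j ((Finset.mem_insert.1 hj).resolve_left hji)
  obtain ⟨α, w, hw, hw0, h⟩ := key Finset.univ
  exact ⟨α, β, w, hw0, hw, fun i => h i (Finset.mem_univ i)⟩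

theorem IsLow.congr {α β α' β' : Fin n → ℤ} {v : P} (h : IsLow (q := q) (ℓ := ℓ) α β v)
    (hα : ∀ i, (ℓ : ℤ) ∣ α i - α' i) (hβ : ∀ i, (ℓ : ℤ) ∣ β i - β' i) :
    IsLow (q := q) (ℓ := ℓ) α' β' v where
  inl_smul p := by rw [h.inl_smul, Taft.K_congr hβ]
  dK_smul i := by rw [h.dK_smul, zpow_eq_of_dvd (hα i)]

theorem IsLow.map {P' : Type*} [AddCommGroup P'] [Module k P'] [Module (DTaft q ℓ n) P']
    [IsScalarTower k (DTaft q ℓ n) P'] (φ : P →ₗ[DTaft q ℓ n] P') {α β : Fin n → ℤ} {v : P}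
    (h : IsLow (q := q) (ℓ := ℓ) α β v) : IsLow (q := q) (ℓ := ℓ) α β (φ v) where
  inl_smul p := by
    rw [← map_smul, h.inl_smul, ← algebraMap_smul (DTaft q ℓ n), map_smul, algebraMap_smul]
  dK_smul i := by
    rw [← map_smul, h.dK_smul, ← algebraMap_smul (DTaft q ℓ n), map_smul, algebraMap_smul]

end low

end TaftAlgebra

end

noncomputable section

namespace TaftAlgebra

open Coalgebra HopfAlgebra HopfDouble WithConv

/-! ### Monomials applied to a lowest weight vector, and the action of ξ_j on them -/

section descend

variable {k : Type*} [Field k] {q : k} {ℓ n : ℕ} [NeZero ℓ] [hq : Fact (IsPrimitiveRoot q ℓ)]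
variable {P : Type*} [AddCommGroup P] [Module k P] [Module (DTaft q ℓ n) P]
  [IsScalarTower k (DTaft q ℓ n) P]

variable (q ℓ) in
/-- The vector `x^γ v`. -/
def monSmul (γ : Fin n → ℕ) (v : P) : P := Double.inr k (Taft.mon q ℓ γ) • v

theorem monSmul_zero (v : P) : monSmul q ℓ (0 : Fin n → ℕ) v = v := by
  rw [monSmul, Taft.mon_zero, map_one, one_smul]

theorem monSmul_eq_zero {γ : Fin n → ℕ} {i : Fin n} (h : ℓ ≤ γ i) (v : P) :
    monSmul q ℓ γ v = 0 := by
  rw [monSmul, Taft.mon_eq_zero h, map_zero, zero_smul]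

theorem dX_pow_smul_monSmul (j : Fin n) (γ : Fin n → ℕ) (m : ℕ) (v : P) :
    ∃ c : k, c ≠ 0 ∧ dX q ℓ j ^ m • monSmul q ℓ γ v = c • monSmul q ℓ (γ + Pi.single j m) v := by
  obtain ⟨c, hc, h⟩ := Taft.x_pow_mul_mon (ℓ := ℓ) (q_ne_zero hq.out) j γ m
  refine ⟨c, hc, ?_⟩
  rw [monSmul, ← mul_smul, dX, ← map_pow, ← map_mul, h, map_smul, smul_assoc, monSmul]

/-- The power of x_j is wanted on the right, next to the vector, so that x_j^m v = 0 kills every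
monomial with γ_j ≥ m. -/
theorem Taft.mon_add_single (j : Fin n) (γ : Fin n → ℕ) (m : ℕ) :
    ∃ c : k, Taft.mon q ℓ (γ + Pi.single j m) =
      c • (Taft.mon q ℓ γ * Taft.gen q ℓ n (.x j) ^ m) := by
  obtain ⟨c, hc, h⟩ := Taft.x_pow_mul_mon (ℓ := ℓ) (q_ne_zero hq.out) j γ m
  have h2 := mul_mon_eq (q := q) (ℓ := ℓ) (AlgHom.id k _) (G := Taft.gen q ℓ n (.x j) ^ m) (γ := γ)
    (g := fun i => theta q (eps j) (eps i) ^ m)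
    fun i _ => pow_mul_q_comm (Taft.sat.x_x j i) m
  simp only [AlgHom.id_apply] at h2
  refine ⟨c⁻¹ * ∏ i, (theta q (eps j) (eps i) ^ m) ^ γ i, ?_⟩
  rw [mul_smul, ← h2, h, smul_smul, inv_mul_cancel₀ hc, one_smul]

theorem monSmul_eq_zero_of_dX_pow {j : Fin n} {m : ℕ} {v : P} (h : dX q ℓ j ^ m • v = 0)
    {γ : Fin n → ℕ} (hγ : m ≤ γ j) : monSmul q ℓ γ v = 0 := by
  have e : γ = (γ - Pi.single j m) + Pi.single j m := by
    ext i
    by_cases hi : i = j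
    · subst hi; simp [hγ]
    · simp [hi]
  obtain ⟨c, hc⟩ := Taft.mon_add_single (q := q) (ℓ := ℓ) j (γ - Pi.single j m) m
  rw [e, monSmul, hc, map_smul, smul_assoc, map_mul, mul_smul, map_pow]
  change c • _ • dX q ℓ j ^ m • v = 0
  rw [h, smul_zero, smul_zero]

/-- Each x_j lowers the j-th coordinate of the weight by one. Monomials with exponents below ℓ
therefore have distinct weights modulo ℓ. -/
theorem IsWeight.monSmul {δ : Fin n → ℤ} {v : P} (h : IsWeight (q := q) (ℓ := ℓ) δ v)
    (γ : Fin n → ℕ) :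
    IsWeight (q := q) (ℓ := ℓ) (fun i => δ i - γ i) (monSmul q ℓ γ v) := fun μ => by
  have hq0 := q_ne_zero hq.out
  have h1 := mul_mon_eq (Double.inr k : Taft q ℓ n →ₐ[k] DTaft q ℓ n) (γ := γ)
    (G := Double.inl k (chi q ℓ μ)) (g := fun j => q ^ (-μ j)) fun j _ => inl_chi_mul_dX j μ
  have h2 : ∏ j, (q ^ (-μ j)) ^ γ j = q ^ ∑ j, -(μ j * γ j) := by
    rw [← prod_zpow_eq hq0]
    refine Finset.prod_congr rfl fun j _ => ?_
    rw [← zpow_natCast, ← zpow_mul, neg_mul]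
  rw [TaftAlgebra.monSmul, ← mul_smul, h1, h2, smul_assoc, mul_smul, h, smul_comm _ (q ^ _),
    smul_smul, ← zpow_add₀ hq0, ← Finset.sum_add_distrib]
  congr 2
  exact Finset.sum_congr rfl fun i _ => by ring

theorem IsLow.dK_smul_monSmul {α β : Fin n → ℤ} {v : P} (h : IsLow (q := q) (ℓ := ℓ) α β v)
    (γ : Fin n → ℕ) (i : Fin n) :
    dK q ℓ i • monSmul q ℓ γ v = q ^ (α i + tilde (fun j => (γ j : ℤ)) i) • monSmul q ℓ γ v := by
  have hq0 := q_ne_zero hq.out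
  have h1 := mul_mon_eq (Double.inr k : Taft q ℓ n →ₐ[k] DTaft q ℓ n) (γ := γ) (G := dK q ℓ i)
    (g := fun j => q ^ sgn i j) fun j _ => dK_mul_dX i j
  have h2 : ∏ j, (q ^ sgn i j) ^ γ j = q ^ tilde (fun j => (γ j : ℤ)) i := by
    rw [tilde_eq_sum, ← prod_zpow_eq hq0]
    exact Finset.prod_congr rfl fun j _ => by rw [← zpow_natCast, ← zpow_mul]
  rw [monSmul, ← mul_smul, h1, h2, smul_assoc, mul_smul, h.dK_smul, smul_comm _ (q ^ α i), smul_smul,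
    ← zpow_add₀ hq0, add_comm]

theorem IsLow.inr_K_smul {α β : Fin n → ℤ} {v : P} (h : IsLow (q := q) (ℓ := ℓ) α β v)
    (δ : Fin n → ℤ) : ∃ c : k, Double.inr k (Taft.K q ℓ δ).val • v = c • v := by
  have hq0 := q_ne_zero hq.out
  have hinv : ∀ i, Double.inr k (Taft.gen q ℓ n (.Kinv i)) • v = q ^ (-α i) • v := by
    intro i
    have h1 : Double.inr k (Taft.gen q ℓ n (.Kinv i)) • dK q ℓ i • v = v := by
      rw [dK, ← mul_smul, ← map_mul, Taft.sat.Kinv_K, map_one, one_smul]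
    rw [h.dK_smul, smul_comm] at h1
    nth_rewrite 2 [← h1]
    rw [smul_smul, ← zpow_add₀ hq0, neg_add_cancel, zpow_zero, one_smul]
  have hz : ∀ (i : Fin n) (z : ℤ),
      ∃ c : k, Double.inr k (Taft.groupGen q ℓ i ^ z).val • v = c • v := by
    intro i z
    induction z using Int.induction_on with
    | zero => exact ⟨1, by simp⟩
    | succ z ih =>
      obtain ⟨c, hc⟩ := ih
      refine ⟨q ^ α i * c, ?_⟩
      rw [zpow_add_one, GroupLike.val_mul, map_mul, mul_smul, Taft.groupGen_val]
      change _ • dK q ℓ i • v = _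
      rw [h.dK_smul, smul_comm, hc, smul_smul]
    | pred z ih =>
      obtain ⟨c, hc⟩ := ih
      refine ⟨q ^ (-α i) * c, ?_⟩
      rw [zpow_sub_one, GroupLike.val_mul, map_mul, mul_smul, Taft.groupGen_inv_val, hinv,
        smul_comm, hc, smul_smul]
  rw [Taft.K_eq]
  induction List.finRange n with
  | nil => exact ⟨1, by simp⟩
  | cons i l ih =>
    obtain ⟨c, hc⟩ := ih
    obtain ⟨d, hd⟩ := hz i (δ i)
    refine ⟨c * d, ?_⟩
    rw [List.map_cons, List.prod_cons, GroupLike.val_mul, map_mul, mul_smul, hc, smul_comm, hd,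
      smul_smul]

theorem IsLow.inr_smul_mem_span {α β : Fin n → ℤ} {v : P} (h : IsLow (q := q) (ℓ := ℓ) α β v)
    (a : Taft q ℓ n) :
    Double.inr k a • v ∈ Submodule.span k (Set.range fun γ : Fin n → ℕ => monSmul q ℓ γ v) := by
  have ha : a ∈ Submodule.span k (Set.range fun t : (Fin n → ℕ) × (Fin n → ℤ) =>
    Taft.mon q ℓ t.1 * (Taft.K q ℓ t.2).val) := Taft.span_mon_mul_K q ℓ n ▸ Submodule.mem_top
  induction ha using Submodule.span_induction with
  | mem a ha =>
    obtain ⟨⟨γ, δ⟩, rfl⟩ := ha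
    obtain ⟨c, hc⟩ := h.inr_K_smul δ
    dsimp only
    rw [map_mul, mul_smul, hc, smul_comm]
    exact Submodule.smul_mem _ _ (Submodule.subset_span ⟨γ, rfl⟩)
  | zero => rw [map_zero, zero_smul]; exact zero_mem _
  | add a b _ _ ha hb => rw [map_add, add_smul]; exact add_mem ha hb
  | smul c a _ ha => rw [map_smul, smul_assoc]; exact Submodule.smul_mem _ _ ha

/-- With X written as a sum of products h p, the functional p acts on v by a scalar, and so do the
K(δ) inside h. -/
theorem IsLow.smul_mem_span {α β : Fin n → ℤ} {v : P} (h : IsLow (q := q) (ℓ := ℓ) α β v)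
    (X : DTaft q ℓ n) : X • v ∈ Submodule.span k (Set.range fun γ : Fin n → ℕ => monSmul q ℓ γ v) := by
  have hX : X ∈ Double.reversed k (H := Taft q ℓ n) := by
    rw [reversed_eq_top]; exact Submodule.mem_top
  induction hX using Submodule.span_induction with
  | mem X hX =>
    obtain ⟨a, p, rfl⟩ := hX
    rw [mul_smul, h.inl_smul, smul_comm]
    exact Submodule.smul_mem _ _ (h.inr_smul_mem_span a)
  | zero => rw [zero_smul]; exact zero_mem _
  | add a b _ _ ha hb => rw [add_smul]; exact add_mem ha hb
  | smul c a _ ha => rw [smul_assoc]; exact Submodule.smul_mem _ _ ha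

/-- In the submodule generated by v the weight β occurs only on the line of v: a nonzero monomial
has exponents below ℓ, and weight β - γ ≡ β then forces γ = 0. -/
theorem IsLow.weightProj_smul_smul {α β : Fin n → ℤ} {v : P}
    (h : IsLow (q := q) (ℓ := ℓ) α β v) (X : DTaft q ℓ n) :
    ∃ c : k, Double.inl k (weightProj q ℓ β) • X • v = c • v := by
  have hX := h.smul_mem_span X
  generalize X • v = u at hX
  induction hX using Submodule.span_induction with
  | mem u hu =>
    obtain ⟨γ, rfl⟩ := hu
    dsimp only
    by_cases hγ : ∃ i, ℓ ≤ γ i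
    · obtain ⟨i, hi⟩ := hγ
      exact ⟨0, by rw [monSmul_eq_zero hi, smul_zero, zero_smul]⟩
    · push Not at hγ
      rw [(h.isWeight.monSmul γ).weightProj_smul]
      split_ifs with hd
      · have : γ = 0 := funext fun i => by
          have h1 := hd i
          rw [sub_sub_cancel_left, dvd_neg, Int.natCast_dvd_natCast] at h1
          exact Nat.eq_zero_of_dvd_of_lt h1 (hγ i)
        rw [this, monSmul_zero]
        exact ⟨_, rfl⟩
      · exact ⟨0, by rw [zero_smul, zero_smul]⟩
  | zero => exact ⟨0, by simp⟩
  | add a b _ _ ha hb =>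
    obtain ⟨c, hc⟩ := ha
    obtain ⟨d, hd⟩ := hb
    exact ⟨c + d, by rw [smul_add, hc, hd, add_smul]⟩
  | smul c a _ ha =>
    obtain ⟨d, hd⟩ := ha
    exact ⟨c * d, by rw [smul_comm, hd, smul_smul]⟩

theorem inl_xi_smul_monSmul_eq_zero (hℓ : 1 < ℓ) {j : Fin n} {γ : Fin n → ℕ} (hγ : γ j = 0) {v : P}
    (hv : Double.inl k (xi (q := q) hℓ j) • v = 0) :
    Double.inl k (xi (q := q) hℓ j) • monSmul q ℓ γ v = 0 := by
  have h1 := mul_mon_eq (Double.inr k : Taft q ℓ n →ₐ[k] DTaft q ℓ n) (γ := γ)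
    (G := Double.inl k (xi (q := q) hℓ j))
    (g := fun _ => 1) fun i hi => by
      have hij : i ≠ j := fun h => hi (h ▸ hγ)
      have := dX_mul_inl_xi (q := q) hℓ i j
      rw [if_neg hij, add_zero] at this
      rw [one_smul]
      exact this.symm
  rw [monSmul, ← mul_smul, h1, smul_assoc, mul_smul, hv, smul_zero, smul_zero]

/-- The quantum sl₂ computation. Moving ξ_j through the power of x_j produces one commutator K(ε_j)
- χ_j per factor, and its eigenvalue on x_j^s u is a q^s - b q^(-s). -/
theorem inl_xi_smul_dX_pow (hℓ : 1 < ℓ) {j : Fin n} {u : P} {a b : k}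
    (hξ : Double.inl k (xi (q := q) hℓ j) • u = 0) (hK : dK q ℓ j • u = a • u)
    (hχ : Double.inl k (chi q ℓ fun i => sgn i j) • u = b • u) (m : ℕ) :
    Double.inl k (xi (q := q) hℓ j) • dX q ℓ j ^ (m + 1) • u =
      (∑ s ∈ Finset.range (m + 1), (a * q ^ (s : ℤ) - b * q ^ (-(s : ℤ)))) • dX q ℓ j ^ m • u := by
  have hq0 := q_ne_zero hq.out
  have hrel : Double.inl k (xi (q := q) hℓ j) * dX q ℓ j =
      dX q ℓ j * Double.inl k (xi (q := q) hℓ j) +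
        (dK q ℓ j - Double.inl k (chi q ℓ fun i => sgn i j)) := by
    rw [dX_mul_inl_xi, if_pos rfl]; abel
  have hpow : ∀ m : ℕ, (dK q ℓ j - Double.inl k (chi q ℓ fun i => sgn i j)) • dX q ℓ j ^ m • u =
      (a * q ^ (m : ℤ) - b * q ^ (-(m : ℤ))) • dX q ℓ j ^ m • u := by
    intro m
    have h1 := mul_pow_of_mul_eq_smul (dK_mul_dX (q := q) (ℓ := ℓ) j j) m
    have h2 := mul_pow_of_mul_eq_smul (inl_chi_mul_dX (q := q) (ℓ := ℓ) j fun i => sgn i j) m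
    have h3 : sgn j j = 1 := by simp [sgn]
    rw [sub_smul, ← mul_smul, ← mul_smul, h1, h2, h3, smul_assoc, smul_assoc, mul_smul, mul_smul,
      hK, hχ, smul_comm _ a, smul_comm _ b, smul_smul, smul_smul, ← sub_smul]
    congr 1
    rw [zpow_one, zpow_neg_one, zpow_natCast, zpow_neg, zpow_natCast, inv_pow]
    ring
  induction m with
  | zero =>
    have h0 := hpow 0
    simp only [pow_zero, one_smul] at h0 ⊢
    rw [zero_add, pow_one, ← mul_smul, hrel, add_smul, mul_smul, hξ, smul_zero, zero_add, h0]
    simp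
  | succ m ih =>
    rw [pow_succ', mul_smul, ← mul_smul _ (dX q ℓ j), hrel, add_smul, mul_smul, ih, hpow,
      smul_comm, ← mul_smul, ← pow_succ', ← add_smul, Finset.sum_range_succ _ (m + 1)]

/-- Closed form of the sum of commutator eigenvalues. Its zeros are visible from the two factors on
the right. -/
theorem sub_one_mul_sum (hq0 : q ≠ 0) (a b : k) (m : ℕ) :
    (q - 1) * ∑ s ∈ Finset.range (m + 1), (a * q ^ (s : ℤ) - b * q ^ (-(s : ℤ))) =
      (q ^ (m + 1) - 1) * (a - b * q ^ (-(m : ℤ))) := by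
  induction m with
  | zero => simp
  | succ m ih =>
    rw [Finset.sum_range_succ, mul_add, ih]
    have h : q ^ (-((m + 1 : ℕ) : ℤ)) = q ^ (-(m : ℤ)) * q⁻¹ := by
      rw [← zpow_neg_one, ← zpow_add₀ hq0]; congr 1; push_cast; ring
    have h' : q ^ (-(m : ℤ)) * q ^ m = 1 := by
      rw [← zpow_natCast, ← zpow_add₀ hq0]; simp
    have h2 : q * q⁻¹ = 1 := mul_inv_cancel₀ hq0
    rw [h, zpow_natCast]
    generalize q ^ (-(m : ℤ)) = y at *
    generalize q⁻¹ = z at *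
    linear_combination (b * y * q ^ (m + 1) - b * y) * h2

theorem kappa_nonneg (α β : Fin n → ℤ) (j : Fin n) : 0 ≤ kappa ℓ α β j := by
  rw [kappa_eq]; exact Int.emod_nonneg _ (by exact_mod_cast NeZero.ne ℓ)

theorem kappa_lt (α β : Fin n → ℤ) (j : Fin n) : kappa ℓ α β j < ℓ := by
  rw [kappa_eq]; exact Int.emod_lt_of_pos _ (by exact_mod_cast NeZero.pos ℓ)

theorem dvd_wt_sub_kappa (α β : Fin n → ℤ) (j : Fin n) :
    (ℓ : ℤ) ∣ wt n β j - α j - kappa ℓ α β j := by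
  rw [kappa_eq]
  exact Int.dvd_self_sub_emod

/-- Below the bound `κ(α, β)` the skew derivations lower the monomials nontrivially. -/
theorem IsLow.xi_smul_monSmul {α β : Fin n → ℤ} {v : P} (h : IsLow (q := q) (ℓ := ℓ) α β v)
    (hℓ : 1 < ℓ) {j : Fin n} {γ : Fin n → ℕ} (hγ : (γ j : ℤ) < kappa ℓ α β j) :
    ∃ c : k, c ≠ 0 ∧ Double.inl k (xi (q := q) hℓ j) • monSmul q ℓ (γ + Pi.single j 1) v =
      c • monSmul q ℓ γ v := by
  have hq0 := q_ne_zero hq.out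
  set m := γ j with hm
  -- The monomial is split as x_j^m times a monomial free of x_j. On the latter applied to v, ξ_j
  -- still gives zero, so the one-variable computation applies.
  set γ₀ : Fin n → ℕ := Function.update γ j 0 with hγ₀
  have e0 : γ = γ₀ + Pi.single j m := by
    ext i
    by_cases hi : i = j
    · subst hi; simp [hγ₀, hm]
    · simp [hγ₀, hi]
  have e1 : γ + Pi.single j 1 = γ₀ + Pi.single j (m + 1) := by
    rw [e0, add_assoc, ← Pi.single_add]
  have hj : γ₀ j = 0 := by simp [hγ₀]
  obtain ⟨c, hc, h1⟩ := dX_pow_smul_monSmul (q := q) (ℓ := ℓ) j γ₀ (m + 1) v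
  obtain ⟨d, hd, h2⟩ := dX_pow_smul_monSmul (q := q) (ℓ := ℓ) j γ₀ m v
  rw [← e1] at h1
  rw [← e0] at h2
  have h3 := inl_xi_smul_dX_pow hℓ (u := monSmul q ℓ γ₀ v)
    (inl_xi_smul_monSmul_eq_zero hℓ hj (by rw [h.inl_smul, xi_K, zero_smul]))
    (h.dK_smul_monSmul γ₀ j) (h.isWeight.monSmul γ₀ fun i => sgn i j) m
  rw [h1, h2, smul_comm, smul_smul] at h3
  set S := ∑ s ∈ Finset.range (m + 1), (q ^ (α j + tilde (fun j => (γ₀ j : ℤ)) j) * q ^ (s : ℤ) -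
    q ^ (∑ i, sgn i j * (β i - γ₀ i)) * q ^ (-(s : ℤ))) with hS
  have hS0 : S ≠ 0 := by
    intro hS0
    have h4 := sub_one_mul_sum hq0 (q ^ (α j + tilde (fun j => (γ₀ j : ℤ)) j))
      (q ^ (∑ i, sgn i j * (β i - γ₀ i))) m
    rw [← hS, hS0, mul_zero, ← zpow_add₀ hq0] at h4
    have hκ := kappa_lt (ℓ := ℓ) α β j
    rcases mul_eq_zero.1 h4.symm with h5 | h5
    · exact hq.out.pow_ne_one_of_pos_of_lt (by omega) (by omega) (sub_eq_zero.1 h5)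
    -- Since γ₀ has j-th entry 0, the contributions of γ₀ to the eigenvalues of K(ε_j) and χ_j
    -- agree. The second factor vanishes only for m ≡ κ_j, which 0 ≤ m < κ_j < ℓ excludes.
    · have h6 := dvd_of_zpow_eq (ℓ := ℓ) (sub_eq_zero.1 h5)
      have h7 := wt_add_tilde (fun j => (γ₀ j : ℤ)) j
      have h8 : ∑ i, sgn i j * (β i - γ₀ i) = wt n β j - wt n (fun j => (γ₀ j : ℤ)) j := by
        simp only [wt, mul_sub, Finset.sum_sub_distrib]
      rw [hj] at h7
      have h9 := dvd_add h6 (dvd_wt_sub_kappa (ℓ := ℓ) α β j)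
      rw [h8] at h9
      have h10 : (ℓ : ℤ) ∣ m - kappa ℓ α β j := by
        obtain ⟨z, hz⟩ := h9
        push_cast at h7
        exact ⟨z, by linarith⟩
      have h11 := Int.eq_zero_of_abs_lt_dvd h10 (by rw [abs_lt]; constructor <;> omega)
      omega
  refine ⟨c⁻¹ * (S * d), mul_ne_zero (inv_ne_zero hc) (mul_ne_zero hS0 hd), ?_⟩
  rw [mul_smul, ← h3, smul_smul, inv_mul_cancel₀ hc, one_smul]

/-- Induction on the degree: some ξ_j carries x^γ v to a nonzero multiple of a monomial of smaller
degree, still within the bound κ. -/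
theorem IsLow.monSmul_ne_zero {α β : Fin n → ℤ} {v : P} (h : IsLow (q := q) (ℓ := ℓ) α β v)
    (hv : v ≠ 0) {γ : Fin n → ℕ} (hγ : ∀ j, (γ j : ℤ) ≤ kappa ℓ α β j) :
    monSmul q ℓ γ v ≠ 0 := by
  induction hs : ∑ i, γ i generalizing γ with
  | zero =>
    have : γ = 0 := funext fun i => Finset.sum_eq_zero_iff.1 hs i (Finset.mem_univ i)
    rwa [this, monSmul_zero]
  | succ s ih =>
    obtain ⟨j, hj⟩ : ∃ j, γ j ≠ 0 := by
      by_contra! h0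
      simp [h0] at hs
    set γ' : Fin n → ℕ := γ - Pi.single j 1 with hγ'
    have e : γ = γ' + Pi.single j 1 := by
      ext i
      by_cases hi : i = j
      · subst hi; simp [hγ']; omega
      · simp [hγ', hi]
    have hle : ∀ i, γ' i ≤ γ i := fun i => by simp [hγ']
    have hjj : γ' j + 1 = γ j := by simp [hγ']; omega
    have hlt : (γ' j : ℤ) < kappa ℓ α β j := by
      have := hγ j
      omega
    -- The chain 0 ≤ γ'_j < κ_j < ℓ supplies 1 < ℓ, which the existence of ξ_j requires. For ℓ = 1
    -- this case does not arise.
    have hκ := kappa_lt (ℓ := ℓ) α β j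
    obtain ⟨c, hc, h1⟩ := h.xi_smul_monSmul (by omega) hlt
    rw [← e] at h1
    intro h0
    rw [h0, smul_zero] at h1
    refine smul_ne_zero hc (ih (fun i => (Int.ofNat_le.2 (hle i)).trans (hγ i)) ?_) h1.symm
    rw [e] at hs
    simp only [Pi.add_apply, Finset.sum_add_distrib] at hs
    simp only [Finset.sum_pi_single', Finset.mem_univ, if_true] at hs
    omega

end descend

end TaftAlgebra

end

noncomputable section

namespace HopfDouble

/-! ### The scalar structure on the dual module -/

section contragredient

variable {k H M : Type*} [Field k] [Ring H] [HopfAlgebra k H] [AddCommGroup M] [Module k M]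

instance : Module k (Contragredient k H M) := inferInstanceAs (Module k (Module.Dual k M))

variable [HopfInverseAntipode k H] [Module (Double k H) M] [IsScalarTower k (Double k H) M]

instance : IsScalarTower k (Double k H) (Contragredient k H M) where
  smul_assoc c X f := LinearMap.ext fun m => by
    change f.toDual (Double.antipode k (c • X) • m) = c • f.toDual (Double.antipode k X • m)
    rw [LinearMap.map_smul, smul_assoc, LinearMap.map_smul]

theorem Contragredient.smul_toDual (c : k) (f : Contragredient k H M) (m : M) :
    (c • f).toDual m = c * f.toDual m := rfl

end contragredient

end HopfDouble

namespace TaftAlgebra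

open Coalgebra HopfAlgebra HopfDouble WithConv

/-! ### Standard modules: basis, simplicity and lowest weights of the dual -/

section standard

variable {k : Type*} [Field k] {q : k} {ℓ n : ℕ} [NeZero ℓ] [hq : Fact (IsPrimitiveRoot q ℓ)]
variable {P : Type*} [AddCommGroup P] [Module k P] [Module (DTaft q ℓ n) P]
  [IsScalarTower k (DTaft q ℓ n) P]

variable (q ℓ) in
/-- A nonzero lowest weight vector that generates the module and satisfies
`x_j^(κ(α,β)_j + 1) v = 0`. -/
structure IsStandard (α β : Fin n → ℤ) (v : P) : Prop where
  isLow : IsLow (q := q) (ℓ := ℓ) α β v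
  ne_zero : v ≠ 0
  generates (u : P) : ∃ X : DTaft q ℓ n, X • v = u
  dX_pow_smul (j : Fin n) : dX q ℓ j ^ ((kappa ℓ α β j).toNat + 1) • v = 0

variable (ℓ) in
/-- The index set of the monomial basis: exponents bounded by `κ(α, β)`. -/
abbrev MonIndex (α β : Fin n → ℤ) : Type := (i : Fin n) → Fin ((kappa ℓ α β i).toNat + 1)

/-- The exponent of an index of the monomial basis. -/
def MonIndex.exp {α β : Fin n → ℤ} (t : MonIndex ℓ α β) : Fin n → ℕ := fun i => t i

theorem MonIndex.exp_le {α β : Fin n → ℤ} (t : MonIndex ℓ α β) (i : Fin n) :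
    (t.exp i : ℤ) ≤ kappa ℓ α β i := by
  have h1 := (t i).2
  have h2 := kappa_nonneg (ℓ := ℓ) α β i
  change (((t i : ℕ)) : ℤ) ≤ _
  omega

theorem MonIndex.exp_lt {α β : Fin n → ℤ} (t : MonIndex ℓ α β) (i : Fin n) : t.exp i < ℓ := by
  have h1 := t.exp_le i
  have h2 := kappa_lt (ℓ := ℓ) α β i
  omega

theorem MonIndex.exp_injective {α β : Fin n → ℤ} :
    Function.Injective (MonIndex.exp : MonIndex ℓ α β → Fin n → ℕ) := fun _ _ h =>
  funext fun i => Fin.ext (congrFun h i)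

theorem MonIndex.exists_exp_eq {α β : Fin n → ℤ} {γ : Fin n → ℕ}
    (h : ∀ i, (γ i : ℤ) ≤ kappa ℓ α β i) : ∃ t : MonIndex ℓ α β, t.exp = γ := by
  refine ⟨fun i => ⟨γ i, ?_⟩, rfl⟩
  have h1 := h i
  omega

/-- Exponents in the index set are below ℓ, so the weights of two such monomials agree modulo ℓ only
if the exponents are equal. The projectors thus isolate single coefficients. -/
theorem IsLow.weightProj_smul_monSmul {α β : Fin n → ℤ} {v : P}
    (h : IsLow (q := q) (ℓ := ℓ) α β v) (s t : MonIndex ℓ α β) :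
    Double.inl k (weightProj q ℓ fun i => β i - s.exp i) • monSmul q ℓ t.exp v =
      if t = s then (ℓ : k) ^ n • monSmul q ℓ s.exp v else 0 := by
  rw [(h.isWeight.monSmul _).weightProj_smul]
  by_cases hts : t = s
  · subst hts; simp
  · rw [if_neg, if_neg hts, zero_smul]
    intro hd
    apply hts
    apply MonIndex.exp_injective
    ext i
    have h1 := hd i
    have h2 := s.exp_lt i
    have h3 := t.exp_lt i
    rw [sub_sub_sub_cancel_left] at h1
    have := Int.eq_zero_of_abs_lt_dvd h1 (by rw [abs_lt]; constructor <;> omega)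
    omega

theorem IsLow.weightProj_smul_sum {α β : Fin n → ℤ} {v : P}
    (h : IsLow (q := q) (ℓ := ℓ) α β v) (c : MonIndex ℓ α β → k) (s : MonIndex ℓ α β) :
    Double.inl k (weightProj q ℓ fun i => β i - s.exp i) • ∑ t, c t • monSmul q ℓ t.exp v =
      ((ℓ : k) ^ n * c s) • monSmul q ℓ s.exp v := by
  rw [Finset.smul_sum, Finset.sum_eq_single s]
  · rw [smul_comm, h.weightProj_smul_monSmul, if_pos rfl, smul_smul, mul_comm]
  · intro t _ hts
    rw [smul_comm, h.weightProj_smul_monSmul, if_neg hts, smul_zero]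
  · simp

variable [CharZero k]

theorem IsStandard.linearIndependent {α β : Fin n → ℤ} {v : P} (h : IsStandard q ℓ α β v) :
    LinearIndependent k fun t : MonIndex ℓ α β => monSmul q ℓ t.exp v := by
  rw [Fintype.linearIndependent_iff]
  intro c hc s
  have h1 := h.isLow.weightProj_smul_sum c s
  rw [hc, smul_zero] at h1
  have h2 := (smul_eq_zero.1 h1.symm).resolve_right (h.isLow.monSmul_ne_zero h.ne_zero s.exp_le)
  exact (mul_eq_zero.1 h2).resolve_left (pow_ne_zero _ (Nat.cast_ne_zero.2 (NeZero.ne ℓ)))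

/-- Monomials applied to the generator span the module, and those exceeding κ in some coordinate
vanish because x_j^(κ_j + 1) v = 0. -/
theorem IsStandard.span_eq_top {α β : Fin n → ℤ} {v : P} (h : IsStandard q ℓ α β v) :
    ⊤ ≤ Submodule.span k (Set.range fun t : MonIndex ℓ α β => monSmul q ℓ t.exp v) := by
  rintro u -
  obtain ⟨X, rfl⟩ := h.generates u
  refine Submodule.span_le.2 ?_ (h.isLow.smul_mem_span X)
  rintro _ ⟨γ, rfl⟩
  dsimp only
  by_cases hγ : ∀ i, (γ i : ℤ) ≤ kappa ℓ α β i
  · obtain ⟨t, rfl⟩ := MonIndex.exists_exp_eq hγ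
    exact Submodule.subset_span ⟨t, rfl⟩
  · push Not at hγ
    obtain ⟨j, hj⟩ := hγ
    have := kappa_nonneg (ℓ := ℓ) α β j
    rw [monSmul_eq_zero_of_dX_pow (h.dX_pow_smul j) (by omega)]
    exact zero_mem _

/-- The monomial basis. -/
def IsStandard.basis {α β : Fin n → ℤ} {v : P} (h : IsStandard q ℓ α β v) :
    Module.Basis (MonIndex ℓ α β) k P := Module.Basis.mk h.linearIndependent h.span_eq_top

theorem IsStandard.basis_apply {α β : Fin n → ℤ} {v : P} (h : IsStandard q ℓ α β v)
    (t : MonIndex ℓ α β) : h.basis t = monSmul q ℓ t.exp v := Module.Basis.mk_apply _ _ t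

theorem IsStandard.finite {α β : Fin n → ℤ} {v : P} (h : IsStandard q ℓ α β v) :
    Module.Finite k P := Module.Finite.of_basis h.basis

theorem IsStandard.finrank_eq {α β : Fin n → ℤ} {v : P} (h : IsStandard q ℓ α β v) :
    (Module.finrank k P : ℤ) = ∏ i, (kappa ℓ α β i + 1) := by
  rw [Module.finrank_eq_card_basis h.basis, Fintype.card_pi]
  push_cast
  refine Finset.prod_congr rfl fun i _ => ?_
  rw [Fintype.card_fin]
  have := kappa_nonneg (ℓ := ℓ) α β i
  omega

/-- The only lowest weight vectors of a standard module are the multiples of its generator. -/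
theorem IsStandard.eq_smul_of_isLow {α β α' β' : Fin n → ℤ} {v u : P}
    (h : IsStandard q ℓ α β v) (hu : IsLow (q := q) (ℓ := ℓ) α' β' u) (hu0 : u ≠ 0) :
    (∃ c : k, c ≠ 0 ∧ u = c • v) ∧ (∀ i, (ℓ : ℤ) ∣ α i - α' i) ∧ ∀ i, (ℓ : ℤ) ∣ β i - β' i := by
  have hℓ : (ℓ : k) ^ n ≠ 0 := pow_ne_zero _ (Nat.cast_ne_zero.2 (NeZero.ne ℓ))
  have hsum : ∑ t, h.basis.repr u t • monSmul q ℓ t.exp v = u := by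
    simpa only [h.basis_apply] using h.basis.sum_repr u
  obtain ⟨s, hs⟩ : ∃ s, h.basis.repr u s ≠ 0 := by
    by_contra! h0
    rw [Finset.sum_eq_zero fun t _ => by rw [h0, zero_smul]] at hsum
    exact hu0 hsum.symm
  -- The same projector multiplies u by ℓⁿ or by 0, as u is itself a weight vector. The nonzero
  -- coefficient at s excludes 0, so u is a multiple of the single monomial x^s v.
  have h1 := h.isLow.weightProj_smul_sum (h.basis.repr u) s
  have hms := h.isLow.monSmul_ne_zero h.ne_zero s.exp_le
  rw [hsum, hu.isWeight.weightProj_smul] at h1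
  split_ifs at h1 with hd
  swap
  · rw [zero_smul] at h1
    exact absurd h1.symm (smul_ne_zero (mul_ne_zero hℓ hs) hms)
  rw [mul_smul, smul_right_inj hℓ] at h1
  -- If s_j > 0, then ξ_j sends x^s v to a nonzero multiple of a lower monomial, whereas ξ_j kills
  -- the lowest weight vector u.
  have hs0 : s.exp = 0 := by
    by_contra h0
    obtain ⟨j, hj⟩ := Function.ne_iff.1 h0
    rw [Pi.zero_apply] at hj
    set γ : Fin n → ℕ := s.exp - Pi.single j 1 with hγ
    have e : s.exp = γ + Pi.single j 1 := by
      ext i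
      by_cases hi : i = j
      · subst hi; simp [hγ]; omega
      · simp [hγ, hi]
    have hle : ∀ i, γ i ≤ s.exp i := fun i => by simp [hγ]
    have hjj : γ j + 1 = s.exp j := by simp [hγ]; omega
    have h2 := s.exp_le
    have hκ := kappa_lt (ℓ := ℓ) α β j
    have h2j := h2 j
    have h1ℓ : 1 < ℓ := by omega
    obtain ⟨c, hc, h3⟩ := h.isLow.xi_smul_monSmul h1ℓ (j := j) (γ := γ) (by omega)
    have h4 := hu.inl_smul (xi h1ℓ j)
    rw [xi_K, zero_smul, h1, smul_comm, e, h3, smul_smul] at h4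
    exact smul_ne_zero (mul_ne_zero hs hc) (h.isLow.monSmul_ne_zero h.ne_zero fun i =>
      (Int.ofNat_le.2 (hle i)).trans (h2 i)) h4
  rw [hs0, monSmul_zero] at h1
  refine ⟨⟨_, hs, h1⟩, fun i => ?_, fun i => ?_⟩
  · have h2 := h.isLow.dK_smul i
    have h3 := hu.dK_smul i
    rw [h1, smul_comm, h2, smul_comm] at h3
    have h4 := smul_left_injective k (smul_ne_zero hs h.ne_zero) (a₁ := q ^ α i) (a₂ := q ^ α' i)
      h3
    exact dvd_of_zpow_eq h4
  · have h2 := hd i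
    rw [hs0] at h2
    rw [← dvd_neg]
    simpa using h2

/-- A nonzero submodule contains a lowest weight vector, which must be a nonzero multiple of v, and
v generates. -/
theorem IsStandard.isSimpleModule {α β : Fin n → ℤ} {v : P} (h : IsStandard q ℓ α β v) :
    IsSimpleModule (DTaft q ℓ n) P := by
  rw [isSimpleModule_iff]
  have : Nontrivial P := ⟨v, 0, h.ne_zero⟩
  refine { toNontrivial := inferInstance, eq_bot_or_eq_top := fun N => ?_ }
  by_cases hN : N = ⊥
  · exact Or.inl hN
  · right
    obtain ⟨x, hx, hx0⟩ := N.ne_bot_iff.1 hN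
    obtain ⟨α', β', u, hu0, hu⟩ := exists_isLow (q := q) (ℓ := ℓ) (n := n) (P := N) (v := ⟨x, hx⟩)
      (by simpa using hx0)
    obtain ⟨⟨c, hc, h1⟩, -⟩ := h.eq_smul_of_isLow (hu.map N.subtype) (by simpa using hu0)
    have hv : v ∈ N := by
      have h2 : v = c⁻¹ • N.subtype u := by rw [h1, smul_smul, inv_mul_cancel₀ hc, one_smul]
      rw [h2, ← algebraMap_smul (DTaft q ℓ n)]
      exact N.smul_mem _ u.2
    rw [eq_top_iff]
    rintro y -
    obtain ⟨X, rfl⟩ := h.generates y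
    exact N.smul_mem X hv

theorem IsStandard.weights_of_linearEquiv {P' : Type*} [AddCommGroup P'] [Module k P']
    [Module (DTaft q ℓ n) P'] [IsScalarTower k (DTaft q ℓ n) P'] {α β α' β' : Fin n → ℤ} {v : P}
    {v' : P'} (h : IsStandard q ℓ α β v) (h' : IsStandard q ℓ α' β' v')
    (φ : P ≃ₗ[DTaft q ℓ n] P') :
    (∀ i, (ℓ : ℤ) ∣ α i - α' i) ∧ ∀ i, (ℓ : ℤ) ∣ β i - β' i :=
  (h.eq_smul_of_isLow (h'.isLow.map φ.symm.toLinearMap) (by simpa using h'.ne_zero)).2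

/-- Pulling functionals through a lowest weight vector of the dual. -/
theorem IsLow.toDual_inl_smul {α β : Fin n → ℤ} {f : Contragredient k (Taft q ℓ n) P}
    (h : IsLow (q := q) (ℓ := ℓ) α β f) (p : HStar k (Taft q ℓ n)) (m : P) :
    f.toDual (Double.inl k p • m) = p.ofConv (Taft.K q ℓ (-β)).val * f.toDual m := by
  -- The antipode of the double acts on functionals by composition with s⁻¹. Starting from p ∘ s
  -- makes p itself appear inside f, and s(K(β)) = K(-β) gives the sign.
  have e : dualSinv k (toConv (p.ofConv ∘ₗ HopfAlgebra.antipode k)) = p := by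
    ext x; simp [HopfInverseAntipode.antipode_sinv]
  have h1 := congrArg (fun g => Contragredient.toDual g m)
    (h.inl_smul (toConv (p.ofConv ∘ₗ HopfAlgebra.antipode k)))
  simp only [Contragredient.smul_apply, Double.antipode_inl, e, Contragredient.smul_toDual] at h1
  rw [h1, Taft.K_neg]
  rfl

theorem IsLow.toDual_dK_smul {α β : Fin n → ℤ} {f : Contragredient k (Taft q ℓ n) P}
    (h : IsLow (q := q) (ℓ := ℓ) α β f) (i : Fin n) (m : P) :
    f.toDual m = q ^ α i * f.toDual (dK q ℓ i • m) := by
  have h1 := congrArg (fun g => Contragredient.toDual g (dK q ℓ i • m)) (h.dK_smul i)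
  simp only [Contragredient.smul_apply, Contragredient.smul_toDual] at h1
  rw [← h1, dK, Double.antipode_inr]
  congr 1
  have e : HopfAlgebra.antipode k (Taft.gen q ℓ n (.K i)) = Taft.gen q ℓ n (.Kinv i) := by
    change Taft.antipode q ℓ n _ = _
    rw [Taft.antipode_gen]; rfl
  rw [e, ← mul_smul, ← map_mul, Taft.sat.Kinv_K, map_one, one_smul]

/-- The lowest weights of the dual of a standard module. -/
theorem IsStandard.weights_of_isLow_dual {α β α' β' : Fin n → ℤ} {v : P}
    (h : IsStandard q ℓ α β v) {f : Contragredient k (Taft q ℓ n) P}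
    (hf : IsLow (q := q) (ℓ := ℓ) α' β' f) (hf0 : f ≠ 0) :
    (∀ i, (ℓ : ℤ) ∣ β' i + β i - kappa ℓ α β i) ∧
      ∀ i, (ℓ : ℤ) ∣ α' i + α i + tilde (kappa ℓ α β) i := by
  have hq0 := q_ne_zero hq.out
  obtain ⟨s, hs⟩ : ∃ s : MonIndex ℓ α β, f.toDual (monSmul q ℓ s.exp v) ≠ 0 := by
    by_contra! h0
    refine hf0 (h.basis.ext (f₁ := f.toDual) (f₂ := 0) fun t => ?_)
    rw [h.basis_apply, h0]; rfl
  -- A lowest weight functional vanishes on the image of every ξ_j. That image contains x^s v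
  -- whenever s_j < κ_j, so only the top monomial can have a nonzero value.
  have hκ : ∀ j, (s.exp j : ℤ) = kappa ℓ α β j := by
    intro j
    by_contra hne
    have hlt := lt_of_le_of_ne (s.exp_le j) hne
    have hκ := kappa_lt (ℓ := ℓ) α β j
    have h1ℓ : 1 < ℓ := by omega
    obtain ⟨c, hc, h3⟩ := h.isLow.xi_smul_monSmul h1ℓ hlt
    have h4 := hf.toDual_inl_smul (xi h1ℓ j) (monSmul q ℓ (s.exp + Pi.single j 1) v)
    rw [h3, xi_K, zero_mul, map_smul, smul_eq_mul] at h4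
    exact mul_ne_zero hc hs h4
  refine ⟨fun i => ?_, fun i => ?_⟩
  -- The character 𝔎(ε_i) reads off the i-th coordinate: on the top monomial it gives β_i - κ_i, on
  -- the functional side -β'_i.
  · have h1 := hf.toDual_inl_smul (chi q ℓ (eps i)) (monSmul q ℓ s.exp v)
    rw [h.isLow.isWeight.monSmul, map_smul, smul_eq_mul, chi_apply, Taft.frakK_K] at h1
    have h2 := dvd_of_zpow_eq (ℓ := ℓ) (mul_right_cancel₀ hs h1)
    have e : ∀ δ : Fin n → ℤ, ∑ j, (eps i : Fin n → ℤ) j * δ j = δ i := fun δ => by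
      simp [eps, Pi.single_apply]
    rw [e, e, hκ] at h2
    convert h2 using 1
    simp; ring
  · have h1 := hf.toDual_dK_smul i (monSmul q ℓ s.exp v)
    rw [h.isLow.dK_smul_monSmul, map_smul, smul_eq_mul, ← mul_assoc, ← zpow_add₀ hq0] at h1
    have h2 : q ^ (0 : ℤ) = q ^ (α' i + (α i + tilde (fun j => (s.exp j : ℤ)) i)) := by
      rw [zpow_zero]
      exact mul_right_cancel₀ hs (by rw [one_mul]; exact h1)
    have h3 := dvd_of_zpow_eq (ℓ := ℓ) h2
    have e : (fun j => (s.exp j : ℤ)) = kappa ℓ α β := funext hκ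
    rw [e, zero_sub, dvd_neg, ← add_assoc] at h3
    exact h3

end standard

/-! ### Simple modules are determined by their lowest weight -/

section uniqueness

variable {k : Type*} [Field k] [CharZero k] {q : k} {ℓ n : ℕ} [NeZero ℓ]
  [hq : Fact (IsPrimitiveRoot q ℓ)]
variable {P P' : Type*} [AddCommGroup P] [Module k P] [Module (DTaft q ℓ n) P]
  [IsScalarTower k (DTaft q ℓ n) P] [AddCommGroup P'] [Module k P'] [Module (DTaft q ℓ n) P']
  [IsScalarTower k (DTaft q ℓ n) P']

/-- A lowest weight vector of a simple module is killed by every element that kills a nonzero lowest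
weight vector of the same weight in another module. -/
theorem IsLow.smul_eq_zero_of_smul_eq_zero {α β : Fin n → ℤ} {v : P} {v' : P'}
    (h : IsLow (q := q) (ℓ := ℓ) α β v) (h' : IsLow (q := q) (ℓ := ℓ) α β v') (hv' : v' ≠ 0)
    [IsSimpleModule (DTaft q ℓ n) P] {X : DTaft q ℓ n} (hX : X • v' = 0) : X • v = 0 := by
  have hℓ : (ℓ : k) ^ n ≠ 0 := pow_ne_zero _ (Nat.cast_ne_zero.2 (NeZero.ne ℓ))
  by_contra h0
  -- If X v ≠ 0, simplicity returns it to v. Then Y X sends (v, v') to (v, 0), contradicting that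
  -- the weight β part of the submodule generated by (v, v') is a line.
  obtain ⟨Y, hY⟩ := IsSimpleModule.toSpanSingleton_surjective (DTaft q ℓ n) h0 v
  rw [LinearMap.toSpanSingleton_apply] at hY
  have hu : IsLow (q := q) (ℓ := ℓ) α β ((v, v') : P × P') :=
    ⟨fun p => Prod.ext (h.inl_smul p) (h'.inl_smul p),
      fun i => Prod.ext (h.dK_smul i) (h'.dK_smul i)⟩
  obtain ⟨c, hc⟩ := hu.weightProj_smul_smul (Y * X)
  have h1 := congrArg Prod.fst hc
  have h2 := congrArg Prod.snd hc
  simp only [Prod.smul_fst, Prod.smul_snd, mul_smul, hX, hY, smul_zero] at h1 h2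
  have hc0 : c = 0 := (smul_eq_zero.1 h2.symm).resolve_right hv'
  rw [hc0, zero_smul, h.isWeight.weightProj_smul, if_pos (by simp)] at h1
  have hv := (smul_eq_zero.1 h1).resolve_left hℓ
  rw [hv, smul_zero] at h0
  exact h0 rfl

/-- Simple modules with lowest weight vectors of the same weight are isomorphic. -/
theorem IsLow.nonempty_linearEquiv {α β : Fin n → ℤ} {v : P} {v' : P'}
    (h : IsLow (q := q) (ℓ := ℓ) α β v) (h' : IsLow (q := q) (ℓ := ℓ) α β v') (hv : v ≠ 0)
    (hv' : v' ≠ 0) [IsSimpleModule (DTaft q ℓ n) P] [IsSimpleModule (DTaft q ℓ n) P'] :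
    Nonempty (P ≃ₗ[DTaft q ℓ n] P') := by
  let T := LinearMap.toSpanSingleton (DTaft q ℓ n) P v
  let T' := LinearMap.toSpanSingleton (DTaft q ℓ n) P' v'
  have hker : LinearMap.ker T = LinearMap.ker T' := by
    ext X
    simp only [T, T', LinearMap.mem_ker, LinearMap.toSpanSingleton_apply]
    exact ⟨fun hX => h'.smul_eq_zero_of_smul_eq_zero h hv hX,
      fun hX => h.smul_eq_zero_of_smul_eq_zero h' hv' hX⟩
  exact ⟨(T.quotKerEquivOfSurjective (IsSimpleModule.toSpanSingleton_surjective _ hv)).symm ≪≫ₗ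
    Submodule.quotEquivOfEq _ _ hker ≪≫ₗ
    T'.quotKerEquivOfSurjective (IsSimpleModule.toSpanSingleton_surjective _ hv')⟩

/-- A simple module is isomorphic to every module of the same finite dimension containing a lowest
weight vector of the same weight. -/
theorem IsLow.nonempty_linearEquiv_of_finrank_eq {α β : Fin n → ℤ} {v : P} {v' : P'}
    (h : IsLow (q := q) (ℓ := ℓ) α β v) (h' : IsLow (q := q) (ℓ := ℓ) α β v') (hv : v ≠ 0)
    (hv' : v' ≠ 0) [IsSimpleModule (DTaft q ℓ n) P] [Module.Finite k P']
    (hdim : Module.finrank k P = Module.finrank k P') :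
    Nonempty (P ≃ₗ[DTaft q ℓ n] P') := by
  let T := LinearMap.toSpanSingleton (DTaft q ℓ n) P v
  let T' := LinearMap.toSpanSingleton (DTaft q ℓ n) P' v'
  have hker : LinearMap.ker T' ≤ LinearMap.ker T := by
    intro X
    simp only [T, T', LinearMap.mem_ker, LinearMap.toSpanSingleton_apply]
    exact fun hX => h.smul_eq_zero_of_smul_eq_zero h' hv' hX
  -- The submodule generated by v' maps onto P by X v' ↦ X v. Equal dimensions then force it to be
  -- all of P' and the map to be bijective.
  let g : LinearMap.range T' →ₗ[DTaft q ℓ n] P :=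
    (LinearMap.ker T').liftQ T hker ∘ₗ T'.quotKerEquivRange.symm.toLinearMap
  have hg : Function.Surjective g := by
    intro x
    obtain ⟨X, hX⟩ := IsSimpleModule.toSpanSingleton_surjective (DTaft q ℓ n) hv x
    refine ⟨T'.quotKerEquivRange (Submodule.Quotient.mk X), ?_⟩
    rw [LinearMap.comp_apply, LinearEquiv.coe_coe, LinearEquiv.symm_apply_apply]
    exact hX
  let R : Submodule k P' := (LinearMap.range T').restrictScalars k
  let gk : R →ₗ[k] P := g.restrictScalars k
  have h1 : Module.finrank k P ≤ Module.finrank k R :=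
    LinearMap.finrank_le_finrank_of_surjective (f := gk) hg
  have h2 : Module.finrank k R ≤ Module.finrank k P' := R.finrank_le
  have hR : R = ⊤ := Submodule.eq_top_of_finrank_eq (by omega)
  have : Module.Finite k P := Module.Finite.of_surjective gk hg
  have hinj : Function.Injective gk :=
    (LinearMap.injective_iff_surjective_of_finrank_eq_finrank (by omega)).2 hg
  have htop : LinearMap.range T' = ⊤ := by
    rw [eq_top_iff]
    intro x _
    have : x ∈ R := hR ▸ Submodule.mem_top
    exact this
  exact ⟨(LinearEquiv.ofBijective g ⟨hinj, hg⟩).symm ≪≫ₗ LinearEquiv.ofTop _ htop⟩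

end uniqueness

end TaftAlgebra

end

noncomputable section

namespace TaftAlgebra

open Coalgebra HopfAlgebra HopfDouble WithConv

/-! ### The modules Ā_{α,β} are standard -/

section simpleMod

variable {k : Type*} [Field k] {q : k} {ℓ n : ℕ} [NeZero ℓ] [hq : Fact (IsPrimitiveRoot q ℓ)]

theorem bullet_K (α : Fin n → ℤ) (i : Fin n) (a : Taft q ℓ n) :
    bullet (Taft.frakK q ℓ α) (Taft.gen q ℓ n (.K i)) a =
      q ^ α i • (Taft.gen q ℓ n (.K i) * (a * Taft.gen q ℓ n (.Kinv i))) := by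
  rw [bullet, LinearMap.comp_apply, Taft.comul₃_K, bulletAux_tmul, Taft.frakK_gen, Taft.sinv_gen]
  rfl

/-- The middle summand K⊗x⊗1 of the twofold coproduct disappears because 𝔎(α) kills x_i. The
negative sign comes from s⁻¹(x_i) = -x_i K(ε_i)⁻¹. -/
theorem bullet_x (α : Fin n → ℤ) (i : Fin n) (a : Taft q ℓ n) :
    bullet (Taft.frakK q ℓ α) (Taft.gen q ℓ n (.x i)) a =
      q ^ α i • (Taft.gen q ℓ n (.x i) * (a * Taft.gen q ℓ n (.Kinv i))) -
        a * (Taft.gen q ℓ n (.x i) * Taft.gen q ℓ n (.Kinv i)) := by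
  rw [bullet, LinearMap.comp_apply, Taft.comul₃_x]
  simp only [map_add, LinearMap.add_apply, bulletAux_tmul, Taft.frakK_gen, Taft.sinv_gen, charGen,
    antiGen', MulOpposite.unop_op, map_one, one_smul, one_mul, zero_smul, zero_add, mul_neg]
  abel

/-- Both terms of the action of x_j are proportional, and moving x_j leftwards past K(β) K(ε_j)^(-s)
costs q^(wt_j - s). The product acquires a zero factor once s reaches κ_j. -/
theorem bullet_x_pow (α β : Fin n → ℤ) (j : Fin n) (m : ℕ) :
    bullet (Taft.frakK q ℓ α) (Taft.gen q ℓ n (.x j) ^ m) (Taft.K q ℓ β).val =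
      (∏ s ∈ Finset.range m, (q ^ α j - q ^ (wt n β j - s))) •
        (Taft.gen q ℓ n (.x j) ^ m * ((Taft.K q ℓ β).val * Taft.gen q ℓ n (.Kinv j) ^ m)) := by
  have hq0 := q_ne_zero hq.out
  induction m with
  | zero => simp [bullet_one]
  | succ m ih =>
    have h1 : Taft.gen q ℓ n (.Kinv j) * Taft.gen q ℓ n (.x j) =
        q⁻¹ • (Taft.gen q ℓ n (.x j) * Taft.gen q ℓ n (.Kinv j)) := by
      rw [Taft.sat.x_Kinv, coef_self, smul_smul, inv_mul_cancel₀ hq0, one_smul]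
    have h2 := pow_mul_q_comm h1 m
    have h3 : Taft.gen q ℓ n (.x j) ^ m *
        ((Taft.K q ℓ β).val * Taft.gen q ℓ n (.Kinv j) ^ m) *
        (Taft.gen q ℓ n (.x j) * Taft.gen q ℓ n (.Kinv j)) =
        q ^ (wt n β j - m) • (Taft.gen q ℓ n (.x j) ^ (m + 1) *
          ((Taft.K q ℓ β).val * Taft.gen q ℓ n (.Kinv j) ^ (m + 1))) := by
      rw [mul_assoc, mul_assoc, ← mul_assoc (Taft.gen q ℓ n (.Kinv j) ^ m), h2, smul_mul_assoc,
        mul_smul_comm, mul_smul_comm, mul_assoc, ← mul_assoc (Taft.K q ℓ β).val, Taft.K_mul_x,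
        smul_mul_assoc, mul_smul_comm, smul_smul, ← pow_succ, mul_assoc, ← mul_assoc (_ ^ m),
        ← pow_succ]
      congr 1
      rw [sub_eq_add_neg, zpow_add₀ hq0, zpow_neg, zpow_natCast, inv_pow, mul_comm]
    rw [pow_succ', bullet_mul, ih, map_smul, bullet_x, h3, Finset.prod_range_succ, mul_smul]
    congr 1
    rw [sub_smul, ← pow_succ']
    congr 2
    rw [mul_assoc, mul_assoc, ← pow_succ, ← mul_assoc, ← pow_succ']

/-- The generator `K(β)` of the module `Ā_{α,β}`. -/
def simpleGen (α β : Fin n → ℤ) : simpleMod q ℓ α β :=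
  ⟨(Taft.K q ℓ β).val, 1, bullet_one (H := Taft q ℓ n) k _ _⟩

theorem simpleMod_inr_smul (α β : Fin n → ℤ) (h : Taft q ℓ n) :
    ((Double.inr k h • simpleGen (q := q) (ℓ := ℓ) α β : simpleMod q ℓ α β) :
      Twisted k (Taft q ℓ n) (Taft.frakK q ℓ α)) =
      bullet (H := Taft q ℓ n) (Taft.frakK q ℓ α) h (Taft.K q ℓ β).val :=
  hit_one (H := Taft q ℓ n) k _

theorem simpleMod_inl_smul (α β : Fin n → ℤ) (p : HStar k (Taft q ℓ n)) :
    ((Double.inl k p • simpleGen (q := q) (ℓ := ℓ) α β : simpleMod q ℓ α β) :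
      Twisted k (Taft q ℓ n) (Taft.frakK q ℓ α)) = hit (H := Taft q ℓ n) k p (Taft.K q ℓ β).val := by
  change hit (H := Taft q ℓ n) k p (bullet (Taft.frakK q ℓ α) 1 (Taft.K q ℓ β).val) = _
  rw [bullet_one]

theorem isStandard_simpleGen (α β : Fin n → ℤ) :
    IsStandard q ℓ α β (simpleGen (q := q) (ℓ := ℓ) α β) where
  isLow :=
    { inl_smul := fun p => Subtype.ext <| by
        rw [simpleMod_inl_smul, hit_groupLike]; rfl
      dK_smul := fun i => Subtype.ext <| by
        rw [dK, simpleMod_inr_smul, bullet_K, ← mul_assoc, ← Taft.K_mul_gen, mul_assoc,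
          Taft.sat.K_Kinv, mul_one]
        rfl }
  ne_zero h0 := by
    have h1 : (Taft.K q ℓ β).val = 0 := congrArg Subtype.val h0
    have h2 := Taft.frakK_K (q := q) (ℓ := ℓ) 0 β
    rw [h1, map_zero] at h2
    exact zpow_ne_zero _ (q_ne_zero hq.out) h2.symm
  generates u := by
    obtain ⟨_, h, rfl⟩ := u
    exact ⟨Double.inr k h, Subtype.ext (simpleMod_inr_smul α β h)⟩
  dX_pow_smul j := Subtype.ext <| by
    rw [dX, ← map_pow, simpleMod_inr_smul, bullet_x_pow, Finset.prod_range_succ]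
    have h1 := kappa_nonneg (ℓ := ℓ) α β j
    -- The last of the κ_j + 1 factors vanishes, since κ_j ≡ wt_j - α_j modulo ℓ.
    have h2 : q ^ α j = q ^ (wt n β j - (kappa ℓ α β j).toNat) := by
      refine (zpow_eq_of_dvd (ℓ := ℓ) ?_).symm
      rw [Int.toNat_of_nonneg h1, sub_right_comm]
      exact dvd_wt_sub_kappa α β j
    rw [h2, sub_self, mul_zero, zero_smul]
    rfl

end simpleMod

/-! ### Congruences modulo an odd ℓ -/

section arithmetic

variable {ℓ n : ℕ}

theorem eq_of_mem_box {α β : Fin n → ℤ} (hα : α ∈ box ℓ n) (hβ : β ∈ box ℓ n)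
    (h : ∀ i, (ℓ : ℤ) ∣ α i - β i) : α = β := by
  ext i
  have h1 := hα i
  have h2 := hβ i
  have := Int.eq_zero_of_abs_lt_dvd (h i) (by rw [abs_lt]; constructor <;> omega)
  omega

theorem dvd_red_sub (α : Fin n → ℤ) (i : Fin n) : (ℓ : ℤ) ∣ red ℓ α i - α i := by
  rw [← dvd_neg, neg_sub]; exact Int.dvd_self_sub_emod

theorem red_mem_box [NeZero ℓ] (α : Fin n → ℤ) : red ℓ α ∈ box ℓ n := fun i =>
  ⟨Int.emod_nonneg _ (by exact_mod_cast NeZero.ne ℓ),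
    Int.le_sub_one_of_lt (Int.emod_lt_of_pos _ (by exact_mod_cast NeZero.pos ℓ))⟩

theorem eq_red_iff [NeZero ℓ] {α β : Fin n → ℤ} (hα : α ∈ box ℓ n) :
    α = red ℓ β ↔ ∀ i, (ℓ : ℤ) ∣ α i - β i := by
  constructor
  · rintro rfl i; exact dvd_red_sub β i
  · intro h
    refine eq_of_mem_box hα (red_mem_box β) fun i => ?_
    have := dvd_sub (h i) (dvd_red_sub (ℓ := ℓ) β i)
    rwa [sub_sub_sub_cancel_right] at this

theorem dvd_of_dvd_two_mul (hℓ : Odd ℓ) {a : ℤ} (h : (ℓ : ℤ) ∣ 2 * a) : (ℓ : ℤ) ∣ a := by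
  refine IsCoprime.dvd_of_dvd_mul_left ?_ h
  exact_mod_cast Nat.isCoprime_iff_coprime.2 (Nat.coprime_two_right.2 hℓ)

/-- This is where i₀ = (ℓ + 1)/2 is seen to be the inverse of 2 modulo ℓ. -/
theorem two_mul_half (hℓ : Odd ℓ) : (2 : ℤ) * (((ℓ + 1) / 2 : ℕ) : ℤ) = ℓ + 1 := by
  obtain ⟨m, rfl⟩ := hℓ
  omega

theorem dvd_tilde {γ : Fin n → ℤ} (h : ∀ i, (ℓ : ℤ) ∣ γ i) (i : Fin n) : (ℓ : ℤ) ∣ tilde γ i := by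
  rw [tilde_eq_sum]
  exact Finset.dvd_sum fun j _ => Dvd.dvd.mul_left (h j) _

theorem tilde_sub_two_mul (γ β : Fin n → ℤ) (i : Fin n) :
    tilde (fun i => γ i - 2 * β i) i = tilde γ i - 2 * tilde β i := by
  simp only [tilde_eq_sum, Finset.mul_sum, ← Finset.sum_sub_distrib]
  exact Finset.sum_congr rfl fun j _ => by ring

theorem kappa_mem_box [NeZero ℓ] (α β : Fin n → ℤ) : kappa ℓ α β ∈ box ℓ n := red_mem_box _

/-- If `α ≡ -β̃` then `κ(α, β) ≡ 2β`. -/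
theorem dvd_kappa_sub [NeZero ℓ] {α β : Fin n → ℤ} (hα : ∀ i, (ℓ : ℤ) ∣ α i + tilde β i)
    (i : Fin n) : (ℓ : ℤ) ∣ kappa ℓ α β i - 2 * β i := by
  have h1 := dvd_add (hα i) (dvd_wt_sub_kappa (ℓ := ℓ) α β i)
  rw [← dvd_neg]
  convert h1 using 1
  linarith [wt_add_tilde β i]

/-- The congruence `β ≡ ((ℓ+1)/2) r` says `r ≡ 2β`. -/
theorem dvd_sub_half_mul_iff (hℓ : Odd ℓ) (b r : ℤ) :
    (ℓ : ℤ) ∣ b - ((ℓ + 1) / 2 : ℕ) * r ↔ (ℓ : ℤ) ∣ r - 2 * b := by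
  have h := two_mul_half hℓ
  generalize (((ℓ + 1) / 2 : ℕ) : ℤ) = i₀ at h
  have e : 2 * (b - i₀ * r) = -(r - 2 * b) - ℓ * r := by linear_combination -r * h
  constructor
  · intro h1
    have h2 := Dvd.dvd.mul_left h1 2
    rw [e] at h2
    exact (dvd_neg.1 ((dvd_sub_left (Dvd.intro r rfl)).1 h2))
  · intro h1
    refine dvd_of_dvd_two_mul hℓ ?_
    rw [e]
    exact dvd_sub (dvd_neg.2 h1) (Dvd.intro r rfl)

end arithmetic

/-! ### The criterion for self-duality -/

section selfDual

variable {k : Type*} [Field k] [CharZero k] {q : k} {ℓ n : ℕ} [NeZero ℓ]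
  [hq : Fact (IsPrimitiveRoot q ℓ)]

/-- The modules `Ā_{α,β}` are self-dual exactly for `α ≡ -β̃`. -/
theorem isSelfDual_simpleMod_iff (hℓ : Odd ℓ) (α β : Fin n → ℤ) :
    IsSelfDual k (Taft q ℓ n) (simpleMod q ℓ α β) ↔ ∀ i, (ℓ : ℤ) ∣ α i + tilde β i := by
  have hstd := isStandard_simpleGen (q := q) (ℓ := ℓ) α β
  constructor
  · rintro ⟨φ⟩
    obtain ⟨h1, h2⟩ := hstd.weights_of_isLow_dual (hstd.isLow.map φ.toLinearMap)
      (by simpa using hstd.ne_zero)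
    intro i
    -- The image of the generator is a lowest weight functional of the same weight (α, β). Comparing
    -- with the weight of the dual gives κ ≡ 2β and 2α ≡ -κ̃, hence 2(α + β̃) ≡ 0, and 2 is
    -- invertible.
    have h3 : ∀ i, (ℓ : ℤ) ∣ kappa ℓ α β i - 2 * β i := fun i => by
      rw [← dvd_neg, show -(kappa ℓ α β i - 2 * β i) = β i + β i - kappa ℓ α β i by ring]
      exact h1 i
    have h4 := dvd_tilde h3 i
    rw [tilde_sub_two_mul] at h4
    refine dvd_of_dvd_two_mul hℓ ?_
    rw [show 2 * (α i + tilde β i) = α i + α i + tilde (kappa ℓ α β) i -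
      (tilde (kappa ℓ α β) i - 2 * tilde β i) by ring]
    exact dvd_sub (h2 i) h4
  · intro hα
    have h1 := dvd_kappa_sub (ℓ := ℓ) hα
    have h2 := dvd_tilde h1
    have hfin := hstd.finite
    have hsimple := hstd.isSimpleModule
    obtain ⟨f₀, hf₀⟩ : ∃ f : Module.Dual k (simpleMod q ℓ α β), f ≠ 0 := by
      by_contra! h0
      exact hstd.ne_zero ((Module.forall_dual_apply_eq_zero_iff k _).1 fun f => by rw [h0 f]; rfl)
    obtain ⟨α', β', f, hf0, hf⟩ := exists_isLow (q := q) (ℓ := ℓ) (n := n)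
      (P := Contragredient k (Taft q ℓ n) (simpleMod q ℓ α β)) (v := f₀) hf₀
    obtain ⟨h3, h4⟩ := hstd.weights_of_isLow_dual hf hf0
    -- With κ ≡ 2β and α ≡ -β̃, the lowest weight (-α - κ̃, κ - β) of the dual reduces to (α, β).
    have hf' : IsLow (q := q) (ℓ := ℓ) α β f := by
      refine hf.congr (fun i => ?_) (fun i => ?_)
      · have h5 := h2 i
        rw [tilde_sub_two_mul] at h5
        rw [show α' i - α i = α' i + α i + tilde (kappa ℓ α β) i -
          (tilde (kappa ℓ α β) i - 2 * tilde β i) - 2 * (α i + tilde β i) by ring]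
        exact dvd_sub (dvd_sub (h4 i) h5) (Dvd.dvd.mul_left (hα i) 2)
      · rw [show β' i - β i = β' i + β i - kappa ℓ α β i + (kappa ℓ α β i - 2 * β i) by ring]
        exact dvd_add (h3 i) (h1 i)
    have hfinDual : Module.Finite k (Contragredient k (Taft q ℓ n) (simpleMod q ℓ α β)) :=
      inferInstanceAs (Module.Finite k (Module.Dual k (simpleMod q ℓ α β)))
    -- A space and its dual have the same dimension, so simplicity of the dual does not have to be
    -- established first.
    exact hstd.isLow.nonempty_linearEquiv_of_finrank_eq hf' hstd.ne_zero hf0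
      (Subspace.dual_finrank_eq (K := k) (V := simpleMod q ℓ α β)).symm

/-- The condition β ≡ i₀ r says r ≡ 2β, so r always exists and is unique in the box. Only α ≡ -β̃
restricts the pair, and under it r = κ(α, β). -/
theorem isSelfDual_simpleMod_iff_existsUnique (hℓ : Odd ℓ) {α β : Fin n → ℤ} (hα : α ∈ box ℓ n)
    (hβ : β ∈ box ℓ n) : IsSelfDual k (Taft q ℓ n) (simpleMod q ℓ α β) ↔
      ∃! r : Fin n → ℤ, r ∈ box ℓ n ∧ β = red ℓ (fun i => ((ℓ + 1) / 2 : ℕ) * r i) ∧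
        α = red ℓ (-tilde β) := by
  rw [isSelfDual_simpleMod_iff hℓ]
  simp only [eq_red_iff hβ, eq_red_iff hα, Pi.neg_apply, sub_neg_eq_add, dvd_sub_half_mul_iff hℓ]
  constructor
  · intro h
    refine ⟨kappa ℓ α β, ⟨kappa_mem_box α β, dvd_kappa_sub h, h⟩, fun r hr => ?_⟩
    refine eq_of_mem_box hr.1 (kappa_mem_box α β) fun i => ?_
    have := dvd_sub (hr.2.1 i) (dvd_kappa_sub h i)
    rwa [sub_sub_sub_cancel_right] at this
  · rintro ⟨r, hr, -⟩
    exact hr.2.2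

end selfDual

end TaftAlgebra

end
-- The classification theorem
open HopfDouble TaftAlgebra in
theorem theorem5p3 {k : Type*} [Field k] [IsAlgClosed k] [CharZero k] (n ℓ : ℕ) [NeZero ℓ]
    (hℓ : Odd ℓ) (q : k) [Fact (IsPrimitiveRoot q ℓ)] :
    -- the modules `Ā_{α,β}` are simple, the criterion for self-duality, and the dimension
    (∀ α ∈ box ℓ n, ∀ β ∈ box ℓ n,
      IsSimpleModule (DTaft q ℓ n) (simpleMod q ℓ α β) ∧
      (IsSelfDual k (Taft q ℓ n) (simpleMod q ℓ α β) ↔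
        ∃! r : Fin n → ℤ, r ∈ box ℓ n ∧
          β = red ℓ (fun i => ((ℓ + 1) / 2 : ℕ) * r i) ∧ α = red ℓ (-tilde β)) ∧
      (∀ r ∈ box ℓ n,
        β = red ℓ (fun i => ((ℓ + 1) / 2 : ℕ) * r i) → α = red ℓ (-tilde β) →
          kappa ℓ α β = r ∧
          (Module.finrank k (simpleMod q ℓ α β) : ℤ) = ∏ i, (r i + 1))) ∧
    -- self-dual simple modules are classified by the tuple `κ(α,β)`
    (∀ α ∈ box ℓ n, ∀ β ∈ box ℓ n, ∀ α' ∈ box ℓ n, ∀ β' ∈ box ℓ n,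
      IsSelfDual k (Taft q ℓ n) (simpleMod q ℓ α β) →
      IsSelfDual k (Taft q ℓ n) (simpleMod q ℓ α' β') →
      (Nonempty (simpleMod q ℓ α β ≃ₗ[DTaft q ℓ n] simpleMod q ℓ α' β') ↔
        kappa ℓ α β = kappa ℓ α' β')) ∧
    (∀ r ∈ box ℓ n, ∃ α ∈ box ℓ n, ∃ β ∈ box ℓ n,
      IsSelfDual k (Taft q ℓ n) (simpleMod q ℓ α β) ∧ kappa ℓ α β = r) ∧
    (∀ (M : Type*) [AddCommGroup M] [Module k M] [Module (DTaft q ℓ n) M]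
      [IsScalarTower k (DTaft q ℓ n) M],
      IsSimpleModule (DTaft q ℓ n) M → IsSelfDual k (Taft q ℓ n) M →
      ∃! r : Fin n → ℤ, r ∈ box ℓ n ∧ ∃ α ∈ box ℓ n, ∃ β ∈ box ℓ n,
        kappa ℓ α β = r ∧ Nonempty (M ≃ₗ[DTaft q ℓ n] simpleMod q ℓ α β)) := by
  have hkey : ∀ α ∈ box ℓ n, ∀ β ∈ box ℓ n, ∀ r ∈ box ℓ n,
      β = red ℓ (fun i => ((ℓ + 1) / 2 : ℕ) * r i) → α = red ℓ (-tilde β) → kappa ℓ α β = r := by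
    intro α hα β hβ r hr h1 h2
    rw [eq_red_iff hβ] at h1
    rw [eq_red_iff hα] at h2
    simp only [dvd_sub_half_mul_iff hℓ] at h1
    simp only [Pi.neg_apply, sub_neg_eq_add] at h2
    refine eq_of_mem_box (kappa_mem_box α β) hr fun i => ?_
    have := dvd_sub (dvd_kappa_sub h2 i) (h1 i)
    rwa [sub_sub_sub_cancel_right] at this
  have hiso : ∀ α ∈ box ℓ n, ∀ β ∈ box ℓ n, ∀ α' ∈ box ℓ n, ∀ β' ∈ box ℓ n,
      Nonempty (simpleMod q ℓ α β ≃ₗ[DTaft q ℓ n] simpleMod q ℓ α' β') → α = α' ∧ β = β' := by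
    rintro α hα β hβ α' hα' β' hβ' ⟨φ⟩
    obtain ⟨h1, h2⟩ := (isStandard_simpleGen α β).weights_of_linearEquiv
      (isStandard_simpleGen α' β') φ
    exact ⟨eq_of_mem_box hα hα' h1, eq_of_mem_box hβ hβ' h2⟩
  refine ⟨fun α hα β hβ => ⟨(isStandard_simpleGen α β).isSimpleModule,
    isSelfDual_simpleMod_iff_existsUnique hℓ hα hβ, fun r hr h1 h2 => ?_⟩, ?_, ?_, ?_⟩
  · have h3 := hkey α hα β hβ r hr h1 h2
    exact ⟨h3, by rw [(isStandard_simpleGen α β).finrank_eq, h3]⟩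
  · intro α hα β hβ α' hα' β' hβ' hs hs'
    constructor
    · intro h
      obtain ⟨rfl, rfl⟩ := hiso α hα β hβ α' hα' β' hβ' h
      rfl
    · intro h
      rw [isSelfDual_simpleMod_iff hℓ] at hs hs'
      -- For self-dual modules κ ≡ 2β, so κ determines β because ℓ is odd, and then α ≡ -β̃ is
      -- determined as well.
      have hββ : β = β' := by
        refine eq_of_mem_box hβ hβ' fun i => dvd_of_dvd_two_mul hℓ ?_
        rw [show 2 * (β i - β' i) =
          kappa ℓ α' β' i - 2 * β' i - (kappa ℓ α β i - 2 * β i) by rw [h]; ring]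
        exact dvd_sub (dvd_kappa_sub hs' i) (dvd_kappa_sub hs i)
      subst hββ
      have hαα : α = α' := by
        refine eq_of_mem_box hα hα' fun i => ?_
        have := dvd_sub (hs i) (hs' i)
        rwa [add_sub_add_right_eq_sub] at this
      subst hαα
      exact ⟨LinearEquiv.refl _ _⟩
  · intro r hr
    set β : Fin n → ℤ := red ℓ (fun i => ((ℓ + 1) / 2 : ℕ) * r i) with hβ
    have hβm : β ∈ box ℓ n := red_mem_box _
    refine ⟨red ℓ (-tilde β), red_mem_box _, β, hβm, ?_,
      hkey _ (red_mem_box _) β hβm r hr hβ rfl⟩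
    rw [isSelfDual_simpleMod_iff hℓ]
    intro i
    have := dvd_red_sub (ℓ := ℓ) (-tilde β) i
    rwa [Pi.neg_apply, sub_neg_eq_add] at this
  · intro M _ _ _ _ hM _
    have hnt := hM.nontrivial
    obtain ⟨v₀, hv₀⟩ := exists_ne (0 : M)
    -- The simple module has a lowest weight, which may be reduced into the box. The module Ā with
    -- that weight is simple too, hence isomorphic to it. Uniqueness of r follows because isomorphic
    -- modules Ā have equal parameters.
    obtain ⟨α, β, v, hv, hlow⟩ := exists_isLow (q := q) (ℓ := ℓ) (n := n) hv₀
    have hlow' : IsLow (q := q) (ℓ := ℓ) (red ℓ α) (red ℓ β) v :=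
      hlow.congr (fun i => by rw [← dvd_neg, neg_sub]; exact dvd_red_sub α i)
        (fun i => by rw [← dvd_neg, neg_sub]; exact dvd_red_sub β i)
    have hstd := isStandard_simpleGen (q := q) (ℓ := ℓ) (red ℓ α) (red ℓ β)
    have hsimple := hstd.isSimpleModule
    have hφ := hlow'.nonempty_linearEquiv hstd.isLow hv hstd.ne_zero
    refine ⟨kappa ℓ (red ℓ α) (red ℓ β), ⟨kappa_mem_box _ _, _, red_mem_box α, _, red_mem_box β,
      rfl, hφ⟩, ?_⟩
    rintro r ⟨-, α', hα', β', hβ', rfl, ⟨ψ⟩⟩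
    obtain ⟨φ⟩ := hφ
    obtain ⟨h1, h2⟩ := hiso _ hα' _ hβ' _ (red_mem_box α) _ (red_mem_box β) ⟨ψ.symm ≪≫ₗ φ⟩
    rw [h1, h2]
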